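/- Let $k$ be a field. A dg vector space is a $\mathbb Z$-graded $k$-vector space with a differential $d$ of degree $-1$, $d^2=0$; dg vector spaces form a closed symmetric monoidal category with the usual tensor product, the Koszul sign rule for the symmetry, and internal hom $[V,W]$ (in degree $n$: the linear maps of degree $n$; $\partial f=df-(-1)^{|f|}fd$). Let $\mathsf{DGA}_0$ be the category of non-unital associative dg algebras over $k$. Let $\mathsf{cDGA}$ be the category of conilpotent non-counital coassociative dg coalgebras over $k$, i.e. those coalgebras $C$ such that every $x\in C$ is annihilated by some iterated comultiplication $\Delta^n:C\to C^{\otimes(n+1)}$; it is a symmetric semi-monoidal category (symmetric monoidal without unit) under the tensor product $\otimes$ of dg coalgebras. For $C\in\mathsf{cDGA}$ and $A\in\mathsf{DGA}_0$ let $\{C,A\}$ be the convolution algebra: the dg vector space $[C,A]$ with product $f*g=\mu_A\circ(f\otimes g)\circ\Delta_C$. This defines a functor $\{-,-\}:\mathsf{cDGA}^{op}\times\mathsf{DGA}_0\to\mathsf{DGA}_0$. A module over a symmetric semi-monoidal category $\mathcal V$ is a category $\mathcal M$ with a functor $\rhd:\mathcal V\times\mathcal M\to\mathcal M$ and a natural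 isomorphism $a:(X\otimes Y)\rhd A\to X\rhd(Y\rhd A)$ satisfying the pentagon axiom: the two composites $((X\otimes Y)\otimes Z)\rhd A\to X\rhd(Y\rhd(Z\rhd A))$ built from $a$ and the associator of $\mathcal V$ agree. It is closed, with enrichment $\overline{\mathcal M}:\mathcal M^{op}\times\mathcal M\to\mathcal V$ and cotensoring $[-,-]:\mathcal V^{op}\times\mathcal M\to\mathcal M$, if $[X,-]$ is right adjoint to $X\rhd-$ and $\overline{\mathcal M}(A,-)$ is right adjoint to $-\rhd A$, by bijections natural in all variables. **Theorem.** $(\mathsf{DGA}_0,\rhd,\overline{\mathsf{DGA}}_0,\{-,-\})$ is a closed $\mathsf{cDGA}$-module. In detail: 1. There exist functors $\rhd:\mathsf{cDGA}\times\mathsf{DGA}_0\to\mathsf{DGA}_0$ and $\overline{\mathsf{DGA}}_0:\mathsf{DGA}_0^{op}\times\mathsf{DGA}_0\to\mathsf{cDGA}$ with bijections $$\mathrm{Hom}(A,\{C,B\})\;\cong\;\mathrm{Hom}(C\rhd A,B)\;\cong\;\mathrm{Hom}(C,\overline{\mathsf{DGA}}_0(A,B))$$ natural in $C\in\mathsf{cDGA}$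 and $A,B\in\mathsf{DGA}_0$. 2. Let $\rhd$, $\overline{\mathsf{DGA}}_0$ and natural bijections as in 1 be given, and let $u:C\otimes A\to C\rhd A$ be the map of dg vector spaces that corresponds, under the tensor-hom adjunction, to the unit $A\to\{C,C\rhd A\}$ of the first bijection. For all $C,D\in\mathsf{cDGA}$ and $A\in\mathsf{DGA}_0$ there is exactly one algebra map $a:(C\otimes D)\rhd A\to C\rhd(D\rhd A)$ with $$a\circ u=u\circ(1_C\otimes u)\circ\alpha,$$ where $\alpha:(C\otimes D)\otimes A\to C\otimes(D\otimes A)$ is the associator of dg vector spaces. The maps $a$ are isomorphisms, are natural in $C$, $D$ and $A$, and satisfy the pentagon axiom, so that $\rhd$, $a$, $\overline{\mathsf{DGA}}_0$, $\{-,-\}$ and the given bijections form a closed $\mathsf{cDGA}$-module. 3. In the situation of 2, for every $B\in\mathsf{DGA}_0$ the functor $\overline{\mathsf{DGA}}_0(-,B):\mathsf{DGA}_0^{op}\to\mathsf{cDGA}$ is right adjoint to $\{-,B\}^{op}:\mathsf{cDGA}\to\mathsf{DGA}_0^{op}$, by the composite of the given bijections. -/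

import Mathlib

open CategoryTheory MonoidalCategory Opposite
open scoped TensorProduct
universe u

/-- The Koszul sign `(-1)ⁿ`, as an element of the ground field. -/
def koszulSign (k : Type u) [Field k] (n : ℤ) : k := ((n.negOnePow : ℤ) : k)

section koszulSign

variable (k : Type u) [Field k]

lemma koszulSign_zero : koszulSign k 0 = 1 := by simp [koszulSign]

lemma koszulSign_add (m n : ℤ) : koszulSign k (m + n) = koszulSign k m * koszulSign k n := by
  simp [koszulSign, Int.negOnePow_add]

lemma koszulSign_neg (n : ℤ) : koszulSign k (-n) = koszulSign k n := by
  simp [koszulSign, Int.negOnePow_neg]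

lemma koszulSign_sub (m n : ℤ) : koszulSign k (m - n) = koszulSign k m * koszulSign k n := by
  simp [koszulSign, Int.negOnePow_sub]

lemma koszulSign_one : koszulSign k 1 = -1 := by simp [koszulSign]

lemma koszulSign_mul_self (n : ℤ) : koszulSign k n * koszulSign k n = 1 := by
  rw [← koszulSign_add, koszulSign, Int.negOnePow_even _ ⟨n, rfl⟩]
  simp

end koszulSign

/-- A differential graded vector space over `k` (homological, `ℤ`-graded): a vector space which is
the internal direct sum of its homogeneous components `gr n`, `n : ℤ`, with a square-zero
differential of degree `-1`. -/
structure DGVec (k : Type u) [Field k] where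
  /-- the total space -/
  carrier : Type u
  [addCommGroup : AddCommGroup carrier]
  [module : Module k carrier]
  /-- the homogeneous components -/
  gr : ℤ → Submodule k carrier
  internal : DirectSum.IsInternal gr
  /-- the differential -/
  d : carrier →ₗ[k] carrier
  d_mem : ∀ (n : ℤ) (x : carrier), x ∈ gr n → d x ∈ gr (n - 1)
  d_d : ∀ x : carrier, d (d x) = 0

namespace DGVec

variable {k : Type u} [Field k]

instance : CoeSort (DGVec k) (Type u) := ⟨DGVec.carrier⟩

attribute [instance] DGVec.addCommGroup DGVec.module

/-- The linear map on `V` which restricts to `φ n` on the homogeneous component of degree `n`. -/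
noncomputable def desc (V : DGVec k) {X : Type*} [AddCommGroup X] [Module k X]
    (φ : ℤ → V →ₗ[k] X) : V →ₗ[k] X :=
  DirectSum.toModule k ℤ X (fun n => φ n ∘ₗ (V.gr n).subtype) ∘ₗ
    (LinearEquiv.ofBijective (DirectSum.coeLinearMap V.gr) V.internal).symm.toLinearMap

lemma desc_apply (V : DGVec k) {X : Type*} [AddCommGroup X] [Module k X]
    (φ : ℤ → V →ₗ[k] X) {n : ℤ} {x : V} (hx : x ∈ V.gr n) : V.desc φ x = φ n x := by
  have h : (LinearEquiv.ofBijective (DirectSum.coeLinearMap V.gr) V.internal).symm x =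
      DirectSum.lof k ℤ (fun n => V.gr n) n ⟨x, hx⟩ := by
    rw [LinearEquiv.symm_apply_eq]
    exact (DirectSum.coeLinearMap_lof V.gr n ⟨x, hx⟩).symm
  simp only [desc, LinearMap.comp_apply, LinearEquiv.coe_coe, h, DirectSum.toModule_lof,
    Submodule.subtype_apply]

lemma homog_induction (V : DGVec k) {P : V → Prop} (h0 : P 0)
    (hadd : ∀ x y, P x → P y → P (x + y)) (hom : ∀ n, ∀ x ∈ V.gr n, P x) (x : V) : P x := by
  have hx : x ∈ ⨆ n, V.gr n := by
    rw [V.internal.submodule_iSup_eq_top]; trivial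
  exact Submodule.iSup_induction V.gr (motive := P) hx hom h0 hadd

lemma ext_homog (V : DGVec k) {X : Type*} [AddCommGroup X] [Module k X] {f g : V →ₗ[k] X}
    (h : ∀ n, ∀ x ∈ V.gr n, f x = g x) : f = g := by
  ext x
  induction x using V.homog_induction with
  | h0 => simp
  | hadd x y hx hy => simp [hx, hy]
  | hom n x hx => exact h n x hx

lemma ext_homog₂ (V W : DGVec k) {X : Type*} [AddCommGroup X] [Module k X]
    {f g : V ⊗[k] W →ₗ[k] X}
    (h : ∀ m, ∀ x ∈ V.gr m, ∀ n, ∀ y ∈ W.gr n, f (x ⊗ₜ y) = g (x ⊗ₜ y)) : f = g := by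
  apply TensorProduct.ext
  apply ext_homog
  intro m x hx
  apply ext_homog
  intro n y hy
  exact h m x hx n y hy

/-- A criterion for a family of submodules to be an internal grading. -/
lemma isInternal_of_detect {X : Type*} [AddCommGroup X] [Module k X] (gr : ℤ → Submodule k X)
    (hspan : iSup gr = ⊤) {J : Type*} {Y : Type*} [AddCommGroup Y] [Module k Y]
    (π : J → X →ₗ[k] Y) (deg : J → ℤ)
    (h0 : ∀ j m, m ≠ deg j → ∀ x ∈ gr m, π j x = 0)
    (hinj : ∀ x, (∀ j, π j x = 0) → x = 0) : DirectSum.IsInternal gr := by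
  rw [DirectSum.isInternal_submodule_iff_iSupIndep_and_iSup_eq_top]
  refine ⟨fun n => ?_, hspan⟩
  rw [Submodule.disjoint_def]
  intro x hx hx'
  refine hinj x fun j => ?_
  by_cases hj : n = deg j
  · have : (⨆ m, ⨆ (_ : m ≠ n), gr m) ≤ LinearMap.ker (π j) := by
      refine iSup₂_le fun m hm y hy => ?_
      exact h0 j m (by rw [← hj]; exact hm) y hy
    exact this hx'
  · exact h0 j n hj x hx

/-- The operator which multiplies the component of degree `n` by the scalar `s n`. -/
noncomputable def scale (V : DGVec k) (s : ℤ → k) : V →ₗ[k] V :=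
  V.desc fun n => s n • LinearMap.id

lemma scale_apply (V : DGVec k) (s : ℤ → k) {n : ℤ} {x : V} (hx : x ∈ V.gr n) :
    V.scale s x = s n • x := by
  simp [scale, V.desc_apply _ hx]

/-- The projection onto the homogeneous component of degree `n`. -/
noncomputable def proj (V : DGVec k) (n : ℤ) : V →ₗ[k] V := V.scale (Pi.single n 1)

lemma proj_self (V : DGVec k) {n : ℤ} {x : V} (hx : x ∈ V.gr n) : V.proj n x = x := by
  simp [proj, V.scale_apply _ hx]

lemma proj_ne (V : DGVec k) {m n : ℤ} (h : m ≠ n) {x : V} (hx : x ∈ V.gr m) :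
    V.proj n x = 0 := by
  simp [proj, V.scale_apply _ hx, h]

lemma exists_sum_proj (V : DGVec k) (x : V) :
    ∃ s : Finset ℤ, ∀ t, s ⊆ t → ∑ n ∈ t, V.proj n x = x := by
  induction x using V.homog_induction with
  | h0 => exact ⟨∅, by simp⟩
  | hadd x y hx hy =>
    obtain ⟨s, hs⟩ := hx
    obtain ⟨s', hs'⟩ := hy
    refine ⟨s ∪ s', fun t ht => ?_⟩
    simp [Finset.sum_add_distrib, hs t (Finset.union_subset_left ht),
      hs' t (Finset.union_subset_right ht)]
  | hom n x hx =>
    refine ⟨{n}, fun t ht => ?_⟩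
    rw [Finset.sum_eq_single n]
    · exact V.proj_self hx
    · intro b _ hb
      exact V.proj_ne hb.symm hx
    · intro h
      exact absurd (ht (by simp)) h

lemma eq_zero_of_proj (V : DGVec k) (x : V) (h : ∀ n, V.proj n x = 0) : x = 0 := by
  obtain ⟨s, hs⟩ := V.exists_sum_proj x
  rw [← hs s subset_rfl]
  simp [h]

/-- Morphisms of dg vector spaces: linear maps of degree `0` commuting with the differentials. -/
@[ext]
structure Hom (V W : DGVec k) where
  /-- the underlying linear map -/
  lin : V →ₗ[k] W
  map_mem : ∀ (n : ℤ) (x : V), x ∈ V.gr n → lin x ∈ W.gr n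
  map_d : ∀ x : V, lin (V.d x) = W.d (lin x)

instance : Category (DGVec k) where
  Hom := Hom
  id V := ⟨LinearMap.id, fun _ _ h => h, fun _ => rfl⟩
  comp f g := ⟨g.lin ∘ₗ f.lin, fun n x h => g.map_mem n _ (f.map_mem n x h),
    fun x => by simp [f.map_d, g.map_d]⟩

lemma hom_ext {V W : DGVec k} {f g : V ⟶ W} (h : f.lin = g.lin) : f = g := Hom.ext h

@[simp] lemma id_lin (V : DGVec k) : Hom.lin (𝟙 V) = LinearMap.id := rfl

@[simp] lemma comp_lin {U V W : DGVec k} (f : U ⟶ V) (g : V ⟶ W) :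
    (f ≫ g).lin = g.lin ∘ₗ f.lin := rfl

lemma Hom.lin_scale {V W : DGVec k} (f : V ⟶ W) (s : ℤ → k) :
    f.lin ∘ₗ V.scale s = W.scale s ∘ₗ f.lin := by
  apply ext_homog
  intro n x hx
  simp [V.scale_apply s hx, W.scale_apply s (f.map_mem n x hx)]

/-- An isomorphism of dg vector spaces from a linear equivalence. -/
def mkIso {V W : DGVec k} (e : V ≃ₗ[k] W) (h : ∀ (n : ℤ) (x : V), x ∈ V.gr n → e x ∈ W.gr n)
    (h' : ∀ (n : ℤ) (x : W), x ∈ W.gr n → e.symm x ∈ V.gr n)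
    (hd : ∀ x : V, e (V.d x) = W.d (e x)) : V ≅ W where
  hom := ⟨e.toLinearMap, h, hd⟩
  inv := ⟨e.symm.toLinearMap, h', fun x => by
    apply e.injective
    simp [hd]⟩
  hom_inv_id := hom_ext (by ext x; simp)
  inv_hom_id := hom_ext (by ext x; simp)

/-! ### The tensor product -/

/-- The component of degree `n` of `V ⊗ W` is spanned by the `x ⊗ y` with `|x| + |y| = n`. -/
def tensorGr (V W : DGVec k) (n : ℤ) : Submodule k (V ⊗[k] W) :=
  ⨆ (p : ℤ) (q : ℤ) (_ : p + q = n), Submodule.map₂ (TensorProduct.mk k V W) (V.gr p) (W.gr q)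

lemma tmul_mem_tensorGr (V W : DGVec k) {p q n : ℤ} (h : p + q = n) {x : V} {y : W}
    (hx : x ∈ V.gr p) (hy : y ∈ W.gr q) : x ⊗ₜ[k] y ∈ tensorGr V W n := by
  have h1 : Submodule.map₂ (TensorProduct.mk k V W) (V.gr p) (W.gr q) ≤ tensorGr V W n :=
    le_iSup_of_le p (le_iSup_of_le q (le_iSup_of_le h le_rfl))
  exact h1 (Submodule.apply_mem_map₂ _ hx hy)

lemma tensorGr_le (V W : DGVec k) {n : ℤ} {S : Submodule k (V ⊗[k] W)}
    (h : ∀ p q, p + q = n → ∀ x ∈ V.gr p, ∀ y ∈ W.gr q, x ⊗ₜ[k] y ∈ S) :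
    tensorGr V W n ≤ S := by
  refine iSup_le fun p => iSup_le fun q => iSup_le fun hpq => ?_
  rw [Submodule.map₂_le]
  exact h p q hpq

lemma tensorGr_induction (V W : DGVec k) {n : ℤ} {X : Type*} [AddCommGroup X] [Module k X]
    (f : V ⊗[k] W →ₗ[k] X) (S : Submodule k X)
    (h : ∀ p q, p + q = n → ∀ x ∈ V.gr p, ∀ y ∈ W.gr q, f (x ⊗ₜ[k] y) ∈ S)
    (z : V ⊗[k] W) (hz : z ∈ tensorGr V W n) : f z ∈ S :=
  tensorGr_le V W (S := S.comap f) h hz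

lemma tensor_internal (V W : DGVec k) : DirectSum.IsInternal (tensorGr V W) := by
  refine isInternal_of_detect (J := ℤ × ℤ) _ ?_
    (fun j => TensorProduct.map (V.proj j.1) (W.proj j.2)) (fun j => j.1 + j.2) ?_ ?_
  · rw [eq_top_iff]
    rintro z -
    have key : Submodule.mkQ (iSup (tensorGr V W)) = 0 := by
      apply ext_homog₂
      intro m x hx n y hy
      simp only [LinearMap.zero_apply, Submodule.mkQ_apply, Submodule.Quotient.mk_eq_zero]
      exact Submodule.mem_iSup_of_mem (m + n) (tmul_mem_tensorGr V W rfl hx hy)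
    have := congrArg (fun f => f z) key
    simpa using this
  · rintro ⟨a, b⟩ m hm z hz
    rw [← Submodule.mem_bot k]
    refine tensorGr_induction V W _ ⊥ ?_ z hz
    intro p q hpq x hx y hy
    rw [Submodule.mem_bot, TensorProduct.map_tmul]
    by_cases hp : p = a
    · have hq : q ≠ b := fun hq => hm (by simp [← hpq, hp, hq])
      rw [W.proj_ne hq hy, TensorProduct.tmul_zero]
    · rw [V.proj_ne hp hx, TensorProduct.zero_tmul]
  · intro z hz
    have : ∃ s : Finset ℤ, ∃ s' : Finset ℤ, ∀ t t', s ⊆ t → s' ⊆ t' →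
        ∑ a ∈ t, ∑ b ∈ t', TensorProduct.map (V.proj a) (W.proj b) z = z := by
      clear hz
      induction z using TensorProduct.induction_on with
      | zero => exact ⟨∅, ∅, by simp⟩
      | tmul x y =>
        obtain ⟨s, hs⟩ := V.exists_sum_proj x
        obtain ⟨s', hs'⟩ := W.exists_sum_proj y
        refine ⟨s, s', fun t t' ht ht' => ?_⟩
        simp only [TensorProduct.map_tmul, ← TensorProduct.tmul_sum, ← TensorProduct.sum_tmul]
        rw [hs t ht, hs' t' ht']
      | add z w hz hw =>
        obtain ⟨s, s', hs⟩ := hz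
        obtain ⟨r, r', hr⟩ := hw
        refine ⟨s ∪ r, s' ∪ r', fun t t' ht ht' => ?_⟩
        simp only [map_add, Finset.sum_add_distrib]
        rw [hs t t' (Finset.union_subset_left ht) (Finset.union_subset_left ht'),
          hr t t' (Finset.union_subset_right ht) (Finset.union_subset_right ht')]
    obtain ⟨s, s', hs⟩ := this
    rw [← hs s s' subset_rfl subset_rfl]
    refine Finset.sum_eq_zero fun a _ => Finset.sum_eq_zero fun b _ => hz (a, b)

/-- The differential `d ⊗ 1 + σ ⊗ d` of the tensor product, where `σ x = (-1)^{|x|} x`. -/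
noncomputable def tensorD (V W : DGVec k) : V ⊗[k] W →ₗ[k] V ⊗[k] W :=
  TensorProduct.map V.d LinearMap.id + TensorProduct.map (V.scale (koszulSign k)) W.d

lemma tensorD_tmul (V W : DGVec k) {p : ℤ} {x : V} (hx : x ∈ V.gr p) (y : W) :
    tensorD V W (x ⊗ₜ y) = V.d x ⊗ₜ y + koszulSign k p • (x ⊗ₜ W.d y) := by
  simp [tensorD, V.scale_apply _ hx, TensorProduct.smul_tmul']

/-- The tensor product of dg vector spaces. -/
noncomputable def tensor (V W : DGVec k) : DGVec k where
  carrier := V ⊗[k] W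
  gr := tensorGr V W
  internal := tensor_internal V W
  d := tensorD V W
  d_mem n := by
    apply tensorGr_induction
    intro p q h x hx y hy
    rw [tensorD_tmul V W hx]
    refine add_mem (tmul_mem_tensorGr V W (p := p - 1) (q := q) (by omega) (V.d_mem _ _ hx) hy)
      (Submodule.smul_mem _ _
        (tmul_mem_tensorGr V W (p := p) (q := q - 1) (by omega) hx (W.d_mem _ _ hy)))
  d_d := by
    suffices h : tensorD V W ∘ₗ tensorD V W = 0 from fun x => congrArg (fun f => f x) h
    apply ext_homog₂
    intro p x hx q y hy
    simp only [LinearMap.comp_apply, tensorD_tmul V W hx, map_add, map_smul,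
      tensorD_tmul V W (V.d_mem _ _ hx), V.d_d, W.d_d, koszulSign_sub, koszulSign_one]
    simp

/-- The tensor product of morphisms. -/
noncomputable def tensorMap {V V' W W' : DGVec k} (f : V ⟶ V') (g : W ⟶ W') :
    tensor V W ⟶ tensor V' W' where
  lin := TensorProduct.map f.lin g.lin
  map_mem n := by
    apply tensorGr_induction
    intro p q h x hx y hy
    exact tmul_mem_tensorGr V' W' h (f.map_mem _ _ hx) (g.map_mem _ _ hy)
  map_d := by
    suffices h : TensorProduct.map f.lin g.lin ∘ₗ tensorD V W =
        tensorD V' W' ∘ₗ TensorProduct.map f.lin g.lin from fun x => congrArg (fun f => f x) h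
    apply ext_homog₂
    intro p x hx q y hy
    simp [tensorD_tmul V W hx, tensorD_tmul V' W' (f.map_mem _ _ hx), f.map_d, g.map_d]

/-- The unit: `k` in degree `0`. -/
def unit (k : Type u) [Field k] : DGVec k where
  carrier := k
  gr n := if n = 0 then ⊤ else ⊥
  internal := by
    refine isInternal_of_detect (J := Unit) _ ?_ (fun _ => LinearMap.id) (fun _ => 0) ?_ ?_
    · rw [eq_top_iff]
      exact le_iSup_of_le 0 (by simp)
    · intro _ m hm x hx
      simpa [hm] using hx
    · intro x hx
      exact hx ()
  d := 0
  d_mem _ _ _ := zero_mem _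
  d_d _ := rfl

lemma mem_unit_gr_zero (x : k) : x ∈ (unit k).gr 0 := by
  change x ∈ (if (0 : ℤ) = 0 then (⊤ : Submodule k k) else ⊥)
  simp

lemma mem_unit_gr {n : ℤ} {x : k} (h : x ∈ (unit k).gr n) : x = 0 ∨ n = 0 := by
  by_cases hn : n = 0
  · exact Or.inr hn
  · left
    change x ∈ (if n = 0 then (⊤ : Submodule k k) else ⊥) at h
    simpa [hn] using h

/-- The associativity isomorphism. -/
noncomputable def assocIso (U V W : DGVec k) :
    tensor (tensor U V) W ≅ tensor U (tensor V W) :=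
  mkIso (TensorProduct.assoc k U V W)
    (by
      intro n x hx
      refine tensorGr_induction (tensor U V) W
        (TensorProduct.assoc k U V W).toLinearMap (tensorGr U (tensor V W) n) ?_ x hx
      intro p q h x hx y hy
      refine tensorGr_induction U V ((TensorProduct.assoc k U V W).toLinearMap ∘ₗ
        (TensorProduct.mk k (U ⊗[k] V) W).flip y) (tensorGr U (tensor V W) n) ?_ x hx
      intro r s h' x hx z hz
      exact tmul_mem_tensorGr U (tensor V W) (p := r) (q := s + q) (by omega) hx
        (tmul_mem_tensorGr V W rfl hz hy))
    (by
      intro n x hx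
      refine tensorGr_induction U (tensor V W)
        (TensorProduct.assoc k U V W).symm.toLinearMap (tensorGr (tensor U V) W n) ?_ x hx
      intro p q h x hx y hy
      refine tensorGr_induction V W ((TensorProduct.assoc k U V W).symm.toLinearMap ∘ₗ
        TensorProduct.mk k U (V ⊗[k] W) x) (tensorGr (tensor U V) W n) ?_ y hy
      intro r s h' z hz y hy
      exact tmul_mem_tensorGr (tensor U V) W (p := p + r) (q := s) (by omega)
        (tmul_mem_tensorGr U V rfl hx hz) hy)
    (by
      suffices h : (TensorProduct.assoc k U V W).toLinearMap ∘ₗ tensorD (tensor U V) W =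
          tensorD U (tensor V W) ∘ₗ (TensorProduct.assoc k U V W).toLinearMap from
        fun x => congrArg (fun f => f x) h
      apply TensorProduct.ext
      apply ext_homog₂
      intro p x hx q y hy
      ext z
      have e1 : tensorD (tensor U V) W ((x ⊗ₜ[k] y) ⊗ₜ[k] z) =
          tensorD U V (x ⊗ₜ[k] y) ⊗ₜ[k] z + koszulSign k (p + q) • ((x ⊗ₜ[k] y) ⊗ₜ[k] W.d z) :=
        tensorD_tmul (tensor U V) W (tmul_mem_tensorGr U V rfl hx hy) z
      have e2 : tensorD U (tensor V W) (x ⊗ₜ[k] (y ⊗ₜ[k] z)) =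
          U.d x ⊗ₜ[k] (y ⊗ₜ[k] z) + koszulSign k p • (x ⊗ₜ[k] tensorD V W (y ⊗ₜ[k] z)) :=
        tensorD_tmul U (tensor V W) hx (y ⊗ₜ[k] z)
      refine (congrArg (TensorProduct.assoc k U V W) e1).trans (Eq.trans ?_ e2.symm)
      rw [tensorD_tmul U V hx, tensorD_tmul V W hy, koszulSign_add]
      simp only [TensorProduct.add_tmul, TensorProduct.tmul_add, ← TensorProduct.smul_tmul',
        map_add, map_smul, TensorProduct.assoc_tmul, TensorProduct.tmul_smul, smul_add, smul_smul,
        add_assoc])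

/-- The left unit isomorphism. -/
noncomputable def leftUnitIso (V : DGVec k) : tensor (unit k) V ≅ V :=
  mkIso (V := tensor (unit k) V) (TensorProduct.lid k V)
    (by
      intro n x hx
      refine tensorGr_induction (unit k) V (TensorProduct.lid k V).toLinearMap (V.gr n) ?_ x hx
      intro p q h (a : k) ha y hy
      change a • y ∈ V.gr n
      rcases mem_unit_gr (k := k) (x := a) ha with rfl | rfl
      · rw [zero_smul]
        exact zero_mem _
      · obtain rfl : q = n := by omega
        exact Submodule.smul_mem _ a hy)
    (fun n x hx => tmul_mem_tensorGr (unit k) V (zero_add n) (mem_unit_gr_zero (1 : k)) hx)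
    (by
      suffices h : (TensorProduct.lid k V).toLinearMap ∘ₗ tensorD (unit k) V =
          V.d ∘ₗ (TensorProduct.lid k V).toLinearMap from fun x => congrArg (fun f => f x) h
      apply TensorProduct.ext'
      intro (a : k) x
      refine (congrArg (TensorProduct.lid k V)
        (tensorD_tmul (unit k) V (mem_unit_gr_zero a) x)).trans ?_
      refine (map_add (TensorProduct.lid k V) ((0 : k) ⊗ₜ[k] x)
        (koszulSign k 0 • (a ⊗ₜ[k] V.d x))).trans ?_
      rw [koszulSign_zero, one_smul]
      change (0 : k) • x + a • V.d x = V.d (a • x)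
      rw [zero_smul, zero_add, map_smul])

/-- The right unit isomorphism. -/
noncomputable def rightUnitIso (V : DGVec k) : tensor V (unit k) ≅ V :=
  mkIso (V := tensor V (unit k)) (TensorProduct.rid k V)
    (by
      intro n z hz
      refine tensorGr_induction V (unit k) (TensorProduct.rid k V).toLinearMap (V.gr n) ?_ z hz
      intro p q h x hx (a : k) ha
      change a • x ∈ V.gr n
      rcases mem_unit_gr (k := k) (x := a) ha with rfl | rfl
      · rw [zero_smul]
        exact zero_mem _
      · obtain rfl : p = n := by omega
        exact Submodule.smul_mem _ a hx)
    (fun n x hx => tmul_mem_tensorGr V (unit k) (add_zero n) hx (mem_unit_gr_zero (1 : k)))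
    (by
      suffices h : (TensorProduct.rid k V).toLinearMap ∘ₗ tensorD V (unit k) =
          V.d ∘ₗ (TensorProduct.rid k V).toLinearMap from fun x => congrArg (fun f => f x) h
      apply TensorProduct.ext
      apply ext_homog
      intro n x hx
      refine LinearMap.ext fun (a : k) => ?_
      refine (congrArg (TensorProduct.rid k V) (tensorD_tmul V (unit k) hx a)).trans ?_
      refine (map_add (TensorProduct.rid k V) (V.d x ⊗ₜ[k] a)
        (koszulSign k n • (x ⊗ₜ[k] (0 : k)))).trans ?_
      refine (congrArg (fun z => TensorProduct.rid k V (V.d x ⊗ₜ[k] a) + z)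
        (map_smul (TensorProduct.rid k V) (koszulSign k n) (x ⊗ₜ[k] (0 : k)))).trans ?_
      change a • V.d x + koszulSign k n • ((0 : k) • x) = V.d (a • x)
      rw [zero_smul, smul_zero, add_zero, map_smul])

noncomputable instance : MonoidalCategoryStruct (DGVec k) where
  tensorObj := tensor
  tensorHom := tensorMap
  whiskerLeft V _ _ f := tensorMap (𝟙 V) f
  whiskerRight f W := tensorMap f (𝟙 W)
  tensorUnit := unit k
  associator := assocIso
  leftUnitor := leftUnitIso
  rightUnitor := rightUnitIso

noncomputable instance : MonoidalCategory (DGVec k) :=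
  MonoidalCategory.ofTensorHom
    (id_tensorHom_id := fun _ _ => hom_ext (TensorProduct.map_id))
    (id_tensorHom := fun _ _ _ _ => rfl)
    (tensorHom_id := fun _ _ => rfl)
    (tensorHom_comp_tensorHom := fun _ _ _ _ => hom_ext
      (TensorProduct.map_comp _ _ _ _).symm)
    (associator_naturality := fun _ _ _ => hom_ext
      (TensorProduct.ext_threefold fun _ _ _ => rfl))
    (leftUnitor_naturality := fun f => hom_ext
      (TensorProduct.ext' fun a b => (f.lin.map_smul (a : k) b).symm))
    (rightUnitor_naturality := fun f => hom_ext
      (TensorProduct.ext' fun a b => (f.lin.map_smul (b : k) a).symm))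
    (pentagon := fun _ _ _ _ => hom_ext (TensorProduct.ext_fourfold fun _ _ _ _ => rfl))
    (triangle := fun _ _ => hom_ext (TensorProduct.ext_threefold fun a b c =>
      (TensorProduct.smul_tmul (R := k) (R' := k) b a c).symm))

end DGVec

namespace DGVec
variable {k : Type u} [Field k]

lemma tmul_mem (V W : DGVec k) {p q n : ℤ} (h : p + q = n) {x : V} {y : W}
    (hx : x ∈ V.gr p) (hy : y ∈ W.gr q) : x ⊗ₜ[k] y ∈ (V ⊗ W).gr n :=
  tmul_mem_tensorGr V W h hx hy

lemma tensor_d_tmul (V W : DGVec k) {p : ℤ} {x : V} (hx : x ∈ V.gr p) (y : W) :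
    (V ⊗ W).d (x ⊗ₜ[k] y) = V.d x ⊗ₜ[k] y + koszulSign k p • (x ⊗ₜ[k] W.d y) :=
  tensorD_tmul V W hx y

/-- The braiding `x ⊗ y ↦ (-1)^{|x||y|} y ⊗ x`. -/
noncomputable def braidLin (V W : DGVec k) : V ⊗[k] W →ₗ[k] W ⊗[k] V :=
  TensorProduct.lift (V.desc fun p =>
    (TensorProduct.mk k W V).flip.compl₂ (W.scale fun q => koszulSign k (p * q)))

lemma braidLin_tmul (V W : DGVec k) {p q : ℤ} {x : V} {y : W} (hx : x ∈ V.gr p)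
    (hy : y ∈ W.gr q) :
    braidLin V W (x ⊗ₜ[k] y) = koszulSign k (p * q) • (y ⊗ₜ[k] x) := by
  simp [braidLin, V.desc_apply _ hx, W.scale_apply _ hy, TensorProduct.smul_tmul']

/-- The braiding as a morphism. -/
noncomputable def braidHom (V W : DGVec k) : V ⊗ W ⟶ W ⊗ V where
  lin := braidLin V W
  map_mem n := by
    refine tensorGr_induction V W (braidLin V W) (tensorGr W V n) ?_
    intro p q h x hx y hy
    rw [braidLin_tmul V W hx hy]
    exact Submodule.smul_mem _ _ (tmul_mem_tensorGr W V (by omega) hy hx)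
  map_d := by
    suffices h : braidLin V W ∘ₗ tensorD V W = tensorD W V ∘ₗ braidLin V W from
      fun x => congrArg (fun f => f x) h
    apply ext_homog₂
    intro p x hx q y hy
    simp only [LinearMap.comp_apply, tensorD_tmul V W hx, braidLin_tmul V W hx hy, map_add,
      map_smul, braidLin_tmul V W (V.d_mem _ _ hx) hy, braidLin_tmul V W hx (W.d_mem _ _ hy),
      tensorD_tmul W V hy, smul_add, smul_smul, ← koszulSign_add]
    rw [add_comm]
    congr 2
    · rw [show p + p * (q - 1) = p * q + (p - p) by ring, sub_self, add_zero]
    · rw [show p * q + q = (p - 1) * q + (q + q) by ring, koszulSign_add, koszulSign_add k q q,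
        koszulSign_mul_self, mul_one]

lemma braidHom_braidHom (V W : DGVec k) : braidHom V W ≫ braidHom W V = 𝟙 _ := by
  apply hom_ext
  apply ext_homog₂
  intro p x hx q y hy
  change braidLin W V (braidLin V W (x ⊗ₜ[k] y)) = x ⊗ₜ[k] y
  rw [braidLin_tmul V W hx hy, map_smul, braidLin_tmul W V hy hx, smul_smul, mul_comm q p,
    koszulSign_mul_self, one_smul]

lemma ext_homog₃ (U V W : DGVec k) {X : Type*} [AddCommGroup X] [Module k X]
    {f g : (U ⊗[k] V) ⊗[k] W →ₗ[k] X}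
    (h : ∀ l, ∀ x ∈ U.gr l, ∀ m, ∀ y ∈ V.gr m, ∀ n, ∀ z ∈ W.gr n,
      f ((x ⊗ₜ y) ⊗ₜ z) = g ((x ⊗ₜ y) ⊗ₜ z)) : f = g := by
  apply TensorProduct.ext
  apply ext_homog₂
  intro l x hx m y hy
  apply ext_homog
  intro n z hz
  exact h l x hx m y hy n z hz

lemma ext_homog₃' (U V W : DGVec k) {X : Type*} [AddCommGroup X] [Module k X]
    {f g : U ⊗[k] (V ⊗[k] W) →ₗ[k] X}
    (h : ∀ l, ∀ x ∈ U.gr l, ∀ m, ∀ y ∈ V.gr m, ∀ n, ∀ z ∈ W.gr n,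
      f (x ⊗ₜ (y ⊗ₜ z)) = g (x ⊗ₜ (y ⊗ₜ z))) : f = g := by
  apply TensorProduct.ext
  apply ext_homog
  intro l x hx
  apply ext_homog₂
  intro m y hy n z hz
  exact h l x hx m y hy n z hz

noncomputable instance : SymmetricCategory (DGVec k) where
  braiding V W := ⟨braidHom V W, braidHom W V, braidHom_braidHom V W, braidHom_braidHom W V⟩
  braiding_naturality_right U V W f := by
    apply hom_ext
    apply ext_homog₂
    intro p x hx q y hy
    change braidLin U W (x ⊗ₜ[k] f.lin y) = TensorProduct.map f.lin LinearMap.id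
      (braidLin U V (x ⊗ₜ[k] y))
    rw [braidLin_tmul U W hx (f.map_mem _ _ hy), braidLin_tmul U V hx hy]
    simp
  braiding_naturality_left {V W} f U := by
    apply hom_ext
    apply ext_homog₂
    intro p x hx q y hy
    change braidLin W U (f.lin x ⊗ₜ[k] y) = TensorProduct.map LinearMap.id f.lin
      (braidLin V U (x ⊗ₜ[k] y))
    rw [braidLin_tmul W U (f.map_mem _ _ hx) hy, braidLin_tmul V U hx hy]
    simp
  hexagon_forward U V W := by
    apply hom_ext
    apply ext_homog₃
    intro l x hx m y hy n z hz
    change TensorProduct.assoc k V W U (braidLin U (V ⊗ W) (x ⊗ₜ[k] (y ⊗ₜ[k] z))) =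
      TensorProduct.map LinearMap.id (braidLin U W) (TensorProduct.assoc k V U W
        (TensorProduct.map (braidLin U V) LinearMap.id ((x ⊗ₜ[k] y) ⊗ₜ[k] z)))
    rw [braidLin_tmul U (V ⊗ W) hx (tmul_mem V W rfl hy hz), TensorProduct.map_tmul,
      braidLin_tmul U V hx hy, ← TensorProduct.smul_tmul', map_smul, map_smul,
      TensorProduct.assoc_tmul, TensorProduct.map_tmul, LinearMap.id_apply, LinearMap.id_apply,
      braidLin_tmul U W hx hz,
      TensorProduct.tmul_smul, smul_smul, ← koszulSign_add, mul_add]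
    exact (map_smul (TensorProduct.assoc k V W U) _ _).trans rfl
  hexagon_reverse U V W := by
    apply hom_ext
    apply ext_homog₃'
    intro l x hx m y hy n z hz
    change (TensorProduct.assoc k W U V).symm (braidLin (U ⊗ V) W ((x ⊗ₜ[k] y) ⊗ₜ[k] z)) =
      TensorProduct.map (braidLin U W) LinearMap.id ((TensorProduct.assoc k U W V).symm
        (TensorProduct.map LinearMap.id (braidLin V W) (x ⊗ₜ[k] (y ⊗ₜ[k] z))))
    rw [braidLin_tmul (U ⊗ V) W (tmul_mem U V rfl hx hy) hz, TensorProduct.map_tmul,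
      braidLin_tmul V W hy hz, TensorProduct.tmul_smul, map_smul, map_smul,
      LinearMap.id_apply, TensorProduct.assoc_symm_tmul, TensorProduct.map_tmul,
      braidLin_tmul U W hx hz, ← TensorProduct.smul_tmul', smul_smul, ← koszulSign_add]
    rw [show (l + m) * n = m * n + l * n by ring]
    exact (map_smul (TensorProduct.assoc k W U V).symm _ _).trans rfl
  symmetry V W := braidHom_braidHom V W

end DGVec

namespace DGVec
variable {k : Type u} [Field k]

/-! ### The internal hom -/

/-- The linear maps `V → W` of degree `n`. -/
def homGr (V W : DGVec k) (n : ℤ) : Submodule k (V →ₗ[k] W) where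
  carrier := {f | ∀ (p : ℤ) (x : V), x ∈ V.gr p → f x ∈ W.gr (p + n)}
  add_mem' hf hg p x hx := add_mem (hf p x hx) (hg p x hx)
  zero_mem' _ _ _ := zero_mem _
  smul_mem' a _ hf p x hx := Submodule.smul_mem _ a (hf p x hx)

/-- The finite sums of homogeneous linear maps `V → W`: the total space of the internal hom. -/
def homSpace (V W : DGVec k) : Submodule k (V →ₗ[k] W) := ⨆ n, homGr V W n

lemma homGr_le (V W : DGVec k) (n : ℤ) : homGr V W n ≤ homSpace V W := le_iSup _ n

/-- The homogeneous component of degree `n` inside the total space of the internal hom. -/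
def ihomGr (V W : DGVec k) (n : ℤ) : Submodule k (homSpace V W) :=
  (homGr V W n).comap (homSpace V W).subtype

lemma iSup_ihomGr (V W : DGVec k) : iSup (ihomGr V W) = ⊤ := by
  have inj := (homSpace V W).injective_subtype
  apply Submodule.map_injective_of_injective inj
  rw [Submodule.map_iSup, Submodule.map_top, Submodule.range_subtype]
  have : ∀ n, (ihomGr V W n).map (homSpace V W).subtype = homGr V W n := fun n => by
    rw [ihomGr, Submodule.map_comap_subtype, inf_eq_right]
    exact homGr_le V W n
  simp_rw [this]
  rfl

lemma ihom_internal (V W : DGVec k) : DirectSum.IsInternal (ihomGr V W) := by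
  refine isInternal_of_detect (J := Σ j : ℤ × ℤ, V.gr j.1) _ (iSup_ihomGr V W)
    (fun j => W.proj j.1.2 ∘ₗ LinearMap.applyₗ (j.2 : V) ∘ₗ (homSpace V W).subtype)
    (fun j => j.1.2 - j.1.1) ?_ ?_
  · rintro ⟨⟨p, q⟩, x⟩ m hm f hf
    exact W.proj_ne (m := p + m) (fun h => hm (by dsimp only at h ⊢; omega)) (hf p x x.2)
  · intro f hf
    apply Subtype.ext
    refine ext_homog V fun p x hx => W.eq_zero_of_proj _ fun q => ?_
    exact hf ⟨(p, q), ⟨x, hx⟩⟩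

lemma homSpace_induction (V W : DGVec k) {P : (V →ₗ[k] W) → Prop} (h0 : P 0)
    (hadd : ∀ f g, P f → P g → P (f + g)) (hom : ∀ n, ∀ f ∈ homGr V W n, P f)
    (f : V →ₗ[k] W) (hf : f ∈ homSpace V W) : P f :=
  Submodule.iSup_induction (homGr V W) (motive := P) hf hom h0 hadd

/-- The differential `f ↦ d f - (-1)^{|f|} f d` of the internal hom. The sign is produced by
conjugation with the operators `x ↦ (-1)^{|x|} x`. -/
noncomputable def homD (V W : DGVec k) : (V →ₗ[k] W) →ₗ[k] (V →ₗ[k] W) where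
  toFun f := W.d ∘ₗ f -
    (W.scale (koszulSign k) ∘ₗ f ∘ₗ V.scale (koszulSign k)) ∘ₗ V.d
  map_add' f g := by
    ext x
    simp only [LinearMap.sub_apply, LinearMap.add_apply, LinearMap.comp_apply, map_add]
    abel
  map_smul' a f := by
    ext x
    simp [smul_sub]

lemma homD_apply (V W : DGVec k) {n : ℤ} {f : V →ₗ[k] W} (hf : f ∈ homGr V W n) :
    homD V W f = W.d ∘ₗ f - koszulSign k n • (f ∘ₗ V.d) := by
  refine congrArg (W.d ∘ₗ f - ·) ?_
  apply ext_homog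
  intro p x hx
  have hdx := V.d_mem _ _ hx
  simp only [LinearMap.comp_apply, V.scale_apply _ hdx, map_smul, LinearMap.smul_apply,
    W.scale_apply _ (hf _ _ hdx), smul_smul]
  rw [koszulSign_add, ← mul_assoc, koszulSign_mul_self, one_mul]

lemma homD_mem (V W : DGVec k) {n : ℤ} {f : V →ₗ[k] W} (hf : f ∈ homGr V W n) :
    homD V W f ∈ homGr V W (n - 1) := by
  rw [homD_apply V W hf]
  intro p x hx
  refine sub_mem ?_ (Submodule.smul_mem _ _ ?_)
  · have := W.d_mem _ _ (hf p x hx)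
    rwa [add_sub_assoc] at this
  · have := hf _ _ (V.d_mem _ _ hx)
    rwa [sub_add_eq_add_sub, add_sub_assoc] at this

lemma homD_homSpace (V W : DGVec k) (f : V →ₗ[k] W) (hf : f ∈ homSpace V W) :
    homD V W f ∈ homSpace V W := by
  refine homSpace_induction V W (P := fun f => homD V W f ∈ homSpace V W) ?_ ?_ ?_ f hf
  · rw [map_zero]
    exact zero_mem _
  · intro f g hf hg
    rw [map_add]
    exact add_mem hf hg
  · intro n f hf
    exact homGr_le V W _ (homD_mem V W hf)

/-- The internal hom of dg vector spaces. -/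
noncomputable def ihom (V W : DGVec k) : DGVec k where
  carrier := homSpace V W
  gr := ihomGr V W
  internal := ihom_internal V W
  d := (homD V W).restrict (homD_homSpace V W)
  d_mem _ f hf := homD_mem V W (f := (f : V →ₗ[k] W)) hf
  d_d f := by
    apply Subtype.ext
    refine homSpace_induction V W (P := fun f => homD V W (homD V W f) = 0) ?_ ?_ ?_ f f.2
    · simp
    · intro f g hf hg
      rw [map_add, map_add, hf, hg, add_zero]
    · intro n f hf
      rw [homD_apply V W (homD_mem V W hf), homD_apply V W hf]
      ext x
      simp only [LinearMap.sub_apply, LinearMap.comp_apply, LinearMap.smul_apply, map_sub,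
        map_smul, W.d_d, V.d_d, map_zero, smul_zero, sub_zero, zero_sub, koszulSign_sub,
        koszulSign_one, LinearMap.zero_apply]
      simp

/-- The linear map underlying an element of the internal hom. -/
def ihomVal (V W : DGVec k) : ihom V W →ₗ[k] (V →ₗ[k] W) := (homSpace V W).subtype

lemma ihomVal_injective (V W : DGVec k) : Function.Injective (ihomVal V W) :=
  (homSpace V W).injective_subtype

lemma ihomVal_mem (V W : DGVec k) (f : ihom V W) : ihomVal V W f ∈ homSpace V W :=
  Subtype.property (p := (· ∈ homSpace V W)) f

lemma ihomVal_d (V W : DGVec k) (f : ihom V W) :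
    ihomVal V W ((ihom V W).d f) = homD V W (ihomVal V W f) := rfl

lemma mem_ihom_gr {V W : DGVec k} {n : ℤ} {f : ihom V W} :
    f ∈ (ihom V W).gr n ↔ ihomVal V W f ∈ homGr V W n := Iff.rfl

lemma ihom_ext {U V W : DGVec k} {f g : U ⟶ ihom V W}
    (h : ∀ x : U, ihomVal V W (f.lin x) = ihomVal V W (g.lin x)) : f = g :=
  hom_ext (LinearMap.ext fun x => ihomVal_injective V W (h x))

/-- Pre- and postcomposition on the internal hom. -/
noncomputable def ihomMap {V V' W W' : DGVec k} (h : V' ⟶ V) (g : W ⟶ W') :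
    ihom V W ⟶ ihom V' W' where
  lin := (LinearMap.lcomp k W'.carrier h.lin ∘ₗ
      LinearMap.llcomp k V.carrier W.carrier W'.carrier g.lin).restrict (p := homSpace V W)
    (q := homSpace V' W') (by
      intro f hf
      refine homSpace_induction V W (P := fun f => g.lin ∘ₗ f ∘ₗ h.lin ∈ homSpace V' W')
        ?_ ?_ ?_ f hf
      · rw [LinearMap.zero_comp, LinearMap.comp_zero]
        exact zero_mem _
      · intro f f' hf hf'
        rw [LinearMap.add_comp, LinearMap.comp_add]
        exact add_mem hf hf'
      · intro n f hf
        exact homGr_le V' W' n fun p x hx => g.map_mem _ _ (hf _ _ (h.map_mem _ _ hx)))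
  map_mem n f hf p x hx := g.map_mem _ _ (hf _ _ (h.map_mem _ _ hx))
  map_d f := by
    apply Subtype.ext
    refine homSpace_induction V W
      (P := fun f => g.lin ∘ₗ homD V W f ∘ₗ h.lin = homD V' W' (g.lin ∘ₗ f ∘ₗ h.lin))
      ?_ ?_ ?_ _ (ihomVal_mem V W f)
    · simp
    · intro f f' hf hf'
      simp only [map_add, LinearMap.add_comp, LinearMap.comp_add, hf, hf']
    · intro n f hf
      rw [homD_apply V W hf, homD_apply V' W' (n := n)
        fun p x hx => g.map_mem _ _ (hf _ _ (h.map_mem _ _ hx))]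
      ext x
      simp [g.map_d, h.map_d]

lemma ihomVal_ihomMap {V V' W W' : DGVec k} (h : V' ⟶ V) (g : W ⟶ W') (f : ihom V W) :
    ihomVal V' W' ((ihomMap h g).lin f) = g.lin ∘ₗ ihomVal V W f ∘ₗ h.lin :=
  rfl

/-- Evaluation `f ⊗ x ↦ f x`. -/
noncomputable def ihomApply (V W : DGVec k) : ihom V W ⊗ V ⟶ W where
  lin := TensorProduct.lift (ihomVal V W)
  map_mem n := by
    refine tensorGr_induction (ihom V W) V (TensorProduct.lift (ihomVal V W)) (W.gr n) ?_
    intro p q h f hf x hx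
    have := hf q x hx
    rw [add_comm, h] at this
    exact this
  map_d := by
    suffices h : TensorProduct.lift (ihomVal V W) ∘ₗ tensorD (ihom V W) V =
        W.d ∘ₗ TensorProduct.lift (ihomVal V W) from fun x => congrArg (fun f => f x) h
    apply ext_homog₂ (ihom V W) V
    intro n f hf p x hx
    simp only [LinearMap.comp_apply, tensorD_tmul (ihom V W) V hf, map_add, map_smul,
      TensorProduct.lift.tmul, ihomVal_d, homD_apply V W (mem_ihom_gr.1 hf)]
    simp

/-- The evaluation map `V ⊗ Hom(V, W) → W`, `x ⊗ f ↦ (-1)^{|x||f|} f x`, i.e. the counit of the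
tensor-hom adjunction. -/
noncomputable def ihomEval (V W : DGVec k) : V ⊗ ihom V W ⟶ W :=
  (β_ V (ihom V W)).hom ≫ ihomApply V W

/-- For a second map of degree `q`: the map `x ⊗ y ↦ (-1)^{q|x|} f x ⊗ g y`. -/
noncomputable def homTensorAux (V W V' W' : DGVec k) (q : ℤ) (f : V →ₗ[k] W)
    (g : V' →ₗ[k] W') : V ⊗[k] V' →ₗ[k] W ⊗[k] W' :=
  TensorProduct.map (f ∘ₗ V.scale fun p => koszulSign k (q * p)) g

lemma homTensorAux_tmul (V W V' W' : DGVec k) (q : ℤ) (f : V →ₗ[k] W)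
    (g : V' →ₗ[k] W') {p : ℤ} {x : V} (hx : x ∈ V.gr p) (y : V') :
    homTensorAux V W V' W' q f g (x ⊗ₜ[k] y) = koszulSign k (q * p) • (f x ⊗ₜ[k] g y) := by
  simp [homTensorAux, V.scale_apply _ hx, TensorProduct.smul_tmul']

lemma homTensorAux_mem (V W V' W' : DGVec k) (q : ℤ) {m n l : ℤ} {f : V →ₗ[k] W}
    {g : V' →ₗ[k] W'} (h : m + n = l) (hf : f ∈ homGr V W m) (hg : g ∈ homGr V' W' n) :
    homTensorAux V W V' W' q f g ∈ homGr (V ⊗ V') (W ⊗ W') l := by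
  intro r
  refine tensorGr_induction V V' (homTensorAux V W V' W' q f g) (tensorGr W W' (r + l)) ?_
  intro a b hab x hx y hy
  rw [homTensorAux_tmul V W V' W' q f g hx]
  exact Submodule.smul_mem _ _ (tmul_mem_tensorGr W W' (p := a + m) (q := b + n) (by omega)
    (hf _ _ hx) (hg _ _ hy))

lemma homTensorAux_homSpace (V W V' W' : DGVec k) (q : ℤ) {f : V →ₗ[k] W}
    {g : V' →ₗ[k] W'} (hf : f ∈ homSpace V W) (hg : g ∈ homSpace V' W') :
    homTensorAux V W V' W' q f g ∈ homSpace (V ⊗ V') (W ⊗ W') := by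
  refine homSpace_induction V W
    (P := fun f => homTensorAux V W V' W' q f g ∈ homSpace (V ⊗ V') (W ⊗ W')) ?_ ?_ ?_ f hf
  · rw [homTensorAux, LinearMap.zero_comp, TensorProduct.map_zero_left]
    exact zero_mem _
  · intro f f' hf hf'
    rw [homTensorAux, LinearMap.add_comp, TensorProduct.map_add_left]
    exact add_mem hf hf'
  · intro m f hf
    refine homSpace_induction V' W'
      (P := fun g => homTensorAux V W V' W' q f g ∈ homSpace (V ⊗ V') (W ⊗ W')) ?_ ?_ ?_ g hg
    · rw [homTensorAux, TensorProduct.map_zero_right]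
      exact zero_mem _
    · intro f f' hf hf'
      rw [homTensorAux, TensorProduct.map_add_right]
      exact add_mem hf hf'
    · intro n g hg
      exact homGr_le (V ⊗ V') (W ⊗ W') _ (homTensorAux_mem V W V' W' q rfl hf hg)

/-- The bilinear map underlying `homTensorAux`. -/
noncomputable def homTensorBil (V W V' W' : DGVec k) (q : ℤ) :
    ihom V' W' →ₗ[k] ihom V W →ₗ[k] ihom (tensor V V') (tensor W W') :=
  LinearMap.mk₂ k (fun g f => (⟨homTensorAux V W V' W' q (ihomVal V W f) (ihomVal V' W' g),
      homTensorAux_homSpace V W V' W' q (ihomVal_mem V W f) (ihomVal_mem V' W' g)⟩ :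
        homSpace (tensor V V') (tensor W W')))
      (fun _ _ _ => Subtype.ext (TensorProduct.map_add_right _ _ _))
      (fun _ _ _ => Subtype.ext (TensorProduct.map_smul_right _ _ _))
      (fun _ f f' => Subtype.ext (by
        refine Eq.trans (congrArg (TensorProduct.map · _) ?_) (TensorProduct.map_add_left _ _ _)
        exact LinearMap.add_comp (V.scale fun p => koszulSign k (q * p)) (ihomVal V W f')
          (ihomVal V W f)))
      (fun a _ f => Subtype.ext (by
        refine Eq.trans (congrArg (TensorProduct.map · _) ?_) (TensorProduct.map_smul_left a _ _)
        exact LinearMap.smul_comp a (ihomVal V W f) (V.scale fun p => koszulSign k (q * p))))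

/-- The linear map `f ⊗ g ↦ (x ⊗ y ↦ (-1)^{|g||x|} f x ⊗ g y)`. -/
noncomputable def homTensorLin (V W V' W' : DGVec k) :
    ihom V W ⊗[k] ihom V' W' →ₗ[k] ihom (tensor V V') (tensor W W') :=
  TensorProduct.lift (LinearMap.flip ((ihom V' W').desc (homTensorBil V W V' W')))

lemma homTensorLin_tmul (V W V' W' : DGVec k) (f : ihom V W) {q : ℤ} {g : ihom V' W'}
    (hg : g ∈ (ihom V' W').gr q) :
    ihomVal (tensor V V') (tensor W W') (homTensorLin V W V' W' (f ⊗ₜ[k] g)) =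
      homTensorAux V W V' W' q (ihomVal V W f) (ihomVal V' W' g) := by
  rw [homTensorLin, TensorProduct.lift.tmul, LinearMap.flip_apply, desc_apply _ _ hg]
  rfl

/-- The morphism `Hom(V, W) ⊗ Hom(V', W') → Hom(V ⊗ V', W ⊗ W')`,
`(f ⊗ g)(x ⊗ y) = (-1)^{|g||x|} f x ⊗ g y`. -/
noncomputable def homTensor (V W V' W' : DGVec k) :
    ihom V W ⊗ ihom V' W' ⟶ ihom (V ⊗ V') (W ⊗ W') where
  lin := homTensorLin V W V' W'
  map_mem n := by
    refine tensorGr_induction (ihom V W) (ihom V' W') (homTensorLin V W V' W')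
      ((ihom (tensor V V') (tensor W W')).gr n) ?_
    intro p q h f hf g hg
    rw [mem_ihom_gr, homTensorLin_tmul V W V' W' f hg]
    exact homTensorAux_mem V W V' W' q h hf hg
  map_d := by
    suffices h : homTensorLin V W V' W' ∘ₗ tensorD (ihom V W) (ihom V' W') =
        (ihom (tensor V V') (tensor W W')).d ∘ₗ homTensorLin V W V' W' from
      fun x => congrArg (fun f => f x) h
    apply ext_homog₂ (ihom V W) (ihom V' W')
    intro p f hf q g hg
    apply ihomVal_injective
    have hdf : (ihom V W).d f ∈ (ihom V W).gr (p - 1) := (ihom V W).d_mem _ _ hf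
    have hdg : (ihom V' W').d g ∈ (ihom V' W').gr (q - 1) := (ihom V' W').d_mem _ _ hg
    rw [LinearMap.comp_apply, LinearMap.comp_apply, ihomVal_d,
      tensorD_tmul (ihom V W) (ihom V' W') hf, map_add, map_smul, map_add, map_smul,
      homTensorLin_tmul V W V' W' _ hg, homTensorLin_tmul V W V' W' _ hdg,
      homTensorLin_tmul V W V' W' _ hg, ihomVal_d, ihomVal_d]
    have hf' := mem_ihom_gr.1 hf
    have hg' := mem_ihom_gr.1 hg
    refine Eq.trans ?_ (homD_apply (tensor V V') (tensor W W')
      (homTensorAux_mem V W V' W' q rfl hf' hg')).symm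
    apply ext_homog₂
    intro a x hx b y hy
    have hfx := hf' a x hx
    change homTensorAux V W V' W' q (homD V W (ihomVal V W f)) (ihomVal V' W' g) (x ⊗ₜ[k] y) +
        koszulSign k p • homTensorAux V W V' W' (q - 1) (ihomVal V W f)
          (homD V' W' (ihomVal V' W' g)) (x ⊗ₜ[k] y) =
      tensorD W W' (homTensorAux V W V' W' q (ihomVal V W f) (ihomVal V' W' g) (x ⊗ₜ[k] y)) -
        koszulSign k (p + q) • homTensorAux V W V' W' q (ihomVal V W f) (ihomVal V' W' g)
          (tensorD V V' (x ⊗ₜ[k] y))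
    rw [tensorD_tmul V V' hx, map_add, map_smul, homTensorAux_tmul _ _ _ _ _ _ _ hx,
      homTensorAux_tmul _ _ _ _ _ _ _ hx, homTensorAux_tmul _ _ _ _ _ _ _ hx,
      homTensorAux_tmul _ _ _ _ _ _ _ hx, homTensorAux_tmul _ _ _ _ _ _ _ (V.d_mem _ _ hx),
      map_smul, tensorD_tmul W W' hfx, homD_apply V W hf', homD_apply V' W' hg']
    simp only [LinearMap.sub_apply, LinearMap.comp_apply, LinearMap.smul_apply,
      TensorProduct.sub_tmul, TensorProduct.tmul_sub, TensorProduct.tmul_smul,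
      ← TensorProduct.smul_tmul', smul_sub, smul_add, smul_smul, sub_mul, mul_sub, one_mul,
      mul_one, koszulSign_add, koszulSign_sub]
    have hq := koszulSign_mul_self k q
    rw [show koszulSign k p * koszulSign k q * (koszulSign k (q * a) * koszulSign k q) =
      koszulSign k (q * a) * koszulSign k p by
      linear_combination (koszulSign k (q * a) * koszulSign k p) * hq]
    module

lemma homTensor_tmul (V W V' W' : DGVec k) (f : ihom V W) {q : ℤ} {g : ihom V' W'}
    (hg : g ∈ (ihom V' W').gr q) :
    ihomVal (V ⊗ V') (W ⊗ W') ((homTensor V W V' W').lin (f ⊗ₜ[k] g)) =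
      homTensorAux V W V' W' q (ihomVal V W f) (ihomVal V' W' g) :=
  homTensorLin_tmul V W V' W' f hg

end DGVec

namespace DGVec
variable {k : Type u} [Field k]

lemma tensorμ_tmul (X₁ X₂ Y₁ Y₂ : DGVec k) {p q : ℤ} (x₁ : X₁) {x₂ : X₂} {y₁ : Y₁} (y₂ : Y₂)
    (hx : x₂ ∈ X₂.gr p) (hy : y₁ ∈ Y₁.gr q) :
    (tensorμ X₁ X₂ Y₁ Y₂).lin ((x₁ ⊗ₜ[k] x₂) ⊗ₜ[k] (y₁ ⊗ₜ[k] y₂)) =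
      koszulSign k (p * q) • ((x₁ ⊗ₜ[k] y₁) ⊗ₜ[k] (x₂ ⊗ₜ[k] y₂)) := by
  change (TensorProduct.assoc k X₁ Y₁ (X₂ ⊗[k] Y₂)).symm (x₁ ⊗ₜ[k] TensorProduct.assoc k Y₁ X₂ Y₂
    (braidLin X₂ Y₁ (x₂ ⊗ₜ[k] y₁) ⊗ₜ[k] y₂)) = _
  rw [braidLin_tmul X₂ Y₁ hx hy, ← TensorProduct.smul_tmul', map_smul, TensorProduct.tmul_smul,
    map_smul, TensorProduct.assoc_tmul, TensorProduct.assoc_symm_tmul]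

lemma tensorμ_braiding (X₁ X₂ Y₁ Y₂ : DGVec k) :
    tensorμ X₁ X₂ Y₁ Y₂ ≫ ((β_ X₁ Y₁).hom ⊗ₘ (β_ X₂ Y₂).hom) =
      (β_ (X₁ ⊗ X₂) (Y₁ ⊗ Y₂)).hom ≫ tensorμ Y₁ Y₂ X₁ X₂ := by
  apply hom_ext
  apply TensorProduct.ext
  apply ext_homog₂
  intro p x hx q x' hx'
  apply ext_homog₂
  intro r y hy s y' hy'
  have e1 := tensorμ_tmul X₁ X₂ Y₁ Y₂ x y' hx' hy
  have e2 := tensorμ_tmul Y₁ Y₂ X₁ X₂ y x' hy' hx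
  have e3 := braidLin_tmul (X₁ ⊗ X₂) (Y₁ ⊗ Y₂) (tmul_mem X₁ X₂ rfl hx hx')
    (tmul_mem Y₁ Y₂ rfl hy hy')
  change TensorProduct.map (braidLin X₁ Y₁) (braidLin X₂ Y₂) ((tensorμ X₁ X₂ Y₁ Y₂).lin
    ((x ⊗ₜ[k] x') ⊗ₜ[k] (y ⊗ₜ[k] y'))) = (tensorμ Y₁ Y₂ X₁ X₂).lin (braidLin (X₁ ⊗ X₂) (Y₁ ⊗ Y₂)
      ((x ⊗ₜ[k] x') ⊗ₜ[k] (y ⊗ₜ[k] y')))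
  refine (congrArg (TensorProduct.map (braidLin X₁ Y₁) (braidLin X₂ Y₂)) e1).trans
    (Eq.trans ?_ (congrArg (tensorμ Y₁ Y₂ X₁ X₂).lin e3).symm)
  refine Eq.trans ?_ (((tensorμ Y₁ Y₂ X₁ X₂).lin.map_smul (koszulSign k ((p + q) * (r + s)))
    ((y ⊗ₜ[k] y') ⊗ₜ[k] (x ⊗ₜ[k] x'))).trans
      (congrArg (koszulSign k ((p + q) * (r + s)) • ·) e2)).symm
  rw [map_smul, TensorProduct.map_tmul, braidLin_tmul X₁ Y₁ hx hy, braidLin_tmul X₂ Y₂ hx' hy']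
  simp only [← TensorProduct.smul_tmul', TensorProduct.tmul_smul]
  refine Eq.trans ?_ (smul_smul (koszulSign k ((p + q) * (r + s))) (koszulSign k (s * p))
    ((y ⊗ₜ[k] x) ⊗ₜ[k] (y' ⊗ₜ[k] x'))).symm
  rw [smul_smul, smul_smul]
  congr 1
  rw [← koszulSign_add, ← koszulSign_add, ← koszulSign_add,
    show (p + q) * (r + s) + s * p = q * r + q * s + p * r + (s * p + s * p) by ring,
    koszulSign_add k _ (s * p + s * p), koszulSign_add k (s * p), koszulSign_mul_self, mul_one]

end DGVec

/-! ### Semi-monoidal categories and modules over them -/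

namespace CategoryTheory

/-- The action `F(f, g)` of a bifunctor on a pair of morphisms. -/
abbrev Functor.bimap {A B C : Type*} [Category A] [Category B] [Category C] (F : A ⥤ B ⥤ C)
    {X X' : A} {Y Y' : B} (f : X ⟶ X') (g : Y ⟶ Y') :
    (F.obj X).obj Y ⟶ (F.obj X').obj Y' :=
  (F.map f).app Y ≫ (F.obj X').map g

/-- A semi-monoidal category: a monoidal category without unit. -/
class SemiMonoidalCategory (V : Type*) [Category V] where
  /-- the tensor product `X ⊗ Y = (tensor.obj X).obj Y` -/
  tensor : V ⥤ V ⥤ V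
  /-- the associator `(X ⊗ Y) ⊗ Z ≅ X ⊗ (Y ⊗ Z)` -/
  assoc (X Y Z : V) : (tensor.obj ((tensor.obj X).obj Y)).obj Z ≅
    (tensor.obj X).obj ((tensor.obj Y).obj Z)
  assoc_naturality {X X' Y Y' Z Z' : V} (f : X ⟶ X') (g : Y ⟶ Y') (h : Z ⟶ Z') :
    tensor.bimap (tensor.bimap f g) h ≫ (assoc X' Y' Z').hom =
      (assoc X Y Z).hom ≫ tensor.bimap f (tensor.bimap g h)
  pentagon (X Y Z W : V) :
    (tensor.map (assoc X Y Z).hom).app W ≫ (assoc X ((tensor.obj Y).obj Z) W).hom ≫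
        (tensor.obj X).map (assoc Y Z W).hom =
      (assoc ((tensor.obj X).obj Y) Z W).hom ≫ (assoc X Y ((tensor.obj Z).obj W)).hom

/-- A symmetric semi-monoidal category. -/
class SymmetricSemiMonoidalCategory (V : Type*) [Category V] extends SemiMonoidalCategory V where
  /-- the symmetry `X ⊗ Y ≅ Y ⊗ X` -/
  braiding (X Y : V) : (tensor.obj X).obj Y ≅ (tensor.obj Y).obj X
  braiding_naturality {X X' Y Y' : V} (f : X ⟶ X') (g : Y ⟶ Y') :
    tensor.bimap f g ≫ (braiding X' Y').hom = (braiding X Y).hom ≫ tensor.bimap g f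
  symmetry (X Y : V) : (braiding X Y).hom ≫ (braiding Y X).hom = 𝟙 _
  hexagon (X Y Z : V) :
    (assoc X Y Z).hom ≫ (braiding X ((tensor.obj Y).obj Z)).hom ≫ (assoc Y Z X).hom =
      (tensor.map (braiding X Y).hom).app Z ≫ (assoc Y X Z).hom ≫
        (tensor.obj Y).map (braiding X Z).hom

open SemiMonoidalCategory in
/-- The structure of a (left) module over the symmetric semi-monoidal category `V` on the category
`M`, with tensoring functor `act`, where `X ▷ A = (act.obj X).obj A`. -/
structure SemiModule {V : Type*} [Category V] [SymmetricSemiMonoidalCategory V] {M : Type*}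
    [Category M] (act : V ⥤ M ⥤ M) where
  /-- the associator `(X ⊗ Y) ▷ A ≅ X ▷ (Y ▷ A)` -/
  assoc (X Y : V) (A : M) : (act.obj ((tensor.obj X).obj Y)).obj A ≅
    (act.obj X).obj ((act.obj Y).obj A)
  assoc_naturality {X X' Y Y' : V} {A A' : M} (f : X ⟶ X') (g : Y ⟶ Y') (h : A ⟶ A') :
    act.bimap (tensor.bimap f g) h ≫ (assoc X' Y' A').hom =
      (assoc X Y A).hom ≫ act.bimap f (act.bimap g h)
  pentagon (X Y Z : V) (A : M) :
    (act.map (SemiMonoidalCategory.assoc X Y Z).hom).app A ≫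
        (assoc X ((tensor.obj Y).obj Z) A).hom ≫ (act.obj X).map (assoc Y Z A).hom =
      (assoc ((tensor.obj X).obj Y) Z A).hom ≫ (assoc X Y ((act.obj Z).obj A)).hom

/-- The structure of a closed `V`-module on `M`, with tensoring `act`, enrichment `enr` and
cotensoring `cot`: a module structure for which `cot(X, -)` is right adjoint to `X ▷ -` and
`enr(A, -)` is right adjoint to `- ▷ A`, the adjunctions being natural in `X` and in `A`. -/
structure ClosedSemiModule {V : Type*} [Category V] [SymmetricSemiMonoidalCategory V] {M : Type*}
    [Category M] (act : V ⥤ M ⥤ M) (enr : Mᵒᵖ ⥤ M ⥤ V) (cot : Vᵒᵖ ⥤ M ⥤ M)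
    extends SemiModule act where
  /-- `cot(X, -)` is right adjoint to `X ▷ -` -/
  cotAdj : act ⊣₂ cot
  /-- `enr(A, -)` is right adjoint to `- ▷ A` -/
  enrAdj : act.flip ⊣₂ enr

end CategoryTheory

/-! ### Algebras and coalgebras -/

/-- A non-unital associative dg algebra. -/
structure NonUnitalDGAlg (k : Type u) [Field k] where
  /-- the underlying dg vector space -/
  X : DGVec k
  /-- the multiplication -/
  mul : X ⊗ X ⟶ X
  mul_assoc : mul ▷ X ≫ mul = (α_ X X X).hom ≫ X ◁ mul ≫ mul

namespace NonUnitalDGAlg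

variable {k : Type u} [Field k]

/-- Morphisms of non-unital dg algebras. -/
@[ext]
structure Hom (A B : NonUnitalDGAlg k) where
  /-- the underlying morphism of dg vector spaces -/
  hom : A.X ⟶ B.X
  mul_hom : A.mul ≫ hom = (hom ⊗ₘ hom) ≫ B.mul

instance : Category (NonUnitalDGAlg k) where
  Hom := Hom
  id A := ⟨𝟙 A.X, by simp⟩
  comp f g := ⟨f.hom ≫ g.hom, by
    rw [← Category.assoc, f.mul_hom, Category.assoc, g.mul_hom, ← Category.assoc,
      tensorHom_comp_tensorHom]⟩
  id_comp f := Hom.ext (Category.id_comp f.hom)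
  comp_id f := Hom.ext (Category.comp_id f.hom)
  assoc f g h := Hom.ext (Category.assoc f.hom g.hom h.hom)

lemma hom_ext {A B : NonUnitalDGAlg k} {f g : A ⟶ B} (h : f.hom = g.hom) : f = g := Hom.ext h

@[simp] lemma id_hom (A : NonUnitalDGAlg k) : Hom.hom (𝟙 A) = 𝟙 A.X := rfl

@[simp] lemma comp_hom {A B C : NonUnitalDGAlg k} (f : A ⟶ B) (g : B ⟶ C) :
    (f ≫ g).hom = f.hom ≫ g.hom := rfl

end NonUnitalDGAlg

/-- A non-counital coassociative dg coalgebra. -/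
structure NonCounitalDGCoalg (k : Type u) [Field k] where
  /-- the underlying dg vector space -/
  X : DGVec k
  /-- the comultiplication -/
  comul : X ⟶ X ⊗ X
  comul_assoc : comul ≫ comul ▷ X ≫ (α_ X X X).hom = comul ≫ X ◁ comul

namespace NonCounitalDGCoalg

variable {k : Type u} [Field k]

/-- Morphisms of non-counital dg coalgebras. -/
@[ext]
structure Hom (C D : NonCounitalDGCoalg k) where
  /-- the underlying morphism of dg vector spaces -/
  hom : C.X ⟶ D.X
  hom_comul : hom ≫ D.comul = C.comul ≫ (hom ⊗ₘ hom)

instance : Category (NonCounitalDGCoalg k) where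
  Hom := Hom
  id A := ⟨𝟙 A.X, by simp⟩
  comp f g := ⟨f.hom ≫ g.hom, by
    rw [Category.assoc, g.hom_comul, ← Category.assoc, f.hom_comul, Category.assoc,
      tensorHom_comp_tensorHom]⟩
  id_comp f := Hom.ext (Category.id_comp f.hom)
  comp_id f := Hom.ext (Category.comp_id f.hom)
  assoc f g h := Hom.ext (Category.assoc f.hom g.hom h.hom)

lemma hom_ext {C D : NonCounitalDGCoalg k} {f g : C ⟶ D} (h : f.hom = g.hom) : f = g := Hom.ext h

@[simp] lemma id_hom (C : NonCounitalDGCoalg k) : Hom.hom (𝟙 C) = 𝟙 C.X := rfl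

@[simp] lemma comp_hom {C D E : NonCounitalDGCoalg k} (f : C ⟶ D) (g : D ⟶ E) :
    (f ≫ g).hom = f.hom ≫ g.hom := rfl

/-- An isomorphism of coalgebras from an isomorphism of dg vector spaces. -/
def mkIso {C D : NonCounitalDGCoalg k} (e : C.X ≅ D.X)
    (h : e.hom ≫ D.comul = C.comul ≫ (e.hom ⊗ₘ e.hom)) : C ≅ D where
  hom := ⟨e.hom, h⟩
  inv := ⟨e.inv, by
    rw [← cancel_epi e.hom, e.hom_inv_id_assoc, ← Category.assoc, h, Category.assoc,
      tensorHom_comp_tensorHom, e.hom_inv_id]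
    simp⟩
  hom_inv_id := hom_ext e.hom_inv_id
  inv_hom_id := hom_ext e.inv_hom_id

/-- The iterated comultiplication `Δⁿ : C → C^{⊗(n+1)}`, where `Δ⁰ = id` and
`Δⁿ⁺¹ = (Δⁿ ⊗ id) Δ`. -/
noncomputable def iterComul (C : NonCounitalDGCoalg k) : (n : ℕ) → C.X →ₗ[k] ⨂[k]^(n + 1) C.X
  | 0 => (PiTensorProduct.subsingletonEquiv (R := k) (s := fun _ : Fin 1 => C.X.carrier)
      0).symm.toLinearMap
  | n + 1 => TensorPower.mulEquiv.toLinearMap ∘ₗ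
      TensorProduct.map (C.iterComul n)
        (PiTensorProduct.subsingletonEquiv (R := k) (s := fun _ : Fin 1 => C.X.carrier)
          0).symm.toLinearMap ∘ₗ C.comul.lin

/-- A coalgebra is conilpotent if every element is annihilated by some `Δⁿ`. -/
def IsConilpotent : ObjectProperty (NonCounitalDGCoalg k) :=
  fun C => ∀ x : C.X, ∃ n : ℕ, C.iterComul n x = 0

/-- The tensor product of coalgebras. -/
noncomputable def tensor (C D : NonCounitalDGCoalg k) : NonCounitalDGCoalg k where
  X := C.X ⊗ D.X
  comul := (C.comul ⊗ₘ D.comul) ≫ tensorμ C.X C.X D.X D.X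
  comul_assoc := by
    have e1 := tensorμ_natural C.comul (𝟙 C.X) D.comul (𝟙 D.X)
    have e2 := tensorμ_natural (𝟙 C.X) C.comul (𝟙 D.X) D.comul
    simp only [id_tensorHom, tensorHom_id, id_whiskerRight,
      tensorHom_id] at e1 e2
    simp only [Category.assoc, comp_whiskerRight, MonoidalCategory.whiskerLeft_comp]
    rw [← reassoc_of% e1, ← reassoc_of% e2, associator_monoidal,
      tensorHom_comp_tensorHom_assoc, tensorHom_comp_tensorHom_assoc,
      tensorHom_comp_tensorHom_assoc, Category.assoc, Category.assoc, C.comul_assoc, D.comul_assoc]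

/-- The tensor product of morphisms of coalgebras. -/
noncomputable def tensorMap {C C' D D' : NonCounitalDGCoalg k} (f : C ⟶ C') (g : D ⟶ D') :
    tensor C D ⟶ tensor C' D' where
  hom := f.hom ⊗ₘ g.hom
  hom_comul := by
    change (f.hom ⊗ₘ g.hom) ≫ (C'.comul ⊗ₘ D'.comul) ≫ tensorμ C'.X C'.X D'.X D'.X =
      ((C.comul ⊗ₘ D.comul) ≫ tensorμ C.X C.X D.X D.X) ≫
        ((f.hom ⊗ₘ g.hom : C.X ⊗ D.X ⟶ C'.X ⊗ D'.X) ⊗ₘ (f.hom ⊗ₘ g.hom))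
    rw [tensorHom_comp_tensorHom_assoc, f.hom_comul, g.hom_comul, Category.assoc,
      ← tensorμ_natural, tensorHom_comp_tensorHom_assoc]

/-- The associator. -/
noncomputable def assocIso (C D E : NonCounitalDGCoalg k) :
    tensor (tensor C D) E ≅ tensor C (tensor D E) :=
  mkIso (α_ C.X D.X E.X) (by
    have e := tensor_associativity C.X C.X D.X D.X E.X E.X
    change (α_ C.X D.X E.X).hom ≫ (C.comul ⊗ₘ ((D.comul ⊗ₘ E.comul) ≫ tensorμ D.X D.X E.X E.X)) ≫
        tensorμ C.X C.X (D.X ⊗ E.X) (D.X ⊗ E.X) =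
      ((((C.comul ⊗ₘ D.comul) ≫ tensorμ C.X C.X D.X D.X) ⊗ₘ E.comul) ≫
        tensorμ (C.X ⊗ D.X) (C.X ⊗ D.X) E.X E.X) ≫
        ((α_ C.X D.X E.X).hom ⊗ₘ (α_ C.X D.X E.X).hom)
    rw [← Category.comp_id E.comul, ← tensorHom_comp_tensorHom, Category.assoc, Category.assoc,
      tensorHom_id, e, associator_naturality_assoc, Category.comp_id, ← id_tensorHom,
      tensorHom_comp_tensorHom_assoc, Category.comp_id])

/-- The symmetry. -/
noncomputable def braidIso (C D : NonCounitalDGCoalg k) : tensor C D ≅ tensor D C :=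
  mkIso (β_ C.X D.X) (by
    change (β_ C.X D.X).hom ≫ (D.comul ⊗ₘ C.comul) ≫ tensorμ D.X D.X C.X C.X =
      ((C.comul ⊗ₘ D.comul) ≫ tensorμ C.X C.X D.X D.X) ≫
        ((β_ C.X D.X).hom ⊗ₘ (β_ C.X D.X).hom)
    rw [Category.assoc, DGVec.tensorμ_braiding, BraidedCategory.braiding_naturality_assoc])

end NonCounitalDGCoalg

namespace NonCounitalDGCoalg

variable {k : Type u} [Field k]

lemma iterComul_succ_eq_zero (C : NonCounitalDGCoalg k) (n : ℕ) (x : C.X)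
    (z : C.X ⊗[k] C.X) (hz : C.comul.lin x = z) :
    C.iterComul (n + 1) x = 0 ↔
      z ∈ LinearMap.range ((LinearMap.ker (C.iterComul n)).subtype.rTensor C.X) := by
  let e := (PiTensorProduct.subsingletonEquiv (R := k) (s := fun _ : Fin 1 => C.X.carrier)
      0).symm
  have h1 : C.iterComul (n + 1) x = TensorPower.mulEquiv
      (TensorProduct.map (C.iterComul n) e.toLinearMap z) := by
    rw [← hz]
    rfl
  have h2 : TensorProduct.map (C.iterComul n) e.toLinearMap z =
      e.toLinearMap.lTensor _ ((C.iterComul n).rTensor C.X z) := by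
    rw [← LinearMap.comp_apply, LinearMap.lTensor_comp_rTensor]
  have h3 : Function.Injective (e.toLinearMap.lTensor (⨂[k]^(n + 1) C.X)) :=
    Module.Flat.lTensor_preserves_injective_linearMap _ e.injective
  rw [h1, LinearEquiv.map_eq_zero_iff, h2, map_eq_zero_iff _ h3]
  exact Module.Flat.rTensor_exact C.X (LinearMap.exact_subtype_ker_map (C.iterComul n)) z

lemma mem_range_of_tensorμ (V W : DGVec k) (F : Submodule k V) (G : Submodule k (V ⊗[k] W))
    (h : ∀ a ∈ F, ∀ c : W, a ⊗ₜ[k] c ∈ G)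
    (T : (V ⊗[k] V) ⊗[k] (W ⊗[k] W) →ₗ[k] (V ⊗[k] W) ⊗[k] (V ⊗[k] W))
    (hT : ∀ (p q : ℤ) (a b : V) (c d : W), b ∈ V.gr p → c ∈ W.gr q →
      T ((a ⊗ₜ[k] b) ⊗ₜ[k] (c ⊗ₜ[k] d)) =
        koszulSign k (p * q) • ((a ⊗ₜ[k] c) ⊗ₜ[k] (b ⊗ₜ[k] d)))
    (z : V ⊗[k] V) (hz : z ∈ LinearMap.range (F.subtype.rTensor V)) (v : W ⊗[k] W) :
    T (z ⊗ₜ[k] v) ∈ LinearMap.range (G.subtype.rTensor (V ⊗[k] W)) := by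
  have h1 : ∀ a ∈ F, ∀ (b : V) (c d : W), T ((a ⊗ₜ[k] b) ⊗ₜ[k] (c ⊗ₜ[k] d)) ∈
      LinearMap.range (G.subtype.rTensor (V ⊗[k] W)) := by
    intro a ha b c d
    induction b using V.homog_induction with
    | h0 => simp
    | hadd b b' hb hb' =>
      rw [TensorProduct.tmul_add, TensorProduct.add_tmul, map_add]
      exact add_mem hb hb'
    | hom p b hb =>
      induction c using W.homog_induction with
      | h0 => simp
      | hadd c c' hc hc' =>
        rw [TensorProduct.add_tmul, TensorProduct.tmul_add, map_add]
        exact add_mem hc hc'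
      | hom q c hc =>
        rw [hT p q a b c d hb hc]
        exact Submodule.smul_mem _ _ ⟨(⟨_, h a ha c⟩ : G) ⊗ₜ[k] (b ⊗ₜ[k] d), rfl⟩
  obtain ⟨w, rfl⟩ := hz
  induction w using TensorProduct.induction_on with
  | zero => simp
  | add w w' hw hw' =>
    rw [map_add, TensorProduct.add_tmul, map_add]
    exact add_mem hw hw'
  | tmul a b =>
    induction v using TensorProduct.induction_on with
    | zero => simp
    | add v v' hv hv' =>
      rw [TensorProduct.tmul_add, map_add]
      exact add_mem hv hv'
    | tmul c d => exact h1 a a.2 b c d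

lemma iterComul_tensor (C D : NonCounitalDGCoalg k) (n : ℕ) (x : C.X) (y : D.X)
    (hx : C.iterComul n x = 0) :
    x ⊗ₜ[k] y ∈ LinearMap.ker ((tensor C D).iterComul n) := by
  induction n generalizing x y with
  | zero =>
    have h0 : x = 0 := (LinearEquiv.map_eq_zero_iff _).1 hx
    rw [h0, TensorProduct.zero_tmul]
    exact zero_mem _
  | succ n ih =>
    rw [iterComul_succ_eq_zero _ _ _ _ rfl] at hx
    refine (iterComul_succ_eq_zero (tensor C D) n _ _ rfl).2 ?_
    exact mem_range_of_tensorμ C.X D.X (LinearMap.ker (C.iterComul n))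
      (LinearMap.ker ((tensor C D).iterComul n)) (fun a ha c => ih a c ha)
      (tensorμ C.X C.X D.X D.X).lin
      (fun p q a b c d hb hc => DGVec.tensorμ_tmul C.X C.X D.X D.X a d hb hc)
      (C.comul.lin x) hx (D.comul.lin y)

lemma iterComul_succ_of_eq_zero (C : NonCounitalDGCoalg k) (n : ℕ) (x : C.X)
    (h : C.iterComul n x = 0) : C.iterComul (n + 1) x = 0 := by
  induction n generalizing x with
  | zero =>
    have h0 : x = 0 := (LinearEquiv.map_eq_zero_iff _).1 h
    rw [h0, map_zero]
  | succ n ih =>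
    rw [iterComul_succ_eq_zero _ _ _ _ rfl] at h ⊢
    obtain ⟨w, hw⟩ := h
    refine ⟨(Submodule.inclusion (fun a ha => ih a ha) :
      LinearMap.ker (C.iterComul n) →ₗ[k] LinearMap.ker (C.iterComul (n + 1))).rTensor C.X w, ?_⟩
    rw [← hw, ← LinearMap.comp_apply, ← LinearMap.rTensor_comp]
    rfl

lemma iterComul_eq_zero_of_le (C : NonCounitalDGCoalg k) {m n : ℕ} (hmn : m ≤ n) (x : C.X)
    (h : C.iterComul m x = 0) : C.iterComul n x = 0 := by
  induction n, hmn using Nat.le_induction with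
  | base => exact h
  | succ n _ ih => exact C.iterComul_succ_of_eq_zero n x ih

lemma IsConilpotent.tensor {C : NonCounitalDGCoalg k} (h : IsConilpotent C)
    (D : NonCounitalDGCoalg k) : IsConilpotent (tensor C D) := by
  intro (z : C.X ⊗[k] D.X)
  induction z using TensorProduct.induction_on with
  | zero => exact ⟨0, map_zero _⟩
  | tmul x y =>
    obtain ⟨n, hn⟩ := h x
    exact ⟨n, iterComul_tensor C D n x y hn⟩
  | add z w hz hw =>
    obtain ⟨m, hm⟩ := hz
    obtain ⟨n, hn⟩ := hw
    refine ⟨max m n, ?_⟩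
    refine (map_add ((NonCounitalDGCoalg.tensor C D).iterComul (max m n)) _ _).trans ?_
    rw [iterComul_eq_zero_of_le _ (le_max_left m n) _ hm,
      iterComul_eq_zero_of_le _ (le_max_right m n) _ hn, add_zero]

end NonCounitalDGCoalg

/-- The category of conilpotent non-counital dg coalgebras, a full subcategory of the category of
non-counital dg coalgebras. -/
abbrev ConilDGCoalg (k : Type u) [Field k] : Type (u + 1) :=
  (NonCounitalDGCoalg.IsConilpotent (k := k)).FullSubcategory

namespace ConilDGCoalg

variable {k : Type u} [Field k]

open NonCounitalDGCoalg

/-- The tensor product of conilpotent coalgebras, as a bifunctor. -/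
noncomputable def tensorFunctor (k : Type u) [Field k] :
    ConilDGCoalg k ⥤ ConilDGCoalg k ⥤ ConilDGCoalg k where
  obj C :=
    { obj D := ⟨tensor C.obj D.obj, C.property.tensor D.obj⟩
      map g := ObjectProperty.homMk (tensorMap (𝟙 C.obj) g.hom)
      map_id D := by
        ext : 1
        exact hom_ext (id_tensorHom_id _ _)
      map_comp g h := by
        ext : 1
        exact hom_ext (MonoidalCategory.whiskerLeft_comp C.obj.X g.hom.hom h.hom.hom) }
  map f :=
    { app D := ObjectProperty.homMk (tensorMap f.hom (𝟙 D.obj))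
      naturality D D' g := by
        ext : 1
        exact hom_ext (whisker_exchange f.hom.hom g.hom.hom) }
  map_id C := by
    ext D : 3
    exact hom_ext (id_tensorHom_id _ _)
  map_comp f g := by
    ext D : 3
    exact hom_ext (comp_whiskerRight f.hom.hom g.hom.hom D.obj.X)

lemma tensorFunctor_bimap_hom {C C' D D' : ConilDGCoalg k} (f : C ⟶ C') (g : D ⟶ D') :
    ((tensorFunctor k).bimap f g).hom.hom = f.hom.hom ⊗ₘ g.hom.hom :=
  (MonoidalCategory.tensorHom_def f.hom.hom g.hom.hom).symm

noncomputable instance : SymmetricSemiMonoidalCategory (ConilDGCoalg k) where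
  tensor := tensorFunctor k
  assoc C D E := ObjectProperty.isoMk _ (assocIso C.obj D.obj E.obj)
  assoc_naturality f g h := by
    ext : 1
    apply hom_ext
    change ((tensorFunctor k).bimap ((tensorFunctor k).bimap f g) h).hom.hom ≫ (α_ _ _ _).hom =
      (α_ _ _ _).hom ≫ ((tensorFunctor k).bimap f ((tensorFunctor k).bimap g h)).hom.hom
    simp only [tensorFunctor_bimap_hom]
    exact associator_naturality f.hom.hom g.hom.hom h.hom.hom
  pentagon C D E F := by
    ext : 1
    exact hom_ext (MonoidalCategory.pentagon C.obj.X D.obj.X E.obj.X F.obj.X)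
  braiding C D := ObjectProperty.isoMk _ (braidIso C.obj D.obj)
  braiding_naturality f g := by
    ext : 1
    apply hom_ext
    change ((tensorFunctor k).bimap f g).hom.hom ≫ (β_ _ _).hom =
      (β_ _ _).hom ≫ ((tensorFunctor k).bimap g f).hom.hom
    simp only [tensorFunctor_bimap_hom]
    exact BraidedCategory.braiding_naturality f.hom.hom g.hom.hom
  symmetry C D := by
    ext : 1
    exact hom_ext (SymmetricCategory.symmetry C.obj.X D.obj.X)
  hexagon C D E := by
    ext : 1
    exact hom_ext (BraidedCategory.hexagon_forward C.obj.X D.obj.X E.obj.X)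

end ConilDGCoalg

namespace DGVec
variable {k : Type u} [Field k]

lemma scale_koszulSign_tensor (V W : DGVec k) (q : ℤ) :
    (tensor V W).scale (fun p => koszulSign k (q * p)) =
      TensorProduct.map (V.scale fun p => koszulSign k (q * p))
        (W.scale fun p => koszulSign k (q * p)) := by
  apply ext_homog₂
  intro a x hx b y hy
  refine ((tensor V W).scale_apply _ (tmul_mem_tensorGr V W rfl hx hy)).trans ?_
  have h : TensorProduct.map (V.scale fun p => koszulSign k (q * p))
      (W.scale fun p => koszulSign k (q * p)) (x ⊗ₜ[k] y) =
      koszulSign k (q * (a + b)) • (x ⊗ₜ[k] y) := by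
    rw [TensorProduct.map_tmul, V.scale_apply _ hx, W.scale_apply _ hy, mul_add, koszulSign_add,
      TensorProduct.tmul_smul, ← TensorProduct.smul_tmul', smul_smul, mul_comm]
  exact h.symm

lemma scale_koszulSign_add (V : DGVec k) (q r : ℤ) :
    (V.scale fun p => koszulSign k (q * p)) ∘ₗ (V.scale fun p => koszulSign k (r * p)) =
      V.scale fun p => koszulSign k ((q + r) * p) := by
  apply ext_homog
  intro n x hx
  simp only [LinearMap.comp_apply, V.scale_apply _ hx, map_smul, smul_smul, add_mul,
    koszulSign_add]
  rw [mul_comm]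

end DGVec

/-! ### The convolution algebra -/

namespace NonUnitalDGAlg

open DGVec

variable {k : Type u} [Field k]

/-- The convolution product `f * g = μ ∘ (f ⊗ g) ∘ Δ`. -/
noncomputable def convMul (C : NonCounitalDGCoalg k) (A : NonUnitalDGAlg k) :
    ihom C.X A.X ⊗ ihom C.X A.X ⟶ ihom C.X A.X :=
  homTensor C.X A.X C.X A.X ≫ ihomMap C.comul A.mul

lemma convMul_tmul (C : NonCounitalDGCoalg k) (A : NonUnitalDGAlg k) (f : ihom C.X A.X) {q : ℤ}
    {g : ihom C.X A.X} (hg : g ∈ (ihom C.X A.X).gr q) :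
    ihomVal C.X A.X ((convMul C A).lin (f ⊗ₜ[k] g)) =
      A.mul.lin ∘ₗ homTensorAux C.X A.X C.X A.X q (ihomVal C.X A.X f) (ihomVal C.X A.X g) ∘ₗ
        C.comul.lin := by
  refine (ihomVal_ihomMap C.comul A.mul ((homTensor C.X A.X C.X A.X).lin (f ⊗ₜ[k] g))).trans ?_
  rw [homTensor_tmul C.X A.X C.X A.X f hg]
  rfl

lemma convMul_assoc_aux {V W : Type u} [AddCommGroup V] [Module k V] [AddCommGroup W] [Module k W]
    (Δ : V →ₗ[k] V ⊗[k] V) (μ : W ⊗[k] W →ₗ[k] W)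
    (hΔ : (TensorProduct.assoc k V V V).toLinearMap ∘ₗ TensorProduct.map Δ LinearMap.id ∘ₗ Δ =
      TensorProduct.map LinearMap.id Δ ∘ₗ Δ)
    (hμ : μ ∘ₗ TensorProduct.map μ LinearMap.id =
      μ ∘ₗ TensorProduct.map LinearMap.id μ ∘ₗ (TensorProduct.assoc k W W W).toLinearMap)
    (F G H : V →ₗ[k] W) :
    μ ∘ₗ TensorProduct.map (μ ∘ₗ TensorProduct.map F G ∘ₗ Δ) H ∘ₗ Δ =
      μ ∘ₗ TensorProduct.map F (μ ∘ₗ TensorProduct.map G H ∘ₗ Δ) ∘ₗ Δ := by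
  have h1 : TensorProduct.map (μ ∘ₗ TensorProduct.map F G ∘ₗ Δ) H =
      TensorProduct.map μ LinearMap.id ∘ₗ TensorProduct.map (TensorProduct.map F G) H ∘ₗ
        TensorProduct.map Δ LinearMap.id := by
    rw [← TensorProduct.map_comp, ← TensorProduct.map_comp, LinearMap.id_comp, LinearMap.comp_id]
  have h2 : TensorProduct.map F (μ ∘ₗ TensorProduct.map G H ∘ₗ Δ) =
      TensorProduct.map LinearMap.id μ ∘ₗ TensorProduct.map F (TensorProduct.map G H) ∘ₗ
        TensorProduct.map LinearMap.id Δ := by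
    rw [← TensorProduct.map_comp, ← TensorProduct.map_comp, LinearMap.id_comp, LinearMap.comp_id]
  have h3 : TensorProduct.map F (TensorProduct.map G H) ∘ₗ
      (TensorProduct.assoc k V V V).toLinearMap = (TensorProduct.assoc k W W W).toLinearMap ∘ₗ
        TensorProduct.map (TensorProduct.map F G) H :=
    TensorProduct.ext_threefold fun _ _ _ => rfl
  rw [h1, h2]
  refine LinearMap.ext fun x => ?_
  refine (congrArg (fun φ => φ (TensorProduct.map (TensorProduct.map F G) H
    (TensorProduct.map Δ LinearMap.id (Δ x)))) hμ).trans ?_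
  refine Eq.trans ?_ (congrArg (fun φ => μ (TensorProduct.map LinearMap.id μ
    (TensorProduct.map F (TensorProduct.map G H) (φ x)))) hΔ)
  exact (congrArg (fun φ => μ (TensorProduct.map LinearMap.id μ
    (φ (TensorProduct.map Δ LinearMap.id (Δ x))))) h3).symm

/-- The convolution algebra `{C, A}`. -/
noncomputable def conv (C : NonCounitalDGCoalg k) (A : NonUnitalDGAlg k) : NonUnitalDGAlg k where
  X := ihom C.X A.X
  mul := convMul C A
  mul_assoc := by
    apply DGVec.hom_ext
    apply ext_homog₃
    intro p f hf q g hg r h hh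
    apply ihomVal_injective
    have hgh : (convMul C A).lin (g ⊗ₜ[k] h) ∈ (ihom C.X A.X).gr (q + r) :=
      (convMul C A).map_mem _ _ (tmul_mem_tensorGr _ _ rfl hg hh)
    change ihomVal C.X A.X ((convMul C A).lin ((convMul C A).lin (f ⊗ₜ[k] g) ⊗ₜ[k] h)) =
      ihomVal C.X A.X ((convMul C A).lin (f ⊗ₜ[k] (convMul C A).lin (g ⊗ₜ[k] h)))
    rw [convMul_tmul C A _ hh, convMul_tmul C A _ hg, convMul_tmul C A _ hgh,
      convMul_tmul C A _ hh]
    have hco : (TensorProduct.assoc k C.X C.X C.X).toLinearMap ∘ₗ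
        TensorProduct.map C.comul.lin LinearMap.id ∘ₗ C.comul.lin =
        TensorProduct.map LinearMap.id C.comul.lin ∘ₗ C.comul.lin :=
      congrArg Hom.lin C.comul_assoc
    have hmu : A.mul.lin ∘ₗ TensorProduct.map A.mul.lin LinearMap.id =
        A.mul.lin ∘ₗ TensorProduct.map LinearMap.id A.mul.lin ∘ₗ
          (TensorProduct.assoc k A.X A.X A.X).toLinearMap :=
      congrArg Hom.lin A.mul_assoc
    have hs : C.comul.lin ∘ₗ (C.X.scale fun p => koszulSign k (r * p)) =
        TensorProduct.map (C.X.scale fun p => koszulSign k (r * p))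
          (C.X.scale fun p => koszulSign k (r * p)) ∘ₗ C.comul.lin :=
      (Hom.lin_scale C.comul _).trans
        (congrArg (· ∘ₗ C.comul.lin) (scale_koszulSign_tensor C.X C.X r))
    have key := convMul_assoc_aux C.comul.lin A.mul.lin hco hmu
      (ihomVal C.X A.X f ∘ₗ C.X.scale fun p => koszulSign k ((q + r) * p))
      (ihomVal C.X A.X g ∘ₗ C.X.scale fun p => koszulSign k (r * p)) (ihomVal C.X A.X h)
    refine Eq.trans ?_ key
    refine congrArg (fun X : C.X →ₗ[k] A.X =>
      A.mul.lin ∘ₗ TensorProduct.map X (ihomVal C.X A.X h) ∘ₗ C.comul.lin) ?_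
    change A.mul.lin ∘ₗ (TensorProduct.map
      (ihomVal C.X A.X f ∘ₗ C.X.scale fun p => koszulSign k (q * p)) (ihomVal C.X A.X g)) ∘ₗ
      (C.comul.lin ∘ₗ (C.X.scale fun p => koszulSign k (r * p))) = _
    rw [← scale_koszulSign_add]
    refine (congrArg (fun X => A.mul.lin ∘ₗ (TensorProduct.map
      (ihomVal C.X A.X f ∘ₗ C.X.scale fun p => koszulSign k (q * p)) (ihomVal C.X A.X g)) ∘ₗ X)
      hs).trans ?_
    refine congrArg (A.mul.lin ∘ₗ ·) ?_
    exact congrArg (fun Y : (C.X ⊗[k] C.X) →ₗ[k] (A.X ⊗[k] A.X) => Y ∘ₗ C.comul.lin)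
      (TensorProduct.map_comp (ihomVal C.X A.X f ∘ₗ C.X.scale fun p => koszulSign k (q * p))
        (ihomVal C.X A.X g) (C.X.scale fun p => koszulSign k (r * p))
        (C.X.scale fun p => koszulSign k (r * p))).symm

/-- Functoriality of the convolution algebra. -/
noncomputable def convMap {C C' : NonCounitalDGCoalg k} {A A' : NonUnitalDGAlg k} (h : C' ⟶ C)
    (g : A ⟶ A') : conv C A ⟶ conv C' A' where
  hom := ihomMap h.hom g.hom
  mul_hom := by
    apply DGVec.hom_ext
    apply ext_homog₂
    intro p (a : ihom C.X A.X) ha q (b : ihom C.X A.X) hb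
    apply ihomVal_injective
    have hb' : (ihomMap h.hom g.hom).lin b ∈ (ihom C'.X A'.X).gr q :=
      (ihomMap h.hom g.hom).map_mem _ _ hb
    change ihomVal C'.X A'.X ((ihomMap h.hom g.hom).lin ((convMul C A).lin (a ⊗ₜ[k] b))) =
      ihomVal C'.X A'.X ((convMul C' A').lin
        ((ihomMap h.hom g.hom).lin a ⊗ₜ[k] (ihomMap h.hom g.hom).lin b))
    rw [convMul_tmul C' A' _ hb', ihomVal_ihomMap, ihomVal_ihomMap, ihomVal_ihomMap,
      convMul_tmul C A _ hb]
    have hh : TensorProduct.map h.hom.lin h.hom.lin ∘ₗ C'.comul.lin = C.comul.lin ∘ₗ h.hom.lin :=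
      (congrArg DGVec.Hom.lin h.hom_comul).symm
    have hg : A'.mul.lin ∘ₗ TensorProduct.map g.hom.lin g.hom.lin = g.hom.lin ∘ₗ A.mul.lin :=
      (congrArg DGVec.Hom.lin g.mul_hom).symm
    have hs := DGVec.Hom.lin_scale h.hom fun p => koszulSign k (q * p)
    have e : homTensorAux C'.X A'.X C'.X A'.X q (g.hom.lin ∘ₗ ihomVal C.X A.X a ∘ₗ h.hom.lin)
        (g.hom.lin ∘ₗ ihomVal C.X A.X b ∘ₗ h.hom.lin) =
        TensorProduct.map g.hom.lin g.hom.lin ∘ₗ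
          homTensorAux C.X A.X C.X A.X q (ihomVal C.X A.X a) (ihomVal C.X A.X b) ∘ₗ
          TensorProduct.map h.hom.lin h.hom.lin := by
      rw [homTensorAux, homTensorAux, ← TensorProduct.map_comp, ← TensorProduct.map_comp,
        LinearMap.comp_assoc, LinearMap.comp_assoc, LinearMap.comp_assoc, hs]
    rw [e]
    refine LinearMap.ext fun x => ?_
    refine Eq.trans ?_ (congrArg (fun F => F (homTensorAux C.X A.X C.X A.X q (ihomVal C.X A.X a)
      (ihomVal C.X A.X b) (TensorProduct.map h.hom.lin h.hom.lin (C'.comul.lin x)))) hg).symm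
    exact (congrArg (fun F => g.hom.lin (A.mul.lin (homTensorAux C.X A.X C.X A.X q
      (ihomVal C.X A.X a) (ihomVal C.X A.X b) (F x)))) hh).symm

/-- The convolution algebra functor. -/
noncomputable def convFunctor (k : Type u) [Field k] :
    (ConilDGCoalg k)ᵒᵖ ⥤ NonUnitalDGAlg k ⥤ NonUnitalDGAlg k where
  obj C :=
    { obj A := conv C.unop.obj A
      map g := convMap (𝟙 C.unop.obj) g
      map_id A := hom_ext (ihom_ext fun _ => rfl)
      map_comp g g' := hom_ext (ihom_ext fun _ => rfl) }
  map h :=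
    { app A := convMap h.unop.hom (𝟙 A)
      naturality A A' g := hom_ext (ihom_ext fun _ => rfl) }
  map_id C := by
    ext A : 2
    exact hom_ext (ihom_ext fun _ => rfl)
  map_comp h h' := by
    ext A : 2
    exact hom_ext (ihom_ext fun _ => rfl)

end NonUnitalDGAlg

/-- The universal measuring `u : C ⊗ A → C ▷ A` attached to a left adjoint `C ▷ -` of the
convolution algebra functor `{C, -}`: the map of dg vector spaces which corresponds to the unit
`A → {C, C ▷ A}` of the adjunction under the tensor-hom adjunction of dg vector spaces. -/
noncomputable def NonUnitalDGAlg.univMeasuring {k : Type u} [Field k]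
    {act : ConilDGCoalg k ⥤ NonUnitalDGAlg k ⥤ NonUnitalDGAlg k}
    (h : act ⊣₂ NonUnitalDGAlg.convFunctor k) (C : ConilDGCoalg k) (A : NonUnitalDGAlg k) :
    C.obj.X ⊗ A.X ⟶ ((act.obj C).obj A).X :=
  C.obj.X ◁ (h.homEquiv (𝟙 ((act.obj C).obj A))).hom ≫
    DGVec.ihomEval C.obj.X ((act.obj C).obj A).X

/-! By the tensor-hom adjunction, an algebra map `A → {C, B}` is a measuring: a dg map `u : C ⊗ A →
B` with `u(c, a a') = ∑ ± u(c₁, a) u(c₂, a')`. The three Hom-sets in the theorem are three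
descriptions of the set of measurings, so this set has to be represented once as a functor of `B`
and once as a functor of `C`.

For fixed `C` and `A`, divide the free algebra on `C ⊗ A` by the dg ideal generated by the failure
of the inclusion of letters to be a measuring (`exists_tensoring`). For fixed `A` and `B`, take the
cofree conilpotent coalgebra on `[A, B]` and in it the largest dg subcoalgebra on which evaluation
is a measuring (`exists_enrichment`). Both work because `measuringDefect`, though quadratic in `u`,
is natural along coalgebra maps and algebra maps.

The free algebra and the cofree coalgebra both live on the space of non-empty words, with
concatenation and deconcatenation. Cofreeness (`exists_cofree_lift`, `cofree_hom_ext`) holds because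
a coalgebra map `f` into words with cogenerator part `φ` satisfies the affine recursion `f = letter
φ + snoc (f ⊗ φ) Δ`. On a conilpotent coalgebra such a recursion has exactly one solution: if `Δⁿ⁺¹
x = 0`, then `Δ x` lies in `ker Δⁿ ⊗ C`.

For the module structure, measurings compose (`IsMeasuring.comp`), and the composite of two
universal ones induces `a`. Conversely, a measuring of `C ⊗ D` curries to a measuring of `D` with
values in `{C, B}` (`IsMeasuring.of_comp_ihomEval`). Hence both sides of `a` represent the same
functor and `a` is invertible. Algebra maps out of `C ▷ A` are determined by their composites with
`u`, so naturality and the pentagon for `a` reduce to those of dg vector spaces. The last adjunction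
is the composite of the given bijections. -/

namespace DGVec

variable {k : Type u} [Field k]

/-! ### Additive structure on morphisms -/

namespace Hom

variable {V W : DGVec k}

instance : Zero (Hom V W) := ⟨⟨0, fun _ _ _ => zero_mem _, fun x => by simp⟩⟩

instance : Add (Hom V W) := ⟨fun f g => ⟨f.lin + g.lin,
  fun n x hx => add_mem (f.map_mem n x hx) (g.map_mem n x hx),
  fun x => by simp [f.map_d, g.map_d]⟩⟩

instance : Neg (Hom V W) := ⟨fun f => ⟨-f.lin,
  fun n x hx => neg_mem (f.map_mem n x hx), fun x => by simp [f.map_d]⟩⟩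

instance : Sub (Hom V W) := ⟨fun f g => ⟨f.lin - g.lin,
  fun n x hx => sub_mem (f.map_mem n x hx) (g.map_mem n x hx),
  fun x => by simp [f.map_d, g.map_d]⟩⟩

instance : SMul ℕ (Hom V W) := ⟨fun m f => ⟨m • f.lin,
  fun n x hx => (W.gr n).smul_of_tower_mem m (f.map_mem n x hx), fun x => by simp [f.map_d]⟩⟩

instance : SMul ℤ (Hom V W) := ⟨fun m f => ⟨m • f.lin,
  fun n x hx => (W.gr n).smul_of_tower_mem m (f.map_mem n x hx), fun x => by simp [f.map_d]⟩⟩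

lemma lin_injective : Function.Injective (Hom.lin : Hom V W → (V →ₗ[k] W)) :=
  fun _ _ h => Hom.ext h

instance : AddCommGroup (Hom V W) :=
  lin_injective.addCommGroup _ rfl (fun _ _ => rfl) (fun _ => rfl) (fun _ _ => rfl)
    (fun _ _ => rfl) (fun _ _ => rfl)

end Hom

instance : Preadditive (DGVec k) where
  homGroup V W := inferInstanceAs (AddCommGroup (Hom V W))
  add_comp _ _ _ f f' g := hom_ext (LinearMap.comp_add f.lin f'.lin g.lin)
  comp_add _ _ _ f g g' := hom_ext (LinearMap.add_comp f.lin g'.lin g.lin)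

instance : MonoidalPreadditive (DGVec k) where
  whiskerLeft_zero := hom_ext (TensorProduct.map_zero_right _)
  zero_whiskerRight := hom_ext (TensorProduct.map_zero_left _)
  whiskerLeft_add f g := hom_ext (TensorProduct.map_add_right _ f.lin g.lin)
  add_whiskerRight f g := hom_ext (TensorProduct.map_add_left f.lin g.lin _)

/-! ### The tensor-hom adjunction -/

lemma lin_tmul_mem_homGr {U V W : DGVec k} (f : U ⊗ V ⟶ W) {n : ℤ} {x : U} (hx : x ∈ U.gr n) :
    (TensorProduct.curry f.lin x : V →ₗ[k] W) ∈ homGr V W n := by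
  intro p y hy
  exact f.map_mem (p + n) _ (tmul_mem U V (add_comm n p) hx hy)

/-- The internal hom contains only finite sums of homogeneous maps. Currying lands there because
every `x` is a finite sum of homogeneous elements. -/
lemma lin_tmul_mem_homSpace {U V W : DGVec k} (f : U ⊗ V ⟶ W) (x : U) :
    (TensorProduct.curry f.lin x : V →ₗ[k] W) ∈ homSpace V W := by
  induction x using U.homog_induction with
  | h0 => rw [map_zero]; exact zero_mem _
  | hadd x y hx hy => rw [map_add]; exact add_mem hx hy
  | hom n x hx => exact homGr_le V W n (lin_tmul_mem_homGr f hx)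

/-- The morphism `U → Hom(V, W)` corresponding to `f : U ⊗ V → W`. -/
noncomputable def curry {U V W : DGVec k} (f : U ⊗ V ⟶ W) : U ⟶ ihom V W where
  lin := LinearMap.codRestrict (homSpace V W) (TensorProduct.curry f.lin)
    (lin_tmul_mem_homSpace f)
  map_mem _ _ hx := lin_tmul_mem_homGr f hx
  map_d x := by
    apply ihomVal_injective
    rw [ihomVal_d]
    change TensorProduct.curry f.lin (U.d x) = homD V W (TensorProduct.curry f.lin x)
    induction x using U.homog_induction with
    | h0 => simp only [map_zero]
    | hadd x y hx hy => simp only [map_add, hx, hy]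
    | hom n x hx =>
      rw [homD_apply V W (lin_tmul_mem_homGr f hx)]
      refine LinearMap.ext fun y => ?_
      -- The Leibniz rule for `x ⊗ y`, solved for `f (d x ⊗ y)`, is the formula for the differential
      -- of a map of degree `n`.
      have e : f.lin (U.d x ⊗ₜ[k] y + koszulSign k n • (x ⊗ₜ[k] V.d y)) =
          W.d (f.lin (x ⊗ₜ[k] y)) :=
        (congrArg f.lin (tensor_d_tmul U V hx y)).symm.trans (f.map_d _)
      refine eq_sub_of_add_eq (Eq.trans ?_ e)
      exact ((f.lin.map_add _ _).trans (congrArg _ (f.lin.map_smul _ _))).symm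

lemma curry_ihomApply {U V W : DGVec k} (f : U ⊗ V ⟶ W) :
    curry f ▷ V ≫ ihomApply V W = f :=
  hom_ext (TensorProduct.ext' fun _ _ => rfl)

lemma ext_ihomApply {U V W : DGVec k} {f g : U ⟶ ihom V W}
    (h : f ▷ V ≫ ihomApply V W = g ▷ V ≫ ihomApply V W) : f = g :=
  ihom_ext fun x => LinearMap.ext fun y => congrArg (fun F => F.lin (x ⊗ₜ[k] y)) h

/-- The morphism `U → Hom(V, W)` corresponding to `f : V ⊗ U → W` under the adjunction with
counit `ihomEval`. -/
noncomputable def curryLeft {U V W : DGVec k} (f : V ⊗ U ⟶ W) : U ⟶ ihom V W :=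
  curry ((β_ U V).hom ≫ f)

lemma whiskerLeft_ihomEval {U V W : DGVec k} (f : U ⟶ ihom V W) :
    V ◁ f ≫ ihomEval V W = (β_ V U).hom ≫ f ▷ V ≫ ihomApply V W := by
  rw [ihomEval, BraidedCategory.braiding_naturality_right_assoc]

lemma curryLeft_ihomEval {U V W : DGVec k} (f : V ⊗ U ⟶ W) :
    V ◁ curryLeft f ≫ ihomEval V W = f := by
  rw [whiskerLeft_ihomEval, curryLeft, curry_ihomApply, SymmetricCategory.symmetry_assoc]

lemma ext_ihomEval {U V W : DGVec k} {f g : U ⟶ ihom V W}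
    (h : V ◁ f ≫ ihomEval V W = V ◁ g ≫ ihomEval V W) : f = g := by
  rw [whiskerLeft_ihomEval, whiskerLeft_ihomEval, cancel_epi] at h
  exact ext_ihomApply h

lemma ihomMap_ihomApply {V V' W W' : DGVec k} (h : V' ⟶ V) (g : W ⟶ W') :
    ihomMap h g ▷ V' ≫ ihomApply V' W' = ihom V W ◁ h ≫ ihomApply V W ≫ g :=
  hom_ext (TensorProduct.ext' fun _ _ => rfl)

lemma ihomMap_ihomEval {V V' W W' : DGVec k} (h : V' ⟶ V) (g : W ⟶ W') :
    V' ◁ ihomMap h g ≫ ihomEval V' W' = h ▷ ihom V W ≫ ihomEval V W ≫ g := by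
  rw [whiskerLeft_ihomEval, ihomMap_ihomApply, ihomEval, Category.assoc,
    BraidedCategory.braiding_naturality_left_assoc]

lemma ihomEval_tmul (V W : DGVec k) {p q : ℤ} {x : V} (hx : x ∈ V.gr p) {f : ihom V W}
    (hf : f ∈ (ihom V W).gr q) :
    (ihomEval V W).lin (x ⊗ₜ[k] f) = koszulSign k (p * q) • ihomVal V W f x := by
  change (ihomApply V W).lin (braidLin V (ihom V W) (x ⊗ₜ[k] f)) = _
  rw [braidLin_tmul V (ihom V W) hx hf]
  exact (ihomApply V W).lin.map_smul _ _

/-- This describes the tensor product of internal homs through evaluation alone. It confines the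
Koszul signs of `homTensor` to one computation, after which everything about convolution is formal
in a symmetric monoidal category. -/
lemma homTensor_ihomEval (V W V' W' : DGVec k) :
    (V ⊗ V') ◁ homTensor V W V' W' ≫ ihomEval (V ⊗ V') (W ⊗ W') =
      tensorμ V V' (ihom V W) (ihom V' W') ≫ (ihomEval V W ⊗ₘ ihomEval V' W') := by
  apply hom_ext
  apply TensorProduct.ext
  apply ext_homog₂
  intro a x hx b y hy
  apply ext_homog₂
  intro p f hf q g hg
  have h1 := tensorμ_tmul V V' (ihom V W) (ihom V' W') x g hy hf
  have hfg : (homTensor V W V' W').lin (f ⊗ₜ[k] g) ∈ (ihom (V ⊗ V') (W ⊗ W')).gr (p + q) :=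
    (homTensor V W V' W').map_mem _ _ (tmul_mem _ _ rfl hf hg)
  have h2 := ihomEval_tmul (V ⊗ V') (W ⊗ W') (tmul_mem V V' rfl hx hy) hfg
  rw [homTensor_tmul V W V' W' f hg] at h2
  refine h2.trans ?_
  refine Eq.trans ?_
    (congrArg (TensorProduct.map (ihomEval V W).lin (ihomEval V' W').lin) h1).symm
  refine Eq.trans ?_ ((TensorProduct.map (ihomEval V W).lin (ihomEval V' W').lin).map_smul
    (koszulSign k (b * p)) ((x ⊗ₜ[k] f) ⊗ₜ[k] (y ⊗ₜ[k] g))).symm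
  have h4 : TensorProduct.map (ihomEval V W).lin (ihomEval V' W').lin
      ((x ⊗ₜ[k] f) ⊗ₜ[k] (y ⊗ₜ[k] g)) = (koszulSign k (a * p) • ihomVal V W f x) ⊗ₜ[k]
        (koszulSign k (b * q) • ihomVal V' W' g y) := by
    rw [← ihomEval_tmul V W hx hf, ← ihomEval_tmul V' W' hy hg]
    rfl
  refine Eq.trans ?_ (congrArg (koszulSign k (b * p) • ·) h4).symm
  have h3 := homTensorAux_tmul V W V' W' q (ihomVal V W f) (ihomVal V' W' g) hx y
  refine (congrArg (koszulSign k ((a + b) * (p + q)) • ·) h3).trans ?_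
  refine (smul_smul _ _ (ihomVal V W f x ⊗ₜ[k] ihomVal V' W' g y)).trans ?_
  rw [← TensorProduct.smul_tmul', TensorProduct.tmul_smul, smul_smul]
  refine Eq.trans ?_ (smul_smul _ _ (ihomVal V W f x ⊗ₜ[k] ihomVal V' W' g y)).symm
  congr 1
  -- The exponents on the two sides differ by `2qa`, which does not affect the sign.
  rw [← koszulSign_add, ← koszulSign_add, ← koszulSign_add,
    show (a + b) * (p + q) + q * a = b * p + (a * p + b * q) + (q * a + q * a) by ring,
    koszulSign_add k _ (q * a + q * a), koszulSign_add k (q * a), koszulSign_mul_self, mul_one]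

end DGVec

/-- The sign-free form of the convolution product: evaluating a product at `c` means splitting `c`,
evaluating each factor on its own half, and multiplying. -/
lemma NonUnitalDGAlg.convMul_ihomEval {k : Type u} [Field k] (C : NonCounitalDGCoalg k)
    (A : NonUnitalDGAlg k) :
    C.X ◁ convMul C A ≫ DGVec.ihomEval C.X A.X =
      C.comul ▷ (DGVec.ihom C.X A.X ⊗ DGVec.ihom C.X A.X) ≫
        tensorμ C.X C.X (DGVec.ihom C.X A.X) (DGVec.ihom C.X A.X) ≫
          (DGVec.ihomEval C.X A.X ⊗ₘ DGVec.ihomEval C.X A.X) ≫ A.mul := by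
  rw [convMul, MonoidalCategory.whiskerLeft_comp, Category.assoc, DGVec.ihomMap_ihomEval,
    whisker_exchange_assoc, ← Category.assoc (_ ◁ DGVec.homTensor _ _ _ _),
    DGVec.homTensor_ihomEval]
  simp only [Category.assoc]

/-! ### Measurings -/

/-- The heart of the composition of measurings. The coherence of `tensorμ` with the associator
breaks the interchange of `C ⊗ D` with `A` into that of `D` with `A` followed by that of `C` with `D
⊗ A`. Naturality then slides `n` past the interchange of `C`. -/
lemma CategoryTheory.tensorμ_comp_comul {M : Type*} [Category M] [MonoidalCategory M]
    [BraidedCategory M] {C D A A' B : M} (δ : C ⟶ C ⊗ C) (ε : D ⟶ D ⊗ D) (m : C ⊗ A' ⟶ B)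
    (n : D ⊗ A ⟶ A') :
    ((δ ⊗ₘ ε) ≫ tensorμ C C D D) ▷ (A ⊗ A) ≫ tensorμ (C ⊗ D) (C ⊗ D) A A ≫
        (((α_ C D A).hom ≫ C ◁ n ≫ m) ⊗ₘ ((α_ C D A).hom ≫ C ◁ n ≫ m)) =
      (α_ C D (A ⊗ A)).hom ≫ C ◁ (ε ▷ (A ⊗ A) ≫ tensorμ D D A A ≫ (n ⊗ₘ n)) ≫
        δ ▷ (A' ⊗ A') ≫ tensorμ C C A' A' ≫ (m ⊗ₘ m) := by
  rw [← tensorHom_comp_tensorHom, ← tensorHom_comp_tensorHom, comp_whiskerRight, Category.assoc,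
    tensor_associativity_assoc, ← tensorμ_natural_right_assoc]
  simp only [MonoidalCategory.whiskerLeft_comp, Category.assoc]
  rw [whisker_exchange_assoc, whisker_exchange_assoc, whisker_exchange_assoc, MonoidalCategory.tensorHom_def,
    comp_whiskerRight_assoc, associator_naturality_middle_assoc,
    associator_naturality_left_assoc]

namespace NonUnitalDGAlg

variable {k : Type u} [Field k]

/-- `u : C ⊗ A → B` is a measuring if `u(c, a a') = ∑ ± u(c₁, a) u(c₂, a')`. -/
def IsMeasuring (C : NonCounitalDGCoalg k) (A B : NonUnitalDGAlg k) (u : C.X ⊗ A.X ⟶ B.X) :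
    Prop :=
  C.X ◁ A.mul ≫ u = C.comul ▷ (A.X ⊗ A.X) ≫ tensorμ C.X C.X A.X A.X ≫ (u ⊗ₘ u) ≫ B.mul

/-- Evaluation is faithful on maps into the internal hom, so multiplicativity of `g` may be tested
after evaluating at `C`. There `convMul_ihomEval` turns it into the measuring identity. -/
lemma isMeasuring_iff_mul_hom {C : NonCounitalDGCoalg k} {A B : NonUnitalDGAlg k}
    (g : A.X ⟶ DGVec.ihom C.X B.X) :
    IsMeasuring C A B (C.X ◁ g ≫ DGVec.ihomEval C.X B.X) ↔
      A.mul ≫ g = (g ⊗ₘ g) ≫ convMul C B := by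
  have h : C.X ◁ ((g ⊗ₘ g) ≫ convMul C B) ≫ DGVec.ihomEval C.X B.X =
      C.comul ▷ (A.X ⊗ A.X) ≫ tensorμ C.X C.X A.X A.X ≫
        ((C.X ◁ g ≫ DGVec.ihomEval C.X B.X) ⊗ₘ (C.X ◁ g ≫ DGVec.ihomEval C.X B.X)) ≫ B.mul := by
    rw [MonoidalCategory.whiskerLeft_comp, Category.assoc, convMul_ihomEval,
      whisker_exchange_assoc, tensorμ_natural_right_assoc, tensorHom_comp_tensorHom_assoc]
  rw [IsMeasuring, ← h, ← MonoidalCategory.whiskerLeft_comp_assoc]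
  exact ⟨DGVec.ext_ihomEval, fun h => by rw [h]⟩

/-- Algebra maps `A → {C, B}` are the same thing as measurings `C ⊗ A → B`. -/
noncomputable def convHomEquiv (C : NonCounitalDGCoalg k) (A B : NonUnitalDGAlg k) :
    (A ⟶ conv C B) ≃ {u : C.X ⊗ A.X ⟶ B.X // IsMeasuring C A B u} where
  toFun g := ⟨C.X ◁ g.hom ≫ DGVec.ihomEval C.X B.X, (isMeasuring_iff_mul_hom g.hom).2 g.mul_hom⟩
  invFun u := ⟨DGVec.curryLeft u.1, (isMeasuring_iff_mul_hom _).1 (by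
    rw [DGVec.curryLeft_ihomEval]; exact u.2)⟩
  left_inv g := hom_ext (DGVec.ext_ihomEval (DGVec.curryLeft_ihomEval _))
  right_inv u := Subtype.ext (DGVec.curryLeft_ihomEval _)

/-- The difference of the two sides of the equation which defines measurings. -/
noncomputable def measuringDefect (C : NonCounitalDGCoalg k) (A B : NonUnitalDGAlg k)
    (u : C.X ⊗ A.X ⟶ B.X) : C.X ⊗ A.X ⊗ A.X ⟶ B.X :=
  C.X ◁ A.mul ≫ u - C.comul ▷ (A.X ⊗ A.X) ≫ tensorμ C.X C.X A.X A.X ≫ (u ⊗ₘ u) ≫ B.mul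

lemma measuringDefect_eq_zero {C : NonCounitalDGCoalg k} {A B : NonUnitalDGAlg k}
    {u : C.X ⊗ A.X ⟶ B.X} : measuringDefect C A B u = 0 ↔ IsMeasuring C A B u :=
  sub_eq_zero

/-- The quadratic term is compatible with `h` because it uses `C` only through its comultiplication.
A generic coalgebra can thus carry the defect of all coalgebras mapping to it. -/
lemma whiskerRight_measuringDefect {C C' : NonCounitalDGCoalg k} {A B : NonUnitalDGAlg k}
    (u : C.X ⊗ A.X ⟶ B.X) (h : C' ⟶ C) :
    h.hom ▷ (A.X ⊗ A.X) ≫ measuringDefect C A B u =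
      measuringDefect C' A B (h.hom ▷ A.X ≫ u) := by
  rw [measuringDefect, measuringDefect, Preadditive.comp_sub, ← comp_whiskerRight_assoc,
    h.hom_comul, ← whisker_exchange_assoc, comp_whiskerRight_assoc, tensorμ_natural_left_assoc,
    tensorHom_comp_tensorHom_assoc]

/-- The dual naturality: an algebra map carries the defect of a pairing to the defect of its image,
so killing one defect makes every induced pairing a measuring. -/
lemma measuringDefect_comp_hom {C : NonCounitalDGCoalg k} {A B B' : NonUnitalDGAlg k}
    (u : C.X ⊗ A.X ⟶ B.X) (g : B ⟶ B') :
    measuringDefect C A B u ≫ g.hom = measuringDefect C A B' (u ≫ g.hom) := by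
  simp only [measuringDefect, Preadditive.sub_comp, Category.assoc, g.mul_hom,
    tensorHom_comp_tensorHom_assoc]

lemma IsMeasuring.whiskerRight_comp {C C' : NonCounitalDGCoalg k} {A B : NonUnitalDGAlg k}
    {u : C.X ⊗ A.X ⟶ B.X} (hu : IsMeasuring C A B u) (h : C' ⟶ C) :
    IsMeasuring C' A B (h.hom ▷ A.X ≫ u) := by
  rw [← measuringDefect_eq_zero] at hu ⊢
  rw [← whiskerRight_measuringDefect, hu, Limits.comp_zero]

lemma IsMeasuring.comp_hom {C : NonCounitalDGCoalg k} {A B B' : NonUnitalDGAlg k}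
    {u : C.X ⊗ A.X ⟶ B.X} (hu : IsMeasuring C A B u) (g : B ⟶ B') :
    IsMeasuring C A B' (u ≫ g.hom) := by
  rw [← measuringDefect_eq_zero] at hu ⊢
  rw [← measuringDefect_comp_hom, hu, Limits.zero_comp]

/-- The composite of measurings `D ⊗ A → A'` and `C ⊗ A' → B` is a measuring. -/
lemma IsMeasuring.comp {C D : NonCounitalDGCoalg k} {A A' B : NonUnitalDGAlg k}
    {n : D.X ⊗ A.X ⟶ A'.X} {m : C.X ⊗ A'.X ⟶ B.X} (hn : IsMeasuring D A A' n)
    (hm : IsMeasuring C A' B m) :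
    IsMeasuring (NonCounitalDGCoalg.tensor C D) A B
      ((α_ C.X D.X A.X).hom ≫ C.X ◁ n ≫ m) := by
  have e := tensorμ_comp_comul C.comul D.comul m n
  rw [IsMeasuring] at hn hm
  have h : (C.X ⊗ D.X) ◁ A.mul ≫ (α_ C.X D.X A.X).hom ≫ C.X ◁ n ≫ m =
      ((α_ C.X D.X (A.X ⊗ A.X)).hom ≫ C.X ◁ (D.comul ▷ (A.X ⊗ A.X) ≫
        tensorμ D.X D.X A.X A.X ≫ (n ⊗ₘ n)) ≫ C.comul ▷ (A'.X ⊗ A'.X) ≫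
          tensorμ C.X C.X A'.X A'.X ≫ (m ⊗ₘ m)) ≫ B.mul := by
    rw [associator_naturality_right_assoc, ← MonoidalCategory.whiskerLeft_comp_assoc, hn]
    simp only [MonoidalCategory.whiskerLeft_comp, Category.assoc, hm]
  rw [← e] at h
  simp only [Category.assoc] at h
  exact h

/-- Currying a measuring of a tensor product of coalgebras gives a measuring. -/
lemma IsMeasuring.of_comp_ihomEval {C D : NonCounitalDGCoalg k} {A B : NonUnitalDGAlg k}
    {n : D.X ⊗ A.X ⟶ DGVec.ihom C.X B.X}
    (h : IsMeasuring (NonCounitalDGCoalg.tensor C D) A B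
      ((α_ C.X D.X A.X).hom ≫ C.X ◁ n ≫ DGVec.ihomEval C.X B.X)) :
    IsMeasuring D A (conv C B) n := by
  have e := tensorμ_comp_comul C.comul D.comul (DGVec.ihomEval C.X B.X) n
  -- The identity for `n` may be tested after tensoring with `C` and evaluating, where it becomes
  -- the measuring identity for `C ⊗ D`.
  apply DGVec.ext_ihomEval
  rw [← cancel_epi (α_ C.X D.X (A.X ⊗ A.X)).hom]
  have h' : (C.X ⊗ D.X) ◁ A.mul ≫ (α_ C.X D.X A.X).hom ≫ C.X ◁ n ≫ DGVec.ihomEval C.X B.X =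
      (((C.comul ⊗ₘ D.comul) ≫ tensorμ C.X C.X D.X D.X) ▷ (A.X ⊗ A.X) ≫
        tensorμ (C.X ⊗ D.X) (C.X ⊗ D.X) A.X A.X ≫
          (((α_ C.X D.X A.X).hom ≫ C.X ◁ n ≫ DGVec.ihomEval C.X B.X) ⊗ₘ
            ((α_ C.X D.X A.X).hom ≫ C.X ◁ n ≫ DGVec.ihomEval C.X B.X))) ≫ B.mul := by
    simp only [Category.assoc]
    exact h
  rw [e, associator_naturality_right_assoc] at h'
  -- The convolution algebra is unfolded to the internal hom with the product `convMul`, to which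
  -- `convMul_ihomEval` applies.
  change (α_ C.X D.X (A.X ⊗ A.X)).hom ≫ C.X ◁ (show D.X ⊗ A.X ⊗ A.X ⟶ DGVec.ihom C.X B.X from
    D.X ◁ A.mul ≫ n) ≫ DGVec.ihomEval C.X B.X =
      (α_ C.X D.X (A.X ⊗ A.X)).hom ≫ C.X ◁ (D.comul ▷ (A.X ⊗ A.X) ≫
    tensorμ D.X D.X A.X A.X ≫ (n ⊗ₘ n) ≫ convMul C B) ≫ DGVec.ihomEval C.X B.X
  simp only [MonoidalCategory.whiskerLeft_comp, Category.assoc] at h' ⊢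
  rw [h', convMul_ihomEval]

end NonUnitalDGAlg

/-! ### Direct sums, subobjects and quotients of dg vector spaces -/

namespace DGVec

variable {k : Type u} [Field k]

lemma proj_mem_gr (V : DGVec k) (n : ℤ) (x : V) : V.proj n x ∈ V.gr n := by
  induction x using V.homog_induction with
  | h0 => rw [map_zero]; exact zero_mem _
  | hadd x y hx hy => rw [map_add]; exact add_mem hx hy
  | hom m x hx =>
    by_cases h : m = n
    · subst h
      rwa [V.proj_self hx]
    · rw [V.proj_ne h hx]
      exact zero_mem _

lemma Hom.lin_proj {V W : DGVec k} (f : V ⟶ W) (n : ℤ) (x : V) :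
    f.lin (V.proj n x) = W.proj n (f.lin x) :=
  congrArg (fun F => F x) (Hom.lin_scale f _)

section dsum

variable (W : ℕ → DGVec k)

/-- The homogeneous components of a direct sum. -/
def dsumGr (n : ℤ) : Submodule k (DirectSum ℕ fun i => W i) :=
  ⨅ i, ((W i).gr n).comap (DirectSum.component k ℕ (fun i => W i) i)

lemma mem_dsumGr {n : ℤ} {x : DirectSum ℕ fun i => W i} :
    x ∈ dsumGr W n ↔ ∀ i, x i ∈ (W i).gr n := by
  simp only [dsumGr, Submodule.mem_iInf, Submodule.mem_comap]
  rfl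

lemma of_mem_dsumGr {n : ℤ} {i : ℕ} {x : W i} (hx : x ∈ (W i).gr n) :
    DirectSum.of (fun i => (W i).carrier) i x ∈ dsumGr W n := by
  refine (mem_dsumGr W).2 fun j => ?_
  by_cases h : i = j
  · subst h
    rwa [DirectSum.of_eq_same]
  · rw [DirectSum.of_eq_of_ne _ _ _ (Ne.symm h)]
    exact zero_mem _

/-- The direct sum of a sequence of dg vector spaces. -/
noncomputable def dsum : DGVec k where
  carrier := DirectSum ℕ fun i => W i
  gr := dsumGr W
  internal := by
    -- The detecting map for `(i, n)` takes the degree `n` part of the `i`-th coordinate and puts it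
    -- back into the sum, so that all of these maps share one target.
    refine isInternal_of_detect (J := ℕ × ℤ) _ ?_
      (fun j => DirectSum.lof k ℕ (fun i => W i) j.1 ∘ₗ (W j.1).proj j.2 ∘ₗ
        DirectSum.component k ℕ (fun i => W i) j.1) (fun j => j.2) ?_ ?_
    · rw [eq_top_iff]
      rintro x -
      induction x using DirectSum.induction_on with
      | zero => exact zero_mem _
      | add x y hx hy => exact add_mem hx hy
      | of i y =>
        induction y using (W i).homog_induction with
        | h0 => rw [map_zero]; exact zero_mem _
        | hadd x y hx hy => rw [map_add]; exact add_mem hx hy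
        | hom n y hy => exact Submodule.mem_iSup_of_mem n (of_mem_dsumGr W hy)
    · rintro ⟨i, n⟩ m hm x hx
      have h := (W i).proj_ne hm ((mem_dsumGr W).1 hx i)
      exact (congrArg (DirectSum.lof k ℕ (fun i => W i) i) h).trans (map_zero _)
    · intro x hx
      refine DFinsupp.ext fun i => (W i).eq_zero_of_proj _ fun n => ?_
      have h := congrArg (fun y => y i) (hx (i, n))
      exact (DirectSum.lof_apply k i _).symm.trans h
  d := DirectSum.lmap fun i => (W i).d
  d_mem n x hx := (mem_dsumGr W).2 fun i => (W i).d_mem _ _ ((mem_dsumGr W).1 hx i)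
  d_d x := DFinsupp.ext fun i => (W i).d_d _

/-- The inclusion of a summand. -/
noncomputable def ι (i : ℕ) : W i ⟶ dsum W where
  lin := DirectSum.lof k ℕ (fun i => W i) i
  map_mem _ _ hx := of_mem_dsumGr W hx
  map_d x := (DirectSum.lmap_lof (fun i => (W i).d) i x).symm

variable {W}

lemma dsum_hom_ext {X : DGVec k} {f g : dsum W ⟶ X} (h : ∀ i, ι W i ≫ f = ι W i ≫ g) : f = g :=
  hom_ext (DirectSum.linearMap_ext k fun i => congrArg Hom.lin (h i))

lemma dsum_induction {P : dsum W → Prop} (h0 : P 0) (hadd : ∀ x y, P x → P y → P (x + y))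
    (hι : ∀ i x, P ((ι W i).lin x)) (x : dsum W) : P x :=
  DirectSum.induction_on (x : DirectSum ℕ fun i => W i) h0 hι hadd

lemma toModule_mem {X : DGVec k} (f : ∀ i, W i ⟶ X) {n : ℤ} {x : DirectSum ℕ fun i => W i}
    (hx : x ∈ dsumGr W n) : DirectSum.toModule k ℕ X (fun i => (f i).lin) x ∈ X.gr n := by
  classical
  rw [← DirectSum.sum_support_of x, map_sum]
  refine sum_mem fun i _ => ?_
  rw [← DirectSum.lof_eq_of k, DirectSum.toModule_lof]
  exact (f i).map_mem n _ ((mem_dsumGr W).1 hx i)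

/-- The morphism out of a direct sum with given restrictions to the summands. -/
noncomputable def dsumDesc {X : DGVec k} (f : ∀ i, W i ⟶ X) : dsum W ⟶ X where
  lin := DirectSum.toModule k ℕ X fun i => (f i).lin
  map_mem _ _ hx := toModule_mem f hx
  map_d x := by
    have h : DirectSum.toModule k ℕ X (fun i => (f i).lin) ∘ₗ DirectSum.lmap (fun i => (W i).d) =
        X.d ∘ₗ DirectSum.toModule k ℕ X fun i => (f i).lin := by
      refine DirectSum.linearMap_ext k fun i => LinearMap.ext fun y => ?_
      simp only [LinearMap.comp_apply, DirectSum.lmap_lof, DirectSum.toModule_lof, (f i).map_d]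
    exact congrArg (fun F => F x) h

@[simp]
lemma ι_dsumDesc {X : DGVec k} (f : ∀ i, W i ⟶ X) (i : ℕ) : ι W i ≫ dsumDesc f = f i :=
  hom_ext (LinearMap.ext fun x => DirectSum.toModule_lof k (φ := fun i => (f i).lin) i x)

/-- The morphism out of `(⨁ i, W i) ⊗ Y` with given restrictions to the `W i ⊗ Y`. -/
noncomputable def dsumDescRight {X Y : DGVec k} (f : ∀ i, W i ⊗ Y ⟶ X) : dsum W ⊗ Y ⟶ X :=
  dsumDesc (fun i => curry (f i)) ▷ Y ≫ ihomApply Y X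

lemma ι_dsumDescRight {X Y : DGVec k} (f : ∀ i, W i ⊗ Y ⟶ X) (i : ℕ) :
    ι W i ▷ Y ≫ dsumDescRight f = f i := by
  rw [dsumDescRight, ← comp_whiskerRight_assoc, ι_dsumDesc, curry_ihomApply]

/-- The functor `Y ⊗ -` preserves direct sums, being a left adjoint: after currying, this is the
universal property of the sum itself. -/
lemma dsum_whiskerLeft_ext {X Y : DGVec k} {f g : Y ⊗ dsum W ⟶ X}
    (h : ∀ i, Y ◁ ι W i ≫ f = Y ◁ ι W i ≫ g) : f = g := by
  have e : curryLeft f = curryLeft g := dsum_hom_ext fun i => ext_ihomEval (by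
    rw [MonoidalCategory.whiskerLeft_comp_assoc, MonoidalCategory.whiskerLeft_comp_assoc,
      curryLeft_ihomEval, curryLeft_ihomEval, h])
  rw [← curryLeft_ihomEval f, e, curryLeft_ihomEval]

lemma dsum_whiskerRight_ext {X Y : DGVec k} {f g : dsum W ⊗ Y ⟶ X}
    (h : ∀ i, ι W i ▷ Y ≫ f = ι W i ▷ Y ≫ g) : f = g := by
  have e : curry f = curry g := dsum_hom_ext fun i => ext_ihomApply (by
    rw [comp_whiskerRight_assoc, comp_whiskerRight_assoc,
      curry_ihomApply, curry_ihomApply, h])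
  rw [← curry_ihomApply f, e, curry_ihomApply]

end dsum

/-- A dg subspace: a homogeneous subspace stable under the differential. -/
structure IsDGSubspace (V : DGVec k) (S : Submodule k V) : Prop where
  proj_mem (n : ℤ) (x : V) (hx : x ∈ S) : V.proj n x ∈ S
  d_mem (x : V) (hx : x ∈ S) : V.d x ∈ S

lemma isDGSubspace_sInf {V : DGVec k} {s : Set (Submodule k V)} (h : ∀ S ∈ s, IsDGSubspace V S) :
    IsDGSubspace V (sInf s) where
  proj_mem n x hx := by
    rw [Submodule.mem_sInf] at hx ⊢
    exact fun S hS => (h S hS).proj_mem n x (hx S hS)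
  d_mem x hx := by
    rw [Submodule.mem_sInf] at hx ⊢
    exact fun S hS => (h S hS).d_mem x (hx S hS)

lemma isDGSubspace_sSup {V : DGVec k} {s : Set (Submodule k V)} (h : ∀ S ∈ s, IsDGSubspace V S) :
    IsDGSubspace V (sSup s) where
  proj_mem n x hx := by
    have : sSup s ≤ (sSup s).comap (V.proj n) :=
      sSup_le fun S hS x hx => le_sSup hS ((h S hS).proj_mem n x hx)
    exact this hx
  d_mem x hx := by
    have : sSup s ≤ (sSup s).comap V.d :=
      sSup_le fun S hS x hx => le_sSup hS ((h S hS).d_mem x hx)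
    exact this hx

lemma isDGSubspace_ker {V W : DGVec k} (f : V ⟶ W) : IsDGSubspace V (LinearMap.ker f.lin) where
  proj_mem n x hx := by
    rw [LinearMap.mem_ker] at hx ⊢
    rw [f.lin_proj, hx, map_zero]
  d_mem x hx := by
    rw [LinearMap.mem_ker] at hx ⊢
    rw [f.map_d, hx, map_zero]

lemma isDGSubspace_range {V W : DGVec k} (f : V ⟶ W) :
    IsDGSubspace W (LinearMap.range f.lin) where
  proj_mem n := by
    rintro _ ⟨x, rfl⟩
    exact ⟨V.proj n x, f.lin_proj n x⟩
  d_mem := by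
    rintro _ ⟨x, rfl⟩
    exact ⟨V.d x, f.map_d x⟩

/-! ### Dg subspaces and their quotients as dg vector spaces -/

section sub

variable {V : DGVec k} {S : Submodule k V} (hS : IsDGSubspace V S)

/-- A dg subspace as a dg vector space. -/
noncomputable def sub : DGVec k where
  carrier := S
  gr n := (V.gr n).comap S.subtype
  internal := by
    refine isInternal_of_detect (J := ℤ) _ ?_ (fun n => V.proj n ∘ₗ S.subtype) id
      (fun n m hm x hx => V.proj_ne hm hx) fun x hx => Subtype.ext (V.eq_zero_of_proj _ hx)
    rw [eq_top_iff]
    rintro x -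
    obtain ⟨s, hs⟩ := V.exists_sum_proj x
    have : x = ∑ n ∈ s, (⟨V.proj n x, hS.proj_mem n x x.2⟩ : S) := by
      apply Subtype.ext
      rw [AddSubmonoidClass.coe_finsetSum]
      exact (hs s subset_rfl).symm
    rw [this]
    exact sum_mem fun n _ => Submodule.mem_iSup_of_mem n (V.proj_mem_gr n x)
  d := V.d.restrict hS.d_mem
  d_mem n x hx := V.d_mem n x hx
  d_d x := Subtype.ext (V.d_d x)

/-- The inclusion of a dg subspace. -/
noncomputable def subι : sub hS ⟶ V where
  lin := S.subtype
  map_mem _ _ h := h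
  map_d _ := rfl

lemma subι_injective : Function.Injective (subι hS).lin := S.injective_subtype

/-- Corestriction of a morphism to a dg subspace. -/
noncomputable def subLift {U : DGVec k} (f : U ⟶ V) (h : ∀ x, f.lin x ∈ S) : U ⟶ sub hS where
  lin := f.lin.codRestrict S h
  map_mem n x hx := f.map_mem n x hx
  map_d x := Subtype.ext (f.map_d x)

@[simp]
lemma subLift_subι {U : DGVec k} (f : U ⟶ V) (h : ∀ x, f.lin x ∈ S) :
    subLift hS f h ≫ subι hS = f := rfl

/-- The quotient by a dg subspace. -/
noncomputable def quot : DGVec k where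
  carrier := V ⧸ S
  gr n := (V.gr n).map S.mkQ
  internal := by
    -- Since `S` is homogeneous, the degree projections descend to `V ⧸ S`. A class killed by all of
    -- them has all its components in `S`.
    refine isInternal_of_detect (J := ℤ) _ ?_ (fun n => S.mapQ S (V.proj n) (hS.proj_mem n)) id
      ?_ ?_
    · rw [← Submodule.map_iSup, V.internal.submodule_iSup_eq_top, Submodule.map_top,
        Submodule.range_mkQ]
    · rintro n m hm _ ⟨x, hx, rfl⟩
      rw [Submodule.mkQ_apply, Submodule.mapQ_apply, V.proj_ne (n := n) hm hx,
        Submodule.Quotient.mk_zero]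
    · intro x hx
      obtain ⟨x, rfl⟩ := S.mkQ_surjective x
      obtain ⟨s, hs⟩ := V.exists_sum_proj x
      rw [Submodule.mkQ_apply, Submodule.Quotient.mk_eq_zero, ← hs s subset_rfl]
      refine sum_mem fun n _ => ?_
      have := hx n
      rwa [Submodule.mkQ_apply, Submodule.mapQ_apply, Submodule.Quotient.mk_eq_zero] at this
  d := S.mapQ S V.d hS.d_mem
  d_mem n := by
    rintro _ ⟨x, hx, rfl⟩
    exact ⟨V.d x, V.d_mem n x hx, rfl⟩
  d_d x := by
    obtain ⟨x, rfl⟩ := S.mkQ_surjective x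
    rw [Submodule.mkQ_apply, Submodule.mapQ_apply, Submodule.mapQ_apply, V.d_d,
      Submodule.Quotient.mk_zero]

/-- The projection onto the quotient. -/
noncomputable def quotπ : V ⟶ quot hS where
  lin := S.mkQ
  map_mem _ x hx := ⟨x, hx, rfl⟩
  map_d _ := rfl

lemma quotπ_surjective : Function.Surjective (quotπ hS).lin := S.mkQ_surjective

lemma quotπ_eq_zero {x : V} : (quotπ hS).lin x = 0 ↔ x ∈ S := Submodule.Quotient.mk_eq_zero S

/-- The morphism induced on the quotient. -/
noncomputable def quotDesc {W : DGVec k} (f : V ⟶ W) (h : ∀ x ∈ S, f.lin x = 0) :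
    quot hS ⟶ W where
  lin := S.liftQ f.lin h
  map_mem n := by
    rintro _ ⟨x, hx, rfl⟩
    exact f.map_mem n x hx
  map_d x := by
    obtain ⟨x, rfl⟩ := S.mkQ_surjective x
    exact f.map_d x

@[simp]
lemma quotπ_quotDesc {W : DGVec k} (f : V ⟶ W) (h : ∀ x ∈ S, f.lin x = 0) :
    quotπ hS ≫ quotDesc hS f h = f := rfl

end sub

lemma epi_of_surjective {V W : DGVec k} (f : V ⟶ W) (h : Function.Surjective f.lin) : Epi f where
  left_cancellation _ _ e := by
    refine hom_ext (LinearMap.ext fun y => ?_)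
    obtain ⟨x, rfl⟩ := h y
    exact congrArg (fun F => F.lin x) e

lemma mono_of_injective {V W : DGVec k} (f : V ⟶ W) (h : Function.Injective f.lin) : Mono f where
  right_cancellation _ _ e :=
    hom_ext (LinearMap.ext fun x => h (congrArg (fun F => F.lin x) e))

lemma tensorHom_surjective {V V' W W' : DGVec k} {f : V ⟶ V'} {g : W ⟶ W'}
    (hf : Function.Surjective f.lin) (hg : Function.Surjective g.lin) :
    Function.Surjective (f ⊗ₘ g).lin :=
  TensorProduct.map_surjective hf hg

/-- Over a field all modules are flat. This is what allows comultiplications to be restricted to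
subspaces. -/
lemma tensorHom_injective {V V' W W' : DGVec k} {f : V ⟶ V'} {g : W ⟶ W'}
    (hf : Function.Injective f.lin) (hg : Function.Injective g.lin) :
    Function.Injective (f ⊗ₘ g).lin :=
  TensorProduct.map_injective_of_flat_flat f.lin g.lin hf hg

end DGVec

/-! ### Words: the reduced tensor algebra and coalgebra -/

namespace DGVec

variable {k : Type u} [Field k] (V : DGVec k)

/-- The dg vector space `V^{⊗ (n + 1)}` of words of length `n + 1`. -/
noncomputable def wordPow : ℕ → DGVec k
  | 0 => V
  | n + 1 => wordPow n ⊗ V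

/-- The dg vector space `⨁ n, V^{⊗ (n + 1)}` of non-empty words. -/
noncomputable def words : DGVec k := dsum (wordPow V)

/-- The inclusion of the words of length `n + 1`. -/
noncomputable def wordι (n : ℕ) : wordPow V n ⟶ words V := ι (wordPow V) n

/-- The inclusion of the words of length one. -/
noncomputable def letter : V ⟶ words V := wordι V 0

/-- Appending a letter to a word. -/
noncomputable def snoc : words V ⊗ V ⟶ words V :=
  dsumDescRight (W := wordPow V) fun n => wordι V (n + 1)

lemma wordι_snoc (n : ℕ) : wordι V n ▷ V ≫ snoc V = wordι V (n + 1) :=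
  ι_dsumDescRight (W := wordPow V) (fun n => wordι V (n + 1)) n

/-! ### Induction and recursion on words -/

variable {V}

/-- Induction on the length of a word, by its last letter. The hypothesis speaks of an arbitrary
morphism `e` into words instead of the words of length `n + 1`, so that applications never refer to
lengths. -/
lemma words_hom_ext {X : DGVec k} {f g : words V ⟶ X} (h0 : letter V ≫ f = letter V ≫ g)
    (hs : ∀ {Y : DGVec k} (e : Y ⟶ words V), e ≫ f = e ≫ g →
      e ▷ V ≫ snoc V ≫ f = e ▷ V ≫ snoc V ≫ g) : f = g := by
  refine dsum_hom_ext (W := wordPow V) fun n => ?_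
  induction n with
  | zero => exact h0
  | succ n ih =>
    have h := hs _ ih
    rw [← Category.assoc, ← Category.assoc] at h
    exact (congrArg (· ≫ f) (wordι_snoc V n)).symm.trans
      (h.trans (congrArg (· ≫ g) (wordι_snoc V n)))

/-- The same induction with a parameter `Y`, needed for identities in which the last of several
factors is a word. -/
lemma words_whiskerLeft_ext {X Y : DGVec k} {f g : Y ⊗ words V ⟶ X}
    (h0 : Y ◁ letter V ≫ f = Y ◁ letter V ≫ g)
    (hs : ∀ {Z : DGVec k} (e : Z ⟶ words V), Y ◁ e ≫ f = Y ◁ e ≫ g →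
      Y ◁ e ▷ V ≫ Y ◁ snoc V ≫ f = Y ◁ e ▷ V ≫ Y ◁ snoc V ≫ g) : f = g := by
  refine dsum_whiskerLeft_ext (W := wordPow V) fun n => ?_
  induction n with
  | zero => exact h0
  | succ n ih =>
    have h := hs _ ih
    rw [← MonoidalCategory.whiskerLeft_comp_assoc,
      ← MonoidalCategory.whiskerLeft_comp_assoc] at h
    exact (congrArg (Y ◁ · ≫ f) (wordι_snoc V n)).symm.trans
      (h.trans (congrArg (Y ◁ · ≫ g) (wordι_snoc V n)))

lemma words_whiskerRight_ext {X Y : DGVec k} {f g : words V ⊗ Y ⟶ X}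
    (h : ∀ n, wordι V n ▷ Y ≫ f = wordι V n ▷ Y ≫ g) : f = g :=
  dsum_whiskerRight_ext (W := wordPow V) h

/-- The morphism out of the words defined by recursion: `F (letter v) = a v` and
`F (snoc w v) = b (F w) v`. -/
noncomputable def wordsRecAux {X : DGVec k} (a : V ⟶ X) (b : X ⊗ V ⟶ X) :
    ∀ n, wordPow V n ⟶ X
  | 0 => a
  | n + 1 => wordsRecAux a b n ▷ V ≫ b

/-- The morphism out of the words defined by recursion: `F (letter v) = a v` and
`F (snoc w v) = b (F w) v`. -/
noncomputable def wordsRec {X : DGVec k} (a : V ⟶ X) (b : X ⊗ V ⟶ X) : words V ⟶ X :=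
  dsumDesc (W := wordPow V) (wordsRecAux a b)

lemma wordι_wordsRec {X : DGVec k} (a : V ⟶ X) (b : X ⊗ V ⟶ X) (n : ℕ) :
    wordι V n ≫ wordsRec a b = wordsRecAux a b n :=
  ι_dsumDesc (W := wordPow V) (wordsRecAux a b) n

lemma letter_wordsRec {X : DGVec k} (a : V ⟶ X) (b : X ⊗ V ⟶ X) :
    letter V ≫ wordsRec a b = a :=
  wordι_wordsRec a b 0

lemma snoc_wordsRec {X : DGVec k} (a : V ⟶ X) (b : X ⊗ V ⟶ X) :
    snoc V ≫ wordsRec a b = wordsRec a b ▷ V ≫ b := by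
  refine words_whiskerRight_ext fun n => ?_
  rw [← Category.assoc, ← comp_whiskerRight_assoc, wordι_wordsRec]
  exact (congrArg (· ≫ wordsRec a b) (wordι_snoc V n)).trans (wordι_wordsRec a b (n + 1))

/-! ### Concatenation and deconcatenation -/

variable (V)

/-- Concatenation of words. -/
noncomputable def concat : words V ⊗ words V ⟶ words V :=
  -- The recursion runs over the second word and takes values in the internal endomorphisms of
  -- `words V`. A letter acts by `snoc`, and a longer word acts by its initial part followed by
  -- `snoc` with its last letter.
  words V ◁ wordsRec (curryLeft (snoc V))
    (curryLeft ((α_ _ _ _).inv ≫ ihomEval (words V) (words V) ▷ V ≫ snoc V)) ≫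
    ihomEval (words V) (words V)

lemma letter_concat : words V ◁ letter V ≫ concat V = snoc V := by
  rw [concat, ← MonoidalCategory.whiskerLeft_comp_assoc, letter_wordsRec, curryLeft_ihomEval]

lemma snoc_concat :
    words V ◁ snoc V ≫ concat V = (α_ _ _ _).inv ≫ concat V ▷ V ≫ snoc V := by
  rw [concat, ← MonoidalCategory.whiskerLeft_comp_assoc, snoc_wordsRec,
    MonoidalCategory.whiskerLeft_comp_assoc, curryLeft_ihomEval,
    associator_inv_naturality_middle_assoc, ← comp_whiskerRight_assoc]

/-- Induction on the third word: for a single letter this is the recursion for concatenation, and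
when a letter is appended both bracketings obey the same recursion. -/
lemma concat_assoc : concat V ▷ words V ≫ concat V =
    (α_ _ _ _).hom ≫ words V ◁ concat V ≫ concat V := by
  refine words_whiskerLeft_ext ?_ fun e he => ?_
  · rw [whisker_exchange_assoc, letter_concat, associator_naturality_right_assoc,
      ← MonoidalCategory.whiskerLeft_comp_assoc, letter_concat, snoc_concat,
      Iso.hom_inv_id_assoc]
  · have hl : (words V ⊗ words V) ◁ snoc V ≫ concat V ▷ words V ≫ concat V =
        (α_ _ _ _).inv ≫ (concat V ▷ words V ≫ concat V) ▷ V ≫ snoc V := by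
      rw [whisker_exchange_assoc, snoc_concat, associator_inv_naturality_left_assoc,
        comp_whiskerRight_assoc]
    have hr : (words V ⊗ words V) ◁ snoc V ≫ (α_ _ _ _).hom ≫ words V ◁ concat V ≫ concat V =
        (α_ _ _ _).inv ≫ ((α_ _ _ _).hom ≫ words V ◁ concat V ≫ concat V) ▷ V ≫ snoc V := by
      rw [associator_naturality_right_assoc, ← MonoidalCategory.whiskerLeft_comp_assoc,
        snoc_concat, MonoidalCategory.whiskerLeft_comp_assoc,
        MonoidalCategory.whiskerLeft_comp_assoc, snoc_concat,
        associator_inv_naturality_middle_assoc, comp_whiskerRight_assoc, comp_whiskerRight_assoc,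
        pentagon_hom_inv_inv_inv_hom_assoc]
    rw [hl, hr, associator_inv_naturality_middle_assoc, associator_inv_naturality_middle_assoc,
      ← comp_whiskerRight_assoc, ← comp_whiskerRight_assoc, he]

/-- Deconcatenation of words. -/
noncomputable def deconcatAux : ∀ n, wordPow V n ⟶ words V ⊗ words V
  -- Both pieces of a cut are non-empty, so a single letter has no cut.
  | 0 => 0
  -- Either the cut is just before the last letter, or it lies earlier and the last letter joins the
  -- right piece.
  | n + 1 => wordι V n ▷ V ≫ words V ◁ letter V +
      deconcatAux n ▷ V ≫ (α_ _ _ _).hom ≫ words V ◁ snoc V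

/-- Deconcatenation of words. -/
noncomputable def deconcat : words V ⟶ words V ⊗ words V :=
  dsumDesc (W := wordPow V) (deconcatAux V)

lemma wordι_deconcat (n : ℕ) : wordι V n ≫ deconcat V = deconcatAux V n :=
  ι_dsumDesc (W := wordPow V) (deconcatAux V) n

lemma letter_deconcat : letter V ≫ deconcat V = 0 := wordι_deconcat V 0

lemma snoc_deconcat : snoc V ≫ deconcat V =
    words V ◁ letter V + deconcat V ▷ V ≫ (α_ _ _ _).hom ≫ words V ◁ snoc V := by
  refine words_whiskerRight_ext fun n => ?_
  rw [← Category.assoc, Preadditive.comp_add, ← comp_whiskerRight_assoc, wordι_deconcat]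
  exact (congrArg (· ≫ deconcat V) (wordι_snoc V n)).trans (wordι_deconcat V (n + 1))

/-- Induction on the word. When a letter is appended, the cuts into three pieces are sorted by
whether that letter forms the third piece alone or is added to a longer one. This gives a common
normal form for both sides. -/
lemma deconcat_coassoc : deconcat V ≫ deconcat V ▷ words V ≫ (α_ _ _ _).hom =
    deconcat V ≫ words V ◁ deconcat V := by
  refine words_hom_ext ?_ fun e he => ?_
  · rw [reassoc_of% (letter_deconcat V), reassoc_of% (letter_deconcat V),
      Limits.zero_comp, Limits.zero_comp]
  · have hl : snoc V ≫ deconcat V ≫ deconcat V ▷ words V ≫ (α_ _ _ _).hom =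
        deconcat V ▷ V ≫ (α_ _ _ _).hom ≫ words V ◁ words V ◁ letter V +
          (deconcat V ≫ deconcat V ▷ words V ≫ (α_ _ _ _).hom) ▷ V ≫ (α_ _ _ _).hom ≫
            words V ◁ (α_ _ _ _).hom ≫ words V ◁ words V ◁ snoc V := by
      rw [reassoc_of% (snoc_deconcat V), Preadditive.add_comp, whisker_exchange_assoc,
        associator_naturality_right]
      simp only [Category.assoc, comp_whiskerRight]
      rw [whisker_exchange_assoc, associator_naturality_right,
        ← associator_naturality_left_assoc, pentagon_assoc]
    have hr : snoc V ≫ deconcat V ≫ words V ◁ deconcat V =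
        deconcat V ▷ V ≫ (α_ _ _ _).hom ≫ words V ◁ words V ◁ letter V +
          (deconcat V ≫ words V ◁ deconcat V) ▷ V ≫ (α_ _ _ _).hom ≫
            words V ◁ (α_ _ _ _).hom ≫ words V ◁ words V ◁ snoc V := by
      rw [reassoc_of% (snoc_deconcat V), Preadditive.add_comp,
        ← MonoidalCategory.whiskerLeft_comp, letter_deconcat, MonoidalPreadditive.whiskerLeft_zero,
        zero_add, Category.assoc, Category.assoc, ← MonoidalCategory.whiskerLeft_comp,
        snoc_deconcat, MonoidalPreadditive.whiskerLeft_add]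
      simp only [Preadditive.comp_add, Category.assoc, comp_whiskerRight,
        MonoidalCategory.whiskerLeft_comp]
      rw [associator_naturality_middle_assoc]
    rw [hl, hr, Preadditive.comp_add, Preadditive.comp_add, ← comp_whiskerRight_assoc e
      (deconcat V ≫ deconcat V ▷ words V ≫ _), ← comp_whiskerRight_assoc e
      (deconcat V ≫ words V ◁ deconcat V), he]

end DGVec

/-! ### Free algebras -/

namespace NonUnitalDGAlg

open DGVec

variable {k : Type u} [Field k]

/-- The free non-unital dg algebra on a dg vector space. -/
noncomputable def free (V : DGVec k) : NonUnitalDGAlg k where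
  X := words V
  mul := concat V
  mul_assoc := concat_assoc V

variable {V : DGVec k}

/-- The algebra map out of the free algebra extending a given morphism. -/
noncomputable def freeDesc {B : NonUnitalDGAlg k} (φ : V ⟶ B.X) : free V ⟶ B where
  hom := wordsRec φ (B.X ◁ φ ≫ B.mul)
  mul_hom := by
    change concat V ≫ wordsRec φ (B.X ◁ φ ≫ B.mul) =
      (wordsRec φ (B.X ◁ φ ≫ B.mul) ⊗ₘ wordsRec φ (B.X ◁ φ ≫ B.mul)) ≫ B.mul
    generalize hF : wordsRec φ (B.X ◁ φ ≫ B.mul) = F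
    have h0 : letter V ≫ F = φ := by rw [← hF, letter_wordsRec]
    have hs : snoc V ≫ F = F ▷ V ≫ B.X ◁ φ ≫ B.mul := by rw [← hF, snoc_wordsRec]
    have hw : ∀ {Y : DGVec k} (g : Y ⟶ words V),
        words V ◁ g ≫ (F ⊗ₘ F) ≫ B.mul = words V ◁ (g ≫ F) ≫ F ▷ B.X ≫ B.mul := fun g => by
      rw [tensorHom_def', MonoidalCategory.whiskerLeft_comp, Category.assoc, Category.assoc]
    -- Induction on the second word: an appended letter becomes a right factor `φ v`, which
    -- associativity of `B.mul` moves outside the product.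
    refine words_whiskerLeft_ext ?_ fun e he => ?_
    · rw [← Category.assoc, letter_concat, hs, hw, h0, whisker_exchange_assoc]
    · have hl : words V ◁ snoc V ≫ concat V ≫ F =
          (α_ _ _ _).inv ≫ (concat V ≫ F) ▷ V ≫ B.X ◁ φ ≫ B.mul := by
        rw [reassoc_of% (snoc_concat V), hs, comp_whiskerRight_assoc]
      have hr : words V ◁ snoc V ≫ (F ⊗ₘ F) ≫ B.mul =
          (α_ _ _ _).inv ≫ ((F ⊗ₘ F) ≫ B.mul) ▷ V ≫ B.X ◁ φ ≫ B.mul := by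
        have e : (α_ (words V) (words V) V).inv ≫ (F ⊗ₘ F) ▷ V ≫ (α_ _ _ _).hom =
            F ⊗ₘ (F ▷ V) := by
          rw [← tensorHom_id, ← tensorHom_id, associator_naturality, Iso.inv_hom_id_assoc]
        rw [hw, hs, comp_whiskerRight_assoc, ← whisker_exchange_assoc B.mul φ,
          B.mul_assoc,
          associator_naturality_right_assoc, reassoc_of% e, MonoidalCategory.tensorHom_def']
        simp only [MonoidalCategory.whiskerLeft_comp, Category.assoc]
        rw [whisker_exchange_assoc, whisker_exchange_assoc, whisker_exchange_assoc]
      rw [hl, hr, associator_inv_naturality_middle_assoc, associator_inv_naturality_middle_assoc,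
        ← comp_whiskerRight_assoc (words V ◁ e) (concat V ≫ F),
        ← comp_whiskerRight_assoc (words V ◁ e) ((F ⊗ₘ F) ≫ B.mul), he]

lemma letter_freeDesc {B : NonUnitalDGAlg k} (φ : V ⟶ B.X) : letter V ≫ (freeDesc φ).hom = φ :=
  letter_wordsRec _ _

/-- Appending a letter is multiplying by a word of length one, so a multiplicative map satisfies a
recursion that involves only its values on letters. Uniqueness in the universal property of the free
algebra follows. -/
lemma snoc_comp_of_concat_comp {B : DGVec k} {F : words V ⟶ B} {μ : B ⊗ B ⟶ B}
    (h : concat V ≫ F = (F ⊗ₘ F) ≫ μ) : snoc V ≫ F = F ▷ V ≫ B ◁ (letter V ≫ F) ≫ μ := by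
  rw [← letter_concat, Category.assoc, h, MonoidalCategory.tensorHom_def,
    MonoidalCategory.whiskerLeft_comp, Category.assoc, Category.assoc,
    whisker_exchange_assoc]

lemma words_hom_ext_of_concat_comp {B : DGVec k} {F G : words V ⟶ B} {μ : B ⊗ B ⟶ B}
    (hF : concat V ≫ F = (F ⊗ₘ F) ≫ μ) (hG : concat V ≫ G = (G ⊗ₘ G) ≫ μ)
    (h : letter V ≫ F = letter V ≫ G) : F = G := by
  refine words_hom_ext h fun e he => ?_
  rw [snoc_comp_of_concat_comp hF, snoc_comp_of_concat_comp hG, h, ← comp_whiskerRight_assoc,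
    ← comp_whiskerRight_assoc, he]

lemma free_hom_ext {B : NonUnitalDGAlg k} {f g : free V ⟶ B}
    (h : letter V ≫ f.hom = letter V ≫ g.hom) : f = g :=
  hom_ext (words_hom_ext_of_concat_comp f.mul_hom g.mul_hom h)

end NonUnitalDGAlg

/-! ### Cofree conilpotent coalgebras -/

namespace NonCounitalDGCoalg

open DGVec

variable {k : Type u} [Field k]

/-! ### Recursion along the kernels of the iterated comultiplications -/

lemma iterComul_zero_eq_zero {C : NonCounitalDGCoalg k} {x : C.X} (h : C.iterComul 0 x = 0) :
    x = 0 :=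
  (LinearEquiv.map_eq_zero_iff _).1 h

/-- By flatness `Δ x` lies in `ker Δⁿ ⊗ C` when `Δⁿ⁺¹ x = 0`, so only the values of `F` on `ker Δⁿ`
matter. All inductions over a conilpotent coalgebra rest on this. -/
lemma map_comul_eq_zero {C : NonCounitalDGCoalg k} {n : ℕ} {x : C.X}
    (hx : C.iterComul (n + 1) x = 0) {Y Z : Type*} [AddCommGroup Y] [Module k Y]
    [AddCommGroup Z] [Module k Z] (F : C.X →ₗ[k] Z) (G : C.X →ₗ[k] Y)
    (hF : ∀ y, C.iterComul n y = 0 → F y = 0) :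
    TensorProduct.map F G (show C.X ⊗[k] C.X from C.comul.lin x) = 0 := by
  obtain ⟨w, hw⟩ := (iterComul_succ_eq_zero C n x _ rfl).1 hx
  have h0 : F ∘ₗ (LinearMap.ker (C.iterComul n)).subtype = 0 :=
    LinearMap.ext fun y => hF y y.2
  rw [← hw, LinearMap.rTensor, ← LinearMap.comp_apply, ← TensorProduct.map_comp, h0,
    TensorProduct.map_zero_left, LinearMap.zero_apply]

/-- A morphism out of a conilpotent coalgebra, glued from morphisms which agree on the kernels of
the iterated comultiplications. -/
lemma exists_glue {C : NonCounitalDGCoalg k} (hC : IsConilpotent C) {Z : DGVec k}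
    (g : ℕ → (C.X ⟶ Z))
    (hg : ∀ n x, C.iterComul n x = 0 → (g (n + 1)).lin x = (g n).lin x) :
    ∃ f : C.X ⟶ Z, ∀ n x, C.iterComul n x = 0 → f.lin x = (g n).lin x := by
  have hmono : ∀ {m n : ℕ}, m ≤ n → ∀ x, C.iterComul m x = 0 →
      (g n).lin x = (g m).lin x := by
    intro m n hmn x hx
    induction n, hmn using Nat.le_induction with
    | base => rfl
    | succ n hmn ih => rw [hg n x (iterComul_eq_zero_of_le C hmn x hx), ih]
  -- The glued map is `x ↦ g (N x) x`, where `N x` is any stage that kills `x`. Linearity and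
  -- compatibility with `d` are checked at a common later stage, where all the values involved come
  -- from one `g n`.
  choose N hN using hC
  have key : ∀ n x, C.iterComul n x = 0 → (g (N x)).lin x = (g n).lin x := fun n x hx => by
    rcases le_total (N x) n with h | h
    · exact (hmono h x (hN x)).symm
    · exact hmono h x hx
  have hle : ∀ {n} x, N x ≤ n → (g (N x)).lin x = (g n).lin x := fun x h =>
    key _ x (iterComul_eq_zero_of_le C h x (hN x))
  refine ⟨⟨⟨⟨fun x => (g (N x)).lin x, fun x y => ?_⟩, fun a x => ?_⟩, fun n x hx => ?_,
    fun x => ?_⟩, key⟩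
  · rw [hle (n := N (x + y) + N x + N y) (x + y) (by omega),
      hle (n := N (x + y) + N x + N y) x (by omega),
      hle (n := N (x + y) + N x + N y) y (by omega), map_add]
  · change (g (N (a • x))).lin (a • x) = a • (g (N x)).lin x
    rw [hle (n := N (a • x) + N x) (a • x) (by omega), hle (n := N (a • x) + N x) x (by omega),
      map_smul]
  · exact (g (N x)).map_mem n x hx
  · change (g (N (C.X.d x))).lin (C.X.d x) = Z.d ((g (N x)).lin x)
    rw [hle (n := N (C.X.d x) + N x) (C.X.d x) (by omega),
      hle (n := N (C.X.d x) + N x) x (by omega), (g _).map_d]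

/-- A linear recursion along the comultiplication of a conilpotent coalgebra has a solution. -/
lemma exists_eq_add_comul {C : NonCounitalDGCoalg k} (hC : IsConilpotent C) {Y Z : DGVec k}
    (a : C.X ⟶ Z) (ψ : C.X ⟶ Y) (s : Z ⊗ Y ⟶ Z) :
    ∃ f : C.X ⟶ Z, f = a + C.comul ≫ (f ⊗ₘ ψ) ≫ s := by
  -- Successive approximation starting from `0`. By `hdiff`, agreement on `ker Δⁿ` improves to
  -- agreement on `ker Δⁿ⁺¹` after one iteration, so `g n` is final on `ker Δⁿ`.
  let g : ℕ → (C.X ⟶ Z) := fun n => Nat.rec 0 (fun _ f => a + C.comul ≫ (f ⊗ₘ ψ) ≫ s) n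
  have hdiff : ∀ (f f' : C.X ⟶ Z) (n : ℕ), (∀ x, C.iterComul n x = 0 → f.lin x = f'.lin x) →
      ∀ x, C.iterComul (n + 1) x = 0 → (a + C.comul ≫ (f ⊗ₘ ψ) ≫ s).lin x =
        (a + C.comul ≫ (f' ⊗ₘ ψ) ≫ s).lin x := by
    intro f f' n h x hx
    have h1 := map_comul_eq_zero hx (f.lin - f'.lin) ψ.lin
      fun y hy => sub_eq_zero_of_eq (h y hy)
    have h2 : TensorProduct.map (f.lin - f'.lin) ψ.lin =
        TensorProduct.map f.lin ψ.lin - TensorProduct.map f'.lin ψ.lin :=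
      TensorProduct.ext' fun x y => TensorProduct.sub_tmul _ _ _
    rw [h2, LinearMap.sub_apply, sub_eq_zero] at h1
    exact congrArg (fun z => a.lin x + s.lin z) h1
  have hg : ∀ n x, C.iterComul n x = 0 → (g (n + 1)).lin x = (g n).lin x := by
    intro n
    induction n with
    | zero =>
      intro x hx
      rw [iterComul_zero_eq_zero hx, map_zero, map_zero]
    | succ n ih => exact hdiff _ _ n ih
  obtain ⟨f, hf⟩ := exists_glue hC g hg
  refine ⟨f, DGVec.hom_ext (LinearMap.ext fun x => ?_)⟩
  obtain ⟨n, hn⟩ := hC x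
  -- At such an `x` the glued `f` equals `g (n + 1)`, which is the right-hand side formed with `g
  -- n`. As `f` and `g n` agree on `ker Δⁿ`, that is also the right-hand side formed with `f`.
  have hn' := iterComul_succ_of_eq_zero C n x hn
  exact (hf (n + 1) x hn').trans (hdiff f (g n) n (hf n) x hn').symm

lemma eq_zero_of_eq_comul {C : NonCounitalDGCoalg k} (hC : IsConilpotent C) {Y Z : DGVec k}
    {f : C.X ⟶ Z} {ψ : C.X ⟶ Y} {s : Z ⊗ Y ⟶ Z} (hf : f = C.comul ≫ (f ⊗ₘ ψ) ≫ s) : f = 0 := by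
  have h : ∀ n x, C.iterComul n x = 0 → f.lin x = 0 := by
    intro n
    induction n with
    | zero =>
      intro x hx
      rw [iterComul_zero_eq_zero hx, map_zero]
    | succ n ih =>
      intro x hx
      rw [hf]
      exact (congrArg s.lin (map_comul_eq_zero hx f.lin ψ.lin ih)).trans (map_zero _)
  refine DGVec.hom_ext (LinearMap.ext fun x => ?_)
  obtain ⟨n, hn⟩ := hC x
  exact h n x hn

/-- The recursion is affine in `f`, since `ψ` is held fixed. The difference of two solutions solves
the homogeneous recursion and vanishes by induction on the stage. -/
lemma eq_of_eq_add_comul {C : NonCounitalDGCoalg k} (hC : IsConilpotent C) {Y Z : DGVec k}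
    {f f' a : C.X ⟶ Z} {ψ : C.X ⟶ Y} {s : Z ⊗ Y ⟶ Z} (hf : f = a + C.comul ≫ (f ⊗ₘ ψ) ≫ s)
    (hf' : f' = a + C.comul ≫ (f' ⊗ₘ ψ) ≫ s) : f = f' := by
  rw [← sub_eq_zero]
  refine eq_zero_of_eq_comul hC (ψ := ψ) (s := s) ?_
  conv_lhs => rw [hf, hf']
  rw [add_sub_add_left_eq_sub, ← Preadditive.comp_sub, ← Preadditive.sub_comp]
  congr 2
  exact DGVec.hom_ext (TensorProduct.ext' fun x y => (TensorProduct.sub_tmul _ _ _).symm)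

/-- The cofree conilpotent coalgebra on a dg vector space. -/
noncomputable def cofree (V : DGVec k) : NonCounitalDGCoalg k where
  X := words V
  comul := deconcat V
  comul_assoc := deconcat_coassoc V

/-- A word of length `n + 1` can be cut at most `n` times. The induction uses the recursive form of
the kernel of `Δⁿ⁺²`: all left pieces of cuts must lie in `ker Δⁿ⁺¹`. -/
lemma iterComul_wordι (V : DGVec k) (n : ℕ) (w : wordPow V n) :
    (cofree V).iterComul (n + 1) ((wordι V n).lin w) = 0 := by
  induction n with
  | zero =>
    refine (iterComul_succ_eq_zero (cofree V) 0 _ 0 ?_).2 (zero_mem _)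
    exact congrArg (fun F => F.lin w) (letter_deconcat V)
  | succ n ih =>
    refine (iterComul_succ_eq_zero (cofree V) (n + 1) _ _ rfl).2 ?_
    have key : ∀ (w : wordPow V n) (v : V),
        (wordι V (n + 1) ≫ deconcat V).lin (w ⊗ₜ[k] v) ∈ LinearMap.range
          ((LinearMap.ker ((cofree V).iterComul (n + 1))).subtype.rTensor (words V)) := by
      intro w v
      -- The map `t` appends `v`. The coproduct of `w v` is the cut before `v`, whose left piece is
      -- `w`, plus the cuts of `w` with `t` applied to the right piece; these leave the left pieces
      -- unchanged.
      let t : words V →ₗ[k] words V := (snoc V).lin ∘ₗ (TensorProduct.mk k _ _).flip v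
      have e : (wordι V (n + 1) ≫ deconcat V).lin (w ⊗ₜ[k] v) =
          (wordι V n).lin w ⊗ₜ[k] (letter V).lin v +
            t.lTensor (words V) ((deconcat V).lin ((wordι V n).lin w)) := by
        have e1 : (words V ◁ snoc V).lin ∘ₗ (α_ (words V) (words V) V).hom.lin ∘ₗ
            (TensorProduct.mk k (words V ⊗[k] words V) V).flip v = t.lTensor (words V) :=
          TensorProduct.ext' fun _ _ => rfl
        rw [wordι_deconcat, ← e1]
        have e2 := congrArg (fun F => F.lin w) (wordι_deconcat V n)
        exact congrArg (fun z => (wordι V n).lin w ⊗ₜ[k] (letter V).lin v +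
          (show words V ⊗[k] words V from
            (words V ◁ snoc V).lin ((α_ (words V) (words V) V).hom.lin (z ⊗ₜ[k] v)))) e2.symm
      rw [e]
      refine add_mem ⟨⟨_, ih w⟩ ⊗ₜ[k] (letter V).lin v, rfl⟩ ?_
      obtain ⟨z, hz⟩ := (iterComul_succ_eq_zero (cofree V) n _ _ rfl).1 (ih w)
      have hle : LinearMap.ker ((cofree V).iterComul n) ≤
          LinearMap.ker ((cofree V).iterComul (n + 1)) :=
        fun a ha => iterComul_succ_of_eq_zero (cofree V) n a ha
      have e3 : (LinearMap.ker ((cofree V).iterComul (n + 1))).subtype.rTensor (words V) ∘ₗ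
          TensorProduct.map (Submodule.inclusion hle) t =
            t.lTensor (words V) ∘ₗ
              (LinearMap.ker ((cofree V).iterComul n)).subtype.rTensor (words V) :=
        TensorProduct.ext' fun _ _ => rfl
      exact ⟨TensorProduct.map (Submodule.inclusion hle) t z,
        (congrArg (fun F => F z) e3).trans (congrArg (t.lTensor (words V)) hz)⟩
    exact TensorProduct.induction_on (motive := fun u =>
      u ∈ (LinearMap.range ((LinearMap.ker ((cofree V).iterComul (n + 1))).subtype.rTensor
        (words V))).comap (wordι V (n + 1) ≫ deconcat V).lin) w (zero_mem _) key
      fun _ _ hx hy => add_mem hx hy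

lemma isConilpotent_cofree (V : DGVec k) : IsConilpotent (cofree V) := by
  refine dsum_induction (W := wordPow V) ⟨0, map_zero _⟩ ?_ fun n w => ⟨n + 1, iterComul_wordι V n w⟩
  rintro x y ⟨m, hm⟩ ⟨n, hn⟩
  refine ⟨max m n, ?_⟩
  refine (map_add ((cofree V).iterComul (max m n)) _ _).trans ?_
  rw [iterComul_eq_zero_of_le _ (le_max_left m n) _ hm,
    iterComul_eq_zero_of_le _ (le_max_right m n) _ hn, add_zero]

/-- The projection of the cofree coalgebra onto its cogenerators. -/
noncomputable def cofreeπ (V : DGVec k) : words V ⟶ V := wordsRec (𝟙 V) 0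

lemma letter_cofreeπ (V : DGVec k) : letter V ≫ cofreeπ V = 𝟙 V := letter_wordsRec _ _

lemma snoc_cofreeπ (V : DGVec k) : snoc V ≫ cofreeπ V = 0 := by
  rw [cofreeπ, snoc_wordsRec, Limits.comp_zero]

/-- A word of length one is its own letter. A longer word is recovered by cutting before the last
letter, the only cut whose right piece survives `cofreeπ`, and appending that letter again. -/
lemma words_id_eq (V : DGVec k) :
    𝟙 (words V) = cofreeπ V ≫ letter V + deconcat V ≫ words V ◁ cofreeπ V ≫ snoc V := by
  refine words_hom_ext ?_ fun e _ => ?_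
  · rw [Category.comp_id, Preadditive.comp_add, reassoc_of% (letter_cofreeπ V),
      reassoc_of% (letter_deconcat V), Limits.zero_comp, add_zero]
  · congr 1
    rw [Category.comp_id, Preadditive.comp_add, reassoc_of% (snoc_cofreeπ V), Limits.zero_comp,
      zero_add, reassoc_of% (snoc_deconcat V), Preadditive.add_comp, Category.assoc,
      Category.assoc, ← MonoidalCategory.whiskerLeft_comp_assoc, letter_cofreeπ,
      ← MonoidalCategory.whiskerLeft_comp_assoc, snoc_cofreeπ,
      MonoidalPreadditive.whiskerLeft_zero, Limits.zero_comp, Limits.comp_zero, Limits.comp_zero,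
      add_zero, MonoidalCategory.whiskerLeft_id, Category.id_comp]

/-- Compatibility with comultiplications is quadratic in `f`. Inserting `words_id_eq` makes it an
affine recursion once the cogenerator part of `f` is known, so `eq_of_eq_add_comul` gives
uniqueness. -/
lemma eq_add_comul_of_comp_deconcat {C V : DGVec k} {δ : C ⟶ C ⊗ C} {f : C ⟶ words V}
    (h : f ≫ deconcat V = δ ≫ (f ⊗ₘ f)) :
    f = (f ≫ cofreeπ V) ≫ letter V + δ ≫ (f ⊗ₘ (f ≫ cofreeπ V)) ≫ snoc V := by
  conv_lhs => rw [← Category.comp_id f, words_id_eq, Preadditive.comp_add, reassoc_of% h,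
    ← id_tensorHom, tensorHom_comp_tensorHom_assoc, Category.comp_id, ← Category.assoc]

lemma hom_ext_of_comp_deconcat {C : NonCounitalDGCoalg k} (hC : IsConilpotent C) {V : DGVec k}
    {f g : C.X ⟶ words V} (hf : f ≫ deconcat V = C.comul ≫ (f ⊗ₘ f))
    (hg : g ≫ deconcat V = C.comul ≫ (g ⊗ₘ g)) (h : f ≫ cofreeπ V = g ≫ cofreeπ V) : f = g := by
  have hf' := eq_add_comul_of_comp_deconcat hf
  rw [h] at hf'
  exact eq_of_eq_add_comul hC hf' (eq_add_comul_of_comp_deconcat hg)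

lemma cofree_hom_ext {C : NonCounitalDGCoalg k} (hC : IsConilpotent C) {V : DGVec k}
    {f g : C ⟶ cofree V} (h : f.hom ≫ cofreeπ V = g.hom ≫ cofreeπ V) : f = g :=
  hom_ext (hom_ext_of_comp_deconcat hC f.hom_comul g.hom_comul h)

/-- The universal property of the cofree conilpotent coalgebra. -/
lemma exists_cofree_lift {C : NonCounitalDGCoalg k} (hC : IsConilpotent C) {V : DGVec k}
    (φ : C.X ⟶ V) : ∃ f : C ⟶ cofree V, f.hom ≫ cofreeπ V = φ := by
  obtain ⟨f, hf⟩ := exists_eq_add_comul hC (φ ≫ letter V) φ (snoc V)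
  have hπ : f ≫ cofreeπ V = φ := by
    rw [hf, Preadditive.add_comp]
    simp only [Category.assoc]
    rw [letter_cofreeπ, snoc_cofreeπ]
    simp
  refine ⟨⟨f, ?_⟩, hπ⟩
  change f ≫ deconcat V = C.comul ≫ (f ⊗ₘ f)
  -- The solution `f` is comultiplicative because both sides solve one affine recursion in `words V
  -- ⊗ words V`: the inhomogeneous term cuts before the last letter, and `s` appends that letter to
  -- the right piece.
  refine eq_of_eq_add_comul hC (a := C.comul ≫ (f ⊗ₘ φ) ≫ words V ◁ letter V) (ψ := φ)
    (s := (α_ _ _ _).hom ≫ words V ◁ snoc V) ?_ ?_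
  · conv_lhs => rw [hf]
    rw [Preadditive.add_comp]
    simp only [Category.assoc]
    rw [letter_deconcat, Limits.comp_zero, zero_add, snoc_deconcat, Preadditive.comp_add,
      Preadditive.comp_add, ← tensorHom_id, tensorHom_comp_tensorHom_assoc, Category.comp_id]
  -- Only the second factor `f` is expanded by its recursion. Coassociativity of `C` then rearranges
  -- the second term.
  · have h : (f ⊗ₘ f) = (f ⊗ₘ φ) ≫ words V ◁ letter V +
        C.X ◁ C.comul ≫ (f ⊗ₘ (f ⊗ₘ φ)) ≫ words V ◁ snoc V := by
      conv_lhs => rw [congrArg (f ⊗ₘ ·) hf, MonoidalPreadditive.tensor_add]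
      rw [← id_tensorHom, ← id_tensorHom, ← id_tensorHom, tensorHom_comp_tensorHom,
        tensorHom_comp_tensorHom, tensorHom_comp_tensorHom, Category.comp_id, Category.id_comp]
    have h' : C.comul ≫ ((C.comul ≫ (f ⊗ₘ f)) ⊗ₘ φ) ≫ (α_ _ _ _).hom =
        C.comul ≫ C.X ◁ C.comul ≫ (f ⊗ₘ (f ⊗ₘ φ)) := by
      rw [← reassoc_of% C.comul_assoc, ← associator_naturality, ← tensorHom_id,
        tensorHom_comp_tensorHom_assoc, Category.id_comp]
    rw [reassoc_of% h']
    conv_lhs => rw [h, Preadditive.comp_add]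

end NonCounitalDGCoalg

/-! ### Quotient algebras and subcoalgebras -/

namespace DGVec

variable {k : Type u} [Field k]

section quot

variable {V : DGVec k} {S : Submodule k V} (hS : IsDGSubspace V S)

lemma subι_comp_eq_zero {X : DGVec k} {f : V ⟶ X} :
    subι hS ≫ f = 0 ↔ ∀ x ∈ S, f.lin x = 0 :=
  ⟨fun h x hx => congrArg (fun F => F.lin (⟨x, hx⟩ : S)) h,
    fun h => hom_ext (LinearMap.ext fun x => h _ (Subtype.property (p := (· ∈ S)) x))⟩

lemma exists_quotDescRight {X Y : DGVec k} (f : V ⊗ Y ⟶ X) (h : subι hS ▷ Y ≫ f = 0) :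
    ∃ g : quot hS ⊗ Y ⟶ X, quotπ hS ▷ Y ≫ g = f := by
  have h' : subι hS ≫ curry f = 0 := ext_ihomApply (by
    rw [comp_whiskerRight_assoc, curry_ihomApply, h, MonoidalPreadditive.zero_whiskerRight,
      Limits.zero_comp])
  refine ⟨quotDesc hS (curry f) ((subι_comp_eq_zero hS).1 h') ▷ Y ≫ ihomApply Y X, ?_⟩
  rw [← comp_whiskerRight_assoc, quotπ_quotDesc, curry_ihomApply]

lemma exists_quotDescLeft {X Y : DGVec k} (f : Y ⊗ V ⟶ X) (h : Y ◁ subι hS ≫ f = 0) :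
    ∃ g : Y ⊗ quot hS ⟶ X, Y ◁ quotπ hS ≫ g = f := by
  obtain ⟨g, hg⟩ := exists_quotDescRight hS ((β_ V Y).hom ≫ f) (by
    rw [BraidedCategory.braiding_naturality_left_assoc, h, Limits.comp_zero])
  refine ⟨(β_ Y (quot hS)).hom ≫ g, ?_⟩
  rw [BraidedCategory.braiding_naturality_right_assoc, hg, SymmetricCategory.symmetry_assoc]

/-- The map is descended one factor at a time. -/
lemma exists_quotDesc₂ {X : DGVec k} (f : V ⊗ V ⟶ X) (h : subι hS ▷ V ≫ f = 0)
    (h' : V ◁ subι hS ≫ f = 0) :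
    ∃ g : quot hS ⊗ quot hS ⟶ X, (quotπ hS ⊗ₘ quotπ hS) ≫ g = f := by
  obtain ⟨f₁, hf₁⟩ := exists_quotDescRight hS f h
  -- The half-descended map must vanish on the subspace in the second factor. As the projection in
  -- the first factor is epi, this follows from `h'`.
  have := epi_of_surjective (quotπ hS ▷ sub hS)
    (tensorHom_surjective (g := 𝟙 (sub hS)) (quotπ_surjective hS) Function.surjective_id)
  obtain ⟨g, hg⟩ := exists_quotDescLeft hS f₁ (by
    rw [← cancel_epi (quotπ hS ▷ sub hS), ← whisker_exchange_assoc, hf₁, h', Limits.comp_zero])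
  exact ⟨g, by rw [MonoidalCategory.tensorHom_def, Category.assoc, hg, hf₁]⟩

end quot

lemma exists_lift_of_injective {U V W : DGVec k} (j : U ⟶ V) (hj : Function.Injective j.lin)
    (f : W ⟶ V) (h : ∀ x, f.lin x ∈ LinearMap.range j.lin) : ∃ g : W ⟶ U, g ≫ j = f := by
  choose g hg using h
  have hj' : ∀ x y, j.lin x = j.lin y → x = y := fun _ _ e => hj e
  refine ⟨⟨⟨⟨g, fun x y => hj' _ _ ?_⟩, fun a x => hj' _ _ ?_⟩, fun n x hx => ?_,
    fun x => hj' _ _ ?_⟩, hom_ext (LinearMap.ext hg)⟩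
  · rw [map_add, hg, hg, hg, map_add]
  · change j.lin (g (a • x)) = j.lin (a • g x)
    rw [map_smul, hg, hg, map_smul]
  -- Morphisms commute with the degree projections, so injectivity of `j` forces the preimage of a
  -- homogeneous element to be homogeneous.
  · have e : U.proj n (g x) = g x := hj' _ _ (by
      rw [j.lin_proj, hg, V.proj_self (f.map_mem n x hx)])
    change g x ∈ U.gr n
    rw [← e]
    exact U.proj_mem_gr n _
  · change j.lin (g (W.d x)) = j.lin (U.d (g x))
    rw [hg, j.map_d, hg, f.map_d]

end DGVec

namespace NonUnitalDGAlg

open DGVec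

variable {k : Type u} [Field k]

/-- The dg ideals of a non-unital dg algebra. -/
structure IsDGIdeal (F : NonUnitalDGAlg k) (S : Submodule k F.X) : Prop
    extends IsDGSubspace F.X S where
  mul_mem_right (x : F.X) (hx : x ∈ S) (y : F.X) : F.mul.lin (x ⊗ₜ[k] y) ∈ S
  mul_mem_left (x : F.X) (hx : x ∈ S) (y : F.X) : F.mul.lin (y ⊗ₜ[k] x) ∈ S

lemma isDGIdeal_sInf {F : NonUnitalDGAlg k} {s : Set (Submodule k F.X)}
    (h : ∀ S ∈ s, IsDGIdeal F S) : IsDGIdeal F (sInf s) where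
  toIsDGSubspace := isDGSubspace_sInf fun S hS => (h S hS).toIsDGSubspace
  mul_mem_right x hx y := by
    rw [Submodule.mem_sInf] at hx ⊢
    exact fun S hS => (h S hS).mul_mem_right x (hx S hS) y
  mul_mem_left x hx y := by
    rw [Submodule.mem_sInf] at hx ⊢
    exact fun S hS => (h S hS).mul_mem_left x (hx S hS) y

lemma isDGIdeal_ker {F B : NonUnitalDGAlg k} (f : F ⟶ B) :
    IsDGIdeal F (LinearMap.ker f.hom.lin) where
  toIsDGSubspace := isDGSubspace_ker f.hom
  mul_mem_right x hx y := by
    refine (congrArg (fun G => G.lin (x ⊗ₜ[k] y)) f.mul_hom).trans ?_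
    change B.mul.lin (f.hom.lin x ⊗ₜ[k] f.hom.lin y) = 0
    rw [LinearMap.mem_ker.1 hx, TensorProduct.zero_tmul]
    exact map_zero _
  mul_mem_left x hx y := by
    refine (congrArg (fun G => G.lin (y ⊗ₜ[k] x)) f.mul_hom).trans ?_
    change B.mul.lin (f.hom.lin y ⊗ₜ[k] f.hom.lin x) = 0
    rw [LinearMap.mem_ker.1 hx, TensorProduct.tmul_zero]
    exact map_zero _

lemma exists_quotient_mul {F : NonUnitalDGAlg k} {S : Submodule k F.X} (hS : IsDGIdeal F S) :
    ∃ m : quot hS.toIsDGSubspace ⊗ quot hS.toIsDGSubspace ⟶ quot hS.toIsDGSubspace,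
      (quotπ hS.toIsDGSubspace ⊗ₘ quotπ hS.toIsDGSubspace) ≫ m =
        F.mul ≫ quotπ hS.toIsDGSubspace := by
  refine exists_quotDesc₂ _ _ ?_ ?_
  · refine DGVec.hom_ext (TensorProduct.ext' fun x y => ?_)
    exact (quotπ_eq_zero hS.toIsDGSubspace).2
      (hS.mul_mem_right _ (Subtype.property (p := (· ∈ S)) x) y)
  · refine DGVec.hom_ext (TensorProduct.ext' fun y x => ?_)
    exact (quotπ_eq_zero hS.toIsDGSubspace).2
      (hS.mul_mem_left _ (Subtype.property (p := (· ∈ S)) x) y)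

/-- Associativity is an identity of maps out of a triple tensor product, so it passes along the
epimorphism from that of `F`. -/
lemma mul_assoc_of_epi {F : NonUnitalDGAlg k} {Q : DGVec k} {π : F.X ⟶ Q} {m : Q ⊗ Q ⟶ Q}
    (hm : (π ⊗ₘ π) ≫ m = F.mul ≫ π) [Epi ((π ⊗ₘ π) ⊗ₘ π)] :
    m ▷ Q ≫ m = (α_ Q Q Q).hom ≫ Q ◁ m ≫ m := by
  rw [← cancel_epi ((π ⊗ₘ π) ⊗ₘ π)]
  have hl : ((π ⊗ₘ π) ⊗ₘ π) ≫ m ▷ Q = F.mul ▷ F.X ≫ (π ⊗ₘ π) := by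
    rw [← tensorHom_id, ← tensorHom_id, tensorHom_comp_tensorHom, tensorHom_comp_tensorHom, hm,
      Category.comp_id, Category.id_comp]
  have hr : (π ⊗ₘ (π ⊗ₘ π)) ≫ Q ◁ m = F.X ◁ F.mul ≫ (π ⊗ₘ π) := by
    rw [← id_tensorHom, ← id_tensorHom, tensorHom_comp_tensorHom, tensorHom_comp_tensorHom, hm,
      Category.comp_id, Category.id_comp]
  rw [reassoc_of% hl, hm, associator_naturality_assoc, reassoc_of% hr, hm,
    reassoc_of% F.mul_assoc]

/-- The quotient of a dg algebra by the dg ideal generated by the image of a morphism. -/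
lemma exists_quotient (F : NonUnitalDGAlg k) {R : DGVec k} (r : R ⟶ F.X) :
    ∃ (Q : NonUnitalDGAlg k) (π : F ⟶ Q), r ≫ π.hom = 0 ∧
      ∀ (B : NonUnitalDGAlg k) (f : F ⟶ B), r ≫ f.hom = 0 → ∃! g : Q ⟶ B, π ≫ g = f := by
  -- The generated ideal is the intersection of all dg ideals that contain the image of `r`. The
  -- kernel of any admissible `f` is among them, so `f` factors through the quotient.
  obtain ⟨S, hS⟩ : ∃ S, S = sInf {S : Submodule k F.X | IsDGIdeal F S ∧ ∀ z, r.lin z ∈ S} :=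
    ⟨_, rfl⟩
  have hI : IsDGIdeal F S := hS ▸ isDGIdeal_sInf fun S hS => hS.1
  have hr : ∀ z, r.lin z ∈ S := fun z => by
    rw [hS, Submodule.mem_sInf]
    exact fun S hS => hS.2 z
  obtain ⟨m, hm⟩ := exists_quotient_mul hI
  have hsurj := quotπ_surjective hI.toIsDGSubspace
  have hsurj₂ := tensorHom_surjective hsurj hsurj
  have epi₁ := epi_of_surjective _ hsurj
  have epi₂ := epi_of_surjective _ hsurj₂
  have epi₃ := epi_of_surjective _ (tensorHom_surjective hsurj₂ hsurj)
  refine ⟨⟨quot hI.toIsDGSubspace, m, mul_assoc_of_epi hm⟩,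
    ⟨quotπ hI.toIsDGSubspace, hm.symm⟩, ?_, fun B f hf => ?_⟩
  · exact DGVec.hom_ext (LinearMap.ext fun z => (quotπ_eq_zero hI.toIsDGSubspace).2 (hr z))
  · have hle : ∀ x ∈ S, f.hom.lin x = 0 := fun x hx => by
      have h : S ≤ LinearMap.ker f.hom.lin :=
        hS ▸ sInf_le ⟨isDGIdeal_ker f, fun z =>
          congrArg (fun F => DGVec.Hom.lin F z) hf⟩
      exact h hx
    have hg := quotπ_quotDesc hI.toIsDGSubspace f.hom hle
    refine ⟨⟨quotDesc hI.toIsDGSubspace f.hom hle, ?_⟩, hom_ext hg, fun g hg' => hom_ext ?_⟩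
    · rw [← cancel_epi (quotπ hI.toIsDGSubspace ⊗ₘ quotπ hI.toIsDGSubspace)]
      change (quotπ hI.toIsDGSubspace ⊗ₘ quotπ hI.toIsDGSubspace) ≫ m ≫ _ = _
      rw [reassoc_of% hm, hg, tensorHom_comp_tensorHom_assoc, hg, f.mul_hom]
    · rw [← cancel_epi (quotπ hI.toIsDGSubspace)]
      exact (congrArg Hom.hom hg').trans hg.symm

end NonUnitalDGAlg

namespace NonCounitalDGCoalg

open DGVec

variable {k : Type u} [Field k]

/-- The dg subcoalgebras of a dg coalgebra. -/
structure IsDGSubcoalgebra (E : NonCounitalDGCoalg k) (S : Submodule k E.X) : Prop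
    extends IsDGSubspace E.X S where
  comul_mem (x : E.X) (hx : x ∈ S) : E.comul.lin x ∈
    LinearMap.range (TensorProduct.map S.subtype S.subtype)

/-- Each `S ⊗ S` maps into the tensor square of the sum. Sums therefore give largest subcoalgebras,
dually to intersections of ideals. -/
lemma isDGSubcoalgebra_sSup {E : NonCounitalDGCoalg k} {s : Set (Submodule k E.X)}
    (h : ∀ S ∈ s, IsDGSubcoalgebra E S) : IsDGSubcoalgebra E (sSup s) where
  toIsDGSubspace := isDGSubspace_sSup fun S hS => (h S hS).toIsDGSubspace
  comul_mem x hx := by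
    have hle : sSup s ≤ (LinearMap.range (TensorProduct.map (sSup s).subtype
        (sSup s).subtype)).comap E.comul.lin := by
      refine sSup_le fun S hS x hx => ?_
      obtain ⟨w, hw⟩ := (h S hS).comul_mem x hx
      refine ⟨TensorProduct.map (Submodule.inclusion (le_sSup hS))
        (Submodule.inclusion (le_sSup hS)) w, ?_⟩
      rw [← hw, ← LinearMap.comp_apply, ← TensorProduct.map_comp]
      rfl
    exact hle hx

lemma isDGSubcoalgebra_range {C E : NonCounitalDGCoalg k} (f : C ⟶ E) :
    IsDGSubcoalgebra E (LinearMap.range f.hom.lin) where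
  toIsDGSubspace := isDGSubspace_range f.hom
  comul_mem := by
    rintro _ ⟨x, rfl⟩
    refine ⟨TensorProduct.map f.hom.lin.rangeRestrict f.hom.lin.rangeRestrict
      (C.comul.lin x), ?_⟩
    refine Eq.trans ?_ (congrArg (fun F => F.lin x) f.hom_comul).symm
    exact congrArg (fun F => F (show C.X ⊗[k] C.X from C.comul.lin x))
      (TensorProduct.map_comp f.hom.lin.range.subtype f.hom.lin.range.subtype
        f.hom.lin.rangeRestrict f.hom.lin.rangeRestrict).symm

lemma comul_assoc_of_mono {E : NonCounitalDGCoalg k} {D : DGVec k} {i : D ⟶ E.X} {δ : D ⟶ D ⊗ D}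
    (hδ : δ ≫ (i ⊗ₘ i) = i ≫ E.comul) [Mono (i ⊗ₘ (i ⊗ₘ i))] :
    δ ≫ δ ▷ D ≫ (α_ D D D).hom = δ ≫ D ◁ δ := by
  rw [← cancel_mono (i ⊗ₘ (i ⊗ₘ i))]
  have hl : δ ▷ D ≫ ((i ⊗ₘ i) ⊗ₘ i) = (i ⊗ₘ i) ≫ E.comul ▷ E.X := by
    rw [← tensorHom_id, ← tensorHom_id, tensorHom_comp_tensorHom, tensorHom_comp_tensorHom, hδ,
      Category.comp_id, Category.id_comp]
  have hr : D ◁ δ ≫ (i ⊗ₘ (i ⊗ₘ i)) = (i ⊗ₘ i) ≫ E.X ◁ E.comul := by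
    rw [← id_tensorHom, ← id_tensorHom, tensorHom_comp_tensorHom, tensorHom_comp_tensorHom, hδ,
      Category.comp_id, Category.id_comp]
  simp only [Category.assoc]
  rw [← associator_naturality, reassoc_of% hl, reassoc_of% hδ, hr, reassoc_of% hδ,
    E.comul_assoc]

/-- The largest dg subcoalgebra contained in the kernel of a morphism. -/
lemma exists_subcoalgebra (E : NonCounitalDGCoalg k) {R : DGVec k} (r : E.X ⟶ R) :
    ∃ (D : NonCounitalDGCoalg k) (i : D ⟶ E), Function.Injective i.hom.lin ∧ i.hom ≫ r = 0 ∧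
      ∀ (C : NonCounitalDGCoalg k) (f : C ⟶ E), f.hom ≫ r = 0 → ∃! g : C ⟶ D, g ≫ i = f := by
  obtain ⟨S, hS⟩ : ∃ S, S = sSup {S : Submodule k E.X | IsDGSubcoalgebra E S ∧
      S ≤ LinearMap.ker r.lin} := ⟨_, rfl⟩
  have hD : IsDGSubcoalgebra E S := hS ▸ isDGSubcoalgebra_sSup fun S hS => hS.1
  have hr : S ≤ LinearMap.ker r.lin := hS ▸ sSup_le fun S hS => hS.2
  have hinj := subι_injective hD.toIsDGSubspace
  have hinj₂ := tensorHom_injective hinj hinj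
  have mono₁ := mono_of_injective _ hinj
  have mono₂ := mono_of_injective _ hinj₂
  have mono₃ := mono_of_injective _ (tensorHom_injective hinj hinj₂)
  -- The tensor square of the inclusion is injective over a field, so the comultiplication restricts
  -- uniquely to `S` and inherits coassociativity.
  obtain ⟨δ, hδ⟩ := exists_lift_of_injective _ hinj₂ (subι hD.toIsDGSubspace ≫ E.comul)
    fun x => hD.comul_mem _ (Subtype.property (p := (· ∈ S)) x)
  refine ⟨⟨sub hD.toIsDGSubspace, δ, comul_assoc_of_mono hδ⟩, ⟨subι hD.toIsDGSubspace, hδ.symm⟩, hinj,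
    (subι_comp_eq_zero hD.toIsDGSubspace).2 hr, fun C f hf => ?_⟩
  -- The image of `f` is itself a dg subcoalgebra in the kernel of `r`, hence lies in the largest
  -- one.
  have hle : ∀ x, f.hom.lin x ∈ S := fun x => by
    have h : LinearMap.range f.hom.lin ≤ S := by
      rw [hS]
      refine le_sSup ⟨isDGSubcoalgebra_range f, ?_⟩
      rintro _ ⟨x, rfl⟩
      exact congrArg (fun F => F.lin x) hf
    exact h ⟨x, rfl⟩
  have hg := subLift_subι hD.toIsDGSubspace f.hom hle
  refine ⟨⟨subLift hD.toIsDGSubspace f.hom hle, ?_⟩, hom_ext hg, fun g hg' => hom_ext ?_⟩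
  · rw [← cancel_mono (subι hD.toIsDGSubspace ⊗ₘ subι hD.toIsDGSubspace)]
    change (_ ≫ δ) ≫ (subι hD.toIsDGSubspace ⊗ₘ subι hD.toIsDGSubspace) = _
    rw [Category.assoc, Category.assoc, hδ, reassoc_of% hg, tensorHom_comp_tensorHom, hg,
      f.hom_comul]
  · rw [← cancel_mono (subι hD.toIsDGSubspace)]
    exact (congrArg Hom.hom hg').trans hg.symm

/-- Flatness removes the injection `i` from the right tensor factor of the coproduct. What remains
says that the left factors lie in the kernel of `Δⁿ` pulled back along `i`, where the induction
hypothesis applies. -/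
lemma iterComul_eq_zero_of_injective {D E : NonCounitalDGCoalg k} (i : D ⟶ E)
    (hi : Function.Injective i.hom.lin) (n : ℕ) (x : D.X)
    (hx : E.iterComul n (i.hom.lin x) = 0) : D.iterComul n x = 0 := by
  induction n generalizing x with
  | zero =>
    have h := iterComul_zero_eq_zero hx
    rw [(map_eq_zero_iff _ hi).1 h, map_zero]
  | succ n ih =>
    have h0 := map_comul_eq_zero hx (E.iterComul n) LinearMap.id fun _ h => h
    have h1 : E.comul.lin (i.hom.lin x) =
        TensorProduct.map i.hom.lin i.hom.lin (D.comul.lin x) :=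
      congrArg (fun F => F.lin x) i.hom_comul
    have h2 : i.hom.lin.lTensor _ ((E.iterComul n ∘ₗ i.hom.lin).rTensor D.X
        (D.comul.lin x)) = 0 := by
      refine Eq.trans ?_ ((congrArg (TensorProduct.map (E.iterComul n) LinearMap.id) h1).symm.trans
        h0)
      have e : i.hom.lin.lTensor _ ∘ₗ (E.iterComul n ∘ₗ i.hom.lin).rTensor D.X =
          TensorProduct.map (E.iterComul n) LinearMap.id ∘ₗ
            TensorProduct.map i.hom.lin i.hom.lin :=
        TensorProduct.ext' fun _ _ => rfl
      exact congrArg (fun F => F (show D.X ⊗[k] D.X from D.comul.lin x)) e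
    have h3 := (map_eq_zero_iff _
      (Module.Flat.lTensor_preserves_injective_linearMap i.hom.lin hi)).1 h2
    obtain ⟨w, hw⟩ := (Module.Flat.rTensor_exact D.X
      (LinearMap.exact_subtype_ker_map (E.iterComul n ∘ₗ i.hom.lin)) _).1 h3
    refine (iterComul_succ_eq_zero D n x _ rfl).2 ?_
    have hle : LinearMap.ker (E.iterComul n ∘ₗ i.hom.lin) ≤ LinearMap.ker (D.iterComul n) :=
      fun y hy => ih y hy
    refine ⟨(Submodule.inclusion hle).rTensor D.X w, ?_⟩
    rw [← hw, ← LinearMap.comp_apply, ← LinearMap.rTensor_comp]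
    rfl

lemma IsConilpotent.of_injective {D E : NonCounitalDGCoalg k} (hE : IsConilpotent E) (i : D ⟶ E)
    (hi : Function.Injective i.hom.lin) : IsConilpotent D := fun x =>
  (hE (i.hom.lin x)).imp fun n => iterComul_eq_zero_of_injective i hi n x

end NonCounitalDGCoalg

/-! ### Parametrized adjunctions from families of adjoints -/

namespace CategoryTheory.ParametrizedAdjunction

variable {C₁ C₂ C₃ : Type*} [Category C₁] [Category C₂] [Category C₃]

/-- If all `G(X, -)` have left adjoints, then these assemble into a bifunctor. -/
lemma exists_left (G : C₁ᵒᵖ ⥤ C₃ ⥤ C₂) (h : ∀ X, (G.obj (op X)).IsRightAdjoint) :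
    ∃ F : C₁ ⥤ C₂ ⥤ C₃, Nonempty (F ⊣₂ G) := by
  have adj X := Adjunction.ofIsRightAdjoint (G.obj (op X))
  let F : C₁ ⥤ C₂ ⥤ C₃ :=
    { obj X := (G.obj (op X)).leftAdjoint
      -- The action on `f` has to be the mate of `G(f)`. Functoriality of mates gives the functor
      -- laws, and their compatibility with units is the coherence of a parametrized adjunction.
      map {X Y} f := (conjugateEquiv (adj Y) (adj X)).symm (G.map f.op)
      map_id X := by simp
      map_comp f g := by simp }
  exact ⟨F, ⟨adj, fun {X Y} f => by
    ext A
    exact (unit_conjugateEquiv_symm (adj Y) (adj X) (G.map f.op) A).symm⟩⟩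

/-- If all `F(X, -)` have right adjoints, then these assemble into a bifunctor. -/
lemma exists_right (F : C₁ ⥤ C₂ ⥤ C₃) (h : ∀ X, (F.obj X).IsLeftAdjoint) :
    ∃ G : C₁ᵒᵖ ⥤ C₃ ⥤ C₂, Nonempty (F ⊣₂ G) := by
  have adj X := Adjunction.ofIsLeftAdjoint (F.obj X)
  let G : C₁ᵒᵖ ⥤ C₃ ⥤ C₂ :=
    { obj X := (F.obj X.unop).rightAdjoint
      map {X Y} f := conjugateEquiv (adj X.unop) (adj Y.unop) (F.map f.unop)
      map_id X := by simp
      map_comp f g := by simp }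
  exact ⟨G, ⟨adj, fun {X Y} f => by
    ext A
    exact (unit_conjugateEquiv (adj Y) (adj X) (F.map f) A).symm⟩⟩

end CategoryTheory.ParametrizedAdjunction

/-! ### Tensoring and enrichment -/

namespace NonUnitalDGAlg

open DGVec

variable {k : Type u} [Field k]

lemma whiskerLeft_comp_ihomMap_ihomEval {U V V' W W' : DGVec k} (x : U ⟶ ihom V W) (h : V' ⟶ V)
    (g : W ⟶ W') : V' ◁ (x ≫ ihomMap h g) ≫ ihomEval V' W' =
      h ▷ U ≫ (V ◁ x ≫ ihomEval V W) ≫ g := by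
  rw [MonoidalCategory.whiskerLeft_comp, Category.assoc, ihomMap_ihomEval, Category.assoc,
    whisker_exchange_assoc]

lemma convHomEquiv_comp_convMap {C C' : NonCounitalDGCoalg k} {A B B' : NonUnitalDGAlg k}
    (x : A ⟶ conv C B) (h : C' ⟶ C) (g : B ⟶ B') :
    (convHomEquiv C' A B' (x ≫ convMap h g)).1 =
      h.hom ▷ A.X ≫ (convHomEquiv C A B x).1 ≫ g.hom :=
  whiskerLeft_comp_ihomMap_ihomEval x.hom h.hom g.hom

lemma convHomEquiv_comp {C : NonCounitalDGCoalg k} {A A' B : NonUnitalDGAlg k}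
    (f : A' ⟶ A) (x : A ⟶ conv C B) :
    (convHomEquiv C A' B (f ≫ x)).1 = C.X ◁ f.hom ≫ (convHomEquiv C A B x).1 :=
  MonoidalCategory.whiskerLeft_comp_assoc _ _ _ _

lemma convHomEquiv_comp_convFunctor_map_app {C C' : ConilDGCoalg k} {A B : NonUnitalDGAlg k}
    (x : A ⟶ ((convFunctor k).obj (op C)).obj B) (h : C' ⟶ C) :
    (convHomEquiv C'.obj A B (x ≫ ((convFunctor k).map h.op).app B)).1 =
      h.hom.hom ▷ A.X ≫ (convHomEquiv C.obj A B x).1 :=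
  convHomEquiv_comp_convMap x h.hom (𝟙 B)

lemma convHomEquiv_comp_convFunctor_obj_map {C : ConilDGCoalg k} {A B B' : NonUnitalDGAlg k}
    (x : A ⟶ ((convFunctor k).obj (op C)).obj B) (g : B ⟶ B') :
    (convHomEquiv C.obj A B' (x ≫ ((convFunctor k).obj (op C)).map g)).1 =
      (convHomEquiv C.obj A B x).1 ≫ g.hom :=
  (convHomEquiv_comp_convMap x (𝟙 C.obj) g).trans (by simp)

/-- The universal measuring with given source `C ⊗ A`. -/
lemma exists_tensoring (C : NonCounitalDGCoalg k) (A : NonUnitalDGAlg k) :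
    ∃ (T : NonUnitalDGAlg k) (u : C.X ⊗ A.X ⟶ T.X), IsMeasuring C A T u ∧
      ∀ (B : NonUnitalDGAlg k) (v : C.X ⊗ A.X ⟶ B.X), IsMeasuring C A B v →
        ∃! g : T ⟶ B, u ≫ g.hom = v := by
  have hl : ∀ {B : NonUnitalDGAlg k} (f : free (C.X ⊗ A.X) ⟶ B),
      measuringDefect C A (free (C.X ⊗ A.X)) (letter (C.X ⊗ A.X)) ≫ f.hom =
        measuringDefect C A B (letter (C.X ⊗ A.X) ≫ f.hom) := fun f =>
    measuringDefect_comp_hom (B := free (C.X ⊗ A.X)) (letter (C.X ⊗ A.X)) f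
  -- The relations are the values of the defect of the inclusion of letters. By naturality of the
  -- defect, an algebra map kills them exactly when it restricts to a measuring on letters.
  obtain ⟨T, π, hπ, huniv⟩ := exists_quotient (free (C.X ⊗ A.X))
    (measuringDefect C A (free (C.X ⊗ A.X)) (letter (C.X ⊗ A.X)))
  refine ⟨T, letter (C.X ⊗ A.X) ≫ π.hom, measuringDefect_eq_zero.1 ((hl π).symm.trans hπ),
    fun B v hv => ?_⟩
  have hv' := letter_freeDesc v
  obtain ⟨g, hg, hg'⟩ := huniv B (freeDesc v) (by
    rw [hl, hv']
    exact measuringDefect_eq_zero.2 hv)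
  refine ⟨g, ?_, fun g' h => hg' g' (free_hom_ext ?_)⟩
  · exact (congrArg (fun F => letter (C.X ⊗ A.X) ≫ F.hom) hg).trans hv'
  · exact h.trans hv'.symm

/-- The canonical map from the cofree coalgebra on `Hom(A, B)`. -/
noncomputable def cofreeEval (A B : NonUnitalDGAlg k) :
    (NonCounitalDGCoalg.cofree (ihom A.X B.X)).X ⊗ A.X ⟶ B.X :=
  NonCounitalDGCoalg.cofreeπ (ihom A.X B.X) ▷ A.X ≫ ihomApply A.X B.X

lemma whiskerRight_cofreeEval {X : DGVec k} (A B : NonUnitalDGAlg k)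
    (f : X ⟶ (NonCounitalDGCoalg.cofree (ihom A.X B.X)).X) :
    f ▷ A.X ≫ cofreeEval A B =
      (f ≫ NonCounitalDGCoalg.cofreeπ (ihom A.X B.X)) ▷ A.X ≫ ihomApply A.X B.X :=
  (comp_whiskerRight_assoc _ _ _ _).symm

/-- By naturality in the coalgebra, the defect of the pulled-back pairing is the pullback of the
defect. Currying it makes the condition one on the image of `f` alone, to which
`exists_subcoalgebra` applies. -/
lemma isMeasuring_whiskerRight_cofreeEval {C : NonCounitalDGCoalg k} {A B : NonUnitalDGAlg k}
    (f : C ⟶ NonCounitalDGCoalg.cofree (ihom A.X B.X)) :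
    f.hom ≫ curry (measuringDefect _ A B (cofreeEval A B)) = 0 ↔
      IsMeasuring C A B (f.hom ▷ A.X ≫ cofreeEval A B) := by
  rw [← measuringDefect_eq_zero, ← whiskerRight_measuringDefect]
  constructor
  · intro h
    rw [← curry_ihomApply (measuringDefect _ A B (cofreeEval A B)), ← comp_whiskerRight_assoc, h,
      MonoidalPreadditive.zero_whiskerRight, Limits.zero_comp]
  · intro h
    apply ext_ihomApply
    rw [comp_whiskerRight_assoc, curry_ihomApply, h, MonoidalPreadditive.zero_whiskerRight,
      Limits.zero_comp]

/-- The universal measuring with given `A` and target `B`. -/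
lemma exists_enrichment (A B : NonUnitalDGAlg k) :
    ∃ (E : ConilDGCoalg k) (e : E.obj.X ⊗ A.X ⟶ B.X), IsMeasuring E.obj A B e ∧
      ∀ (C : ConilDGCoalg k) (v : C.obj.X ⊗ A.X ⟶ B.X), IsMeasuring C.obj A B v →
        ∃! g : C ⟶ E, g.hom.hom ▷ A.X ≫ e = v := by
  obtain ⟨D, i, hinj, hi, huniv⟩ := NonCounitalDGCoalg.exists_subcoalgebra
    (NonCounitalDGCoalg.cofree (ihom A.X B.X)) (curry (measuringDefect _ A B (cofreeEval A B)))
  have hD := (NonCounitalDGCoalg.isConilpotent_cofree _).of_injective i hinj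
  refine ⟨⟨D, hD⟩, i.hom ▷ A.X ≫ cofreeEval A B, (isMeasuring_whiskerRight_cofreeEval i).1 hi,
    fun C v hv => ?_⟩
  -- A pairing `v` is a linear map `C → [A, B]`, which extends uniquely to a coalgebra map into the
  -- cofree coalgebra. It is a measuring exactly when this map factors through `D`.
  obtain ⟨f, hf⟩ := NonCounitalDGCoalg.exists_cofree_lift C.property (curry v)
  have hfv : f.hom ▷ A.X ≫ cofreeEval A B = v := by
    rw [whiskerRight_cofreeEval, hf, curry_ihomApply]
  obtain ⟨g, hg, hg'⟩ := huniv C.obj f ((isMeasuring_whiskerRight_cofreeEval f).2 (hfv ▸ hv))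
  refine ⟨ObjectProperty.homMk g, ?_, fun g' h => ?_⟩
  · change g.hom ▷ A.X ≫ i.hom ▷ A.X ≫ cofreeEval A B = v
    rw [← hfv, ← hg, NonCounitalDGCoalg.comp_hom, comp_whiskerRight_assoc]
  · ext : 1
    refine hg' g'.hom (NonCounitalDGCoalg.cofree_hom_ext C.property ?_)
    refine Eq.trans (ext_ihomApply ?_) hf.symm
    rw [← whiskerRight_cofreeEval, curry_ihomApply, NonCounitalDGCoalg.comp_hom,
      comp_whiskerRight_assoc]
    exact h

variable (k) in
lemma isRightAdjoint_convFunctor_obj (C : ConilDGCoalg k) :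
    ((convFunctor k).obj (op C)).IsRightAdjoint := by
  choose T u hu huniv using exists_tensoring C.obj
  let e (A B : NonUnitalDGAlg k) : (T A ⟶ B) ≃ (A ⟶ ((convFunctor k).obj (op C)).obj B) :=
    (Equiv.ofBijective (fun g => (⟨u A ≫ g.hom, (hu A).comp_hom g⟩ :
      {v : C.obj.X ⊗ A.X ⟶ B.X // IsMeasuring C.obj A B v})) (by
        refine ⟨fun g g' h => ?_, fun v => ?_⟩
        · exact (huniv A B _ ((hu A).comp_hom g)).unique rfl (congrArg Subtype.val h).symm
        · obtain ⟨g, hg, -⟩ := huniv A B v.1 v.2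
          exact ⟨g, Subtype.ext hg⟩)).trans (convHomEquiv C.obj A B).symm
  have he : ∀ A B (g : T A ⟶ B), (convHomEquiv C.obj A B (e A B g)).1 = u A ≫ g.hom :=
    fun A B g => congrArg Subtype.val ((convHomEquiv C.obj A B).apply_symm_apply _)
  refine ⟨_, ⟨Adjunction.adjunctionOfEquivLeft e fun A B B' h g => ?_⟩⟩
  apply (convHomEquiv C.obj A B').injective
  apply Subtype.ext
  refine (he _ _ _).trans
    (Eq.trans ?_ (convHomEquiv_comp_convFunctor_obj_map (e A B g) h).symm)
  exact (Category.assoc _ _ _).symm.trans (congrArg (· ≫ h.hom) (he A B g).symm)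

/-- Maps out of `C ▷ A` are identified with measurings by `adj` and `convHomEquiv`, and measurings
with coalgebra maps into the universal coalgebra. Only naturality in `C` is then left to check. -/
lemma isLeftAdjoint_flip_obj {act : ConilDGCoalg k ⥤ NonUnitalDGAlg k ⥤ NonUnitalDGAlg k}
    (adj : act ⊣₂ convFunctor k) (A : NonUnitalDGAlg k) : (act.flip.obj A).IsLeftAdjoint := by
  choose E e he huniv using exists_enrichment A
  let m (C : ConilDGCoalg k) (B : NonUnitalDGAlg k) :
      (C ⟶ E B) ≃ {v : C.obj.X ⊗ A.X ⟶ B.X // IsMeasuring C.obj A B v} :=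
    Equiv.ofBijective (fun g => ⟨g.hom.hom ▷ A.X ≫ e B, (he B).whiskerRight_comp g.hom⟩) (by
      refine ⟨fun g g' h => ?_, fun v => ?_⟩
      · exact (huniv B C _ ((he B).whiskerRight_comp g.hom)).unique rfl
          (congrArg Subtype.val h).symm
      · obtain ⟨g, hg, -⟩ := huniv B C v.1 v.2
        exact ⟨g, Subtype.ext hg⟩)
  refine ⟨_, ⟨Adjunction.adjunctionOfEquivRight (G_obj := E) (fun C B =>
    (adj.homEquiv.trans (convHomEquiv C.obj A B)).trans (m C B).symm) fun C' C B f g => ?_⟩⟩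
  rw [Equiv.trans_apply, Equiv.symm_apply_eq]
  apply Subtype.ext
  change (convHomEquiv C'.obj A B (adj.homEquiv ((act.map f).app A ≫ g))).1 =
    (f ≫ (m C B).symm (convHomEquiv C.obj A B (adj.homEquiv g))).hom.hom ▷ A.X ≫ e B
  have h : ((m C B).symm (convHomEquiv C.obj A B (adj.homEquiv g))).hom.hom ▷ A.X ≫ e B =
      (convHomEquiv C.obj A B (adj.homEquiv g)).1 :=
    congrArg Subtype.val ((m C B).apply_symm_apply _)
  refine (congrArg (fun x => (convHomEquiv C'.obj A B x).1)
    (adj.homEquiv_naturality_one f g)).trans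
    ((convHomEquiv_comp_convFunctor_map_app (adj.homEquiv g) f).trans ?_)
  exact (congrArg (f.hom.hom ▷ A.X ≫ ·) h.symm).trans (comp_whiskerRight_assoc _ _ _ _).symm

variable (k) in
lemma exists_tensoring_enrichment :
    ∃ (act : ConilDGCoalg k ⥤ NonUnitalDGAlg k ⥤ NonUnitalDGAlg k)
      (enr : (NonUnitalDGAlg k)ᵒᵖ ⥤ NonUnitalDGAlg k ⥤ ConilDGCoalg k),
      Nonempty (act ⊣₂ convFunctor k) ∧ Nonempty (act.flip ⊣₂ enr) := by
  obtain ⟨act, ⟨adj⟩⟩ := ParametrizedAdjunction.exists_left (convFunctor k)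
    (isRightAdjoint_convFunctor_obj k)
  obtain ⟨enr, hE⟩ := ParametrizedAdjunction.exists_right act.flip (isLeftAdjoint_flip_obj adj)
  exact ⟨act, enr, ⟨adj⟩, hE⟩

end NonUnitalDGAlg


/-! ### The module structure -/

namespace CategoryTheory.MonoidalCategory

variable {M : Type*} [Category M] [MonoidalCategory M]

/-- The formal content of naturality of the module associator, with arbitrary maps in place of the
universal measurings: all sides, precomposed with `v`, reduce to naturality of `α`. -/
lemma associator_naturality_of_eq {X X' Y Y' Z Z' P P' Q Q' R R' : M}
    {f : X ⟶ X'} {g : Y ⟶ Y'} {h : Z ⟶ Z'}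
    {u : Y ⊗ Z ⟶ P} {u' : Y' ⊗ Z' ⟶ P'} {w : X ⊗ P ⟶ Q} {w' : X' ⊗ P' ⟶ Q'}
    {v : (X ⊗ Y) ⊗ Z ⟶ R} {v' : (X' ⊗ Y') ⊗ Z' ⟶ R'} {a : R ⟶ Q} {a' : R' ⟶ Q'}
    (ha : v ≫ a = (α_ X Y Z).hom ≫ X ◁ u ≫ w)
    (ha' : v' ≫ a' = (α_ X' Y' Z').hom ≫ X' ◁ u' ≫ w')
    {b : R ⟶ R'} {c : P ⟶ P'} {d : Q ⟶ Q'} (hb : v ≫ b = ((f ⊗ₘ g) ⊗ₘ h) ≫ v')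
    (hc : u ≫ c = (g ⊗ₘ h) ≫ u') (hd : w ≫ d = (f ⊗ₘ c) ≫ w') :
    v ≫ b ≫ a' = v ≫ a ≫ d := by
  rw [reassoc_of% hb, ha', reassoc_of% ha, hd, associator_naturality_assoc,
    ← id_tensorHom X u, tensorHom_comp_tensorHom_assoc, hc, Category.id_comp, ← id_tensorHom X' u',
    tensorHom_comp_tensorHom_assoc, Category.comp_id]

/-- The formal content of the module pentagon: precomposed with `v`, it becomes the pentagon of the
ambient monoidal category. -/
lemma pentagon_of_eq {X Y Z W P Q R S T U V N : M} {p : Z ⊗ W ⟶ P} {q : Y ⊗ P ⟶ Q}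
    {r : X ⊗ Q ⟶ R} {s : (Y ⊗ Z) ⊗ W ⟶ S} {t : X ⊗ S ⟶ T} {u : (X ⊗ Y ⊗ Z) ⊗ W ⟶ U}
    {v : ((X ⊗ Y) ⊗ Z) ⊗ W ⟶ V} {n : (X ⊗ Y) ⊗ P ⟶ N}
    {a : S ⟶ Q} {b : U ⟶ T} {c : T ⟶ R} {d : V ⟶ U} {e : V ⟶ N} {f : N ⟶ R}
    (ha : s ≫ a = (α_ Y Z W).hom ≫ Y ◁ p ≫ q)
    (hb : u ≫ b = (α_ X (Y ⊗ Z) W).hom ≫ X ◁ s ≫ t) (hc : t ≫ c = X ◁ a ≫ r)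
    (hd : v ≫ d = (α_ X Y Z).hom ▷ W ≫ u)
    (he : v ≫ e = (α_ (X ⊗ Y) Z W).hom ≫ (X ⊗ Y) ◁ p ≫ n)
    (hf : n ≫ f = (α_ X Y P).hom ≫ X ◁ q ≫ r) :
    v ≫ d ≫ b ≫ c = v ≫ e ≫ f := by
  rw [reassoc_of% hd, reassoc_of% hb, hc, reassoc_of% he, hf,
    ← whiskerLeft_comp_assoc X s a, ha]
  simp only [MonoidalCategory.whiskerLeft_comp, Category.assoc, pentagon_assoc]
  simp

end CategoryTheory.MonoidalCategory

namespace NonUnitalDGAlg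

open DGVec

section univMeasuring

variable {k : Type u} [Field k] {act : ConilDGCoalg k ⥤ NonUnitalDGAlg k ⥤ NonUnitalDGAlg k}
  (adj : act ⊣₂ convFunctor k)

lemma isMeasuring_univMeasuring (C : ConilDGCoalg k) (A : NonUnitalDGAlg k) :
    IsMeasuring C.obj A ((act.obj C).obj A) (univMeasuring adj C A) :=
  (convHomEquiv C.obj A _ (adj.homEquiv (𝟙 _))).2

/-- By the Yoneda lemma, the given bijection, read in terms of measurings, is composition with the
image of the identity. Thus `univMeasuring` is universal, whatever adjunction was given. -/
lemma convHomEquiv_homEquiv {C : ConilDGCoalg k} {A B : NonUnitalDGAlg k}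
    (f : (act.obj C).obj A ⟶ B) :
    (convHomEquiv C.obj A B (adj.homEquiv f)).1 = univMeasuring adj C A ≫ f.hom := by
  have h := adj.homEquiv_naturality_three f (𝟙 ((act.obj C).obj A))
  rw [Category.id_comp] at h
  exact (congrArg (fun x => (convHomEquiv C.obj A B x).1) h).trans
    (convHomEquiv_comp_convFunctor_obj_map _ f)

lemma univMeasuring_ext {C : ConilDGCoalg k} {A B : NonUnitalDGAlg k}
    {f g : (act.obj C).obj A ⟶ B}
    (h : univMeasuring adj C A ≫ f.hom = univMeasuring adj C A ≫ g.hom) : f = g :=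
  adj.homEquiv.injective ((convHomEquiv C.obj A B).injective (Subtype.ext
    ((convHomEquiv_homEquiv adj f).trans (h.trans (convHomEquiv_homEquiv adj g).symm))))

lemma exists_univMeasuring_comp {C : ConilDGCoalg k} {A B : NonUnitalDGAlg k}
    {v : C.obj.X ⊗ A.X ⟶ B.X} (hv : IsMeasuring C.obj A B v) :
    ∃ f : (act.obj C).obj A ⟶ B, univMeasuring adj C A ≫ f.hom = v := by
  refine ⟨adj.homEquiv.symm ((convHomEquiv C.obj A B).symm ⟨v, hv⟩), ?_⟩
  refine (convHomEquiv_homEquiv adj _).symm.trans ?_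
  refine (congrArg (fun x => (convHomEquiv C.obj A B x).1) (adj.homEquiv.apply_symm_apply _)).trans
    ?_
  exact congrArg Subtype.val ((convHomEquiv C.obj A B).apply_symm_apply ⟨v, hv⟩)

lemma univMeasuring_comp_act_map_app {C C' : ConilDGCoalg k} (h : C ⟶ C')
    (A : NonUnitalDGAlg k) :
    univMeasuring adj C A ≫ ((act.map h).app A).hom = h.hom.hom ▷ A.X ≫ univMeasuring adj C' A := by
  refine (convHomEquiv_homEquiv adj ((act.map h).app A)).symm.trans ?_
  have e := adj.homEquiv_naturality_one h (𝟙 ((act.obj C').obj A))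
  rw [Category.comp_id] at e
  exact (congrArg (fun x => (convHomEquiv C.obj A _ x).1) e).trans
    (convHomEquiv_comp_convFunctor_map_app _ h)

lemma univMeasuring_comp_act_obj_map (C : ConilDGCoalg k) {A A' : NonUnitalDGAlg k}
    (f : A ⟶ A') :
    univMeasuring adj C A ≫ ((act.obj C).map f).hom = C.obj.X ◁ f.hom ≫ univMeasuring adj C A' := by
  refine (convHomEquiv_homEquiv adj ((act.obj C).map f)).symm.trans ?_
  have e := adj.homEquiv_naturality_two f (𝟙 ((act.obj C).obj A'))
  rw [Category.comp_id] at e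
  exact (congrArg (fun x => (convHomEquiv C.obj A _ x).1) e).trans (convHomEquiv_comp f _)

lemma univMeasuring_comp_act_bimap {C C' : ConilDGCoalg k} {A A' : NonUnitalDGAlg k}
    (h : C ⟶ C') (f : A ⟶ A') :
    univMeasuring adj C A ≫ (act.bimap h f).hom =
      (h.hom.hom ⊗ₘ f.hom) ≫ univMeasuring adj C' A' := by
  rw [Functor.bimap, comp_hom, ← Category.assoc, univMeasuring_comp_act_map_app, Category.assoc,
    univMeasuring_comp_act_obj_map, MonoidalCategory.tensorHom_def, Category.assoc]

/-- The composite of two universal measurings still separates algebra maps: transposing along `C`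
gives maps out of `D ▷ A` into `{C, B}`, which `univMeasuring_ext` distinguishes. -/
lemma univMeasuring_ext₂ {C D : ConilDGCoalg k} {A B : NonUnitalDGAlg k}
    {f g : (act.obj C).obj ((act.obj D).obj A) ⟶ B}
    (h : C.obj.X ◁ univMeasuring adj D A ≫ univMeasuring adj C _ ≫ f.hom =
      C.obj.X ◁ univMeasuring adj D A ≫ univMeasuring adj C _ ≫ g.hom) : f = g := by
  have e (f : (act.obj C).obj ((act.obj D).obj A) ⟶ B) :
      C.obj.X ◁ (univMeasuring adj D A ≫ (adj.homEquiv f).hom) ≫ ihomEval C.obj.X B.X =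
        C.obj.X ◁ univMeasuring adj D A ≫ univMeasuring adj C _ ≫ f.hom :=
    (MonoidalCategory.whiskerLeft_comp_assoc _ _ _ _).trans
      (congrArg (C.obj.X ◁ univMeasuring adj D A ≫ ·) (convHomEquiv_homEquiv adj f))
  exact adj.homEquiv.injective (univMeasuring_ext adj
    (ext_ihomEval ((e f).trans (h.trans (e g).symm))))

/-- Measurings of `C ⊗ D` with values in `B` are the same as measurings of `D` with values in `{C,
B}`, so the two objects have the same universal property. -/
lemma exists_assoc (C D : ConilDGCoalg k) (A : NonUnitalDGAlg k) :
    ∃ a : (act.obj (((ConilDGCoalg.tensorFunctor k).obj C).obj D)).obj A ≅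
        (act.obj C).obj ((act.obj D).obj A),
      univMeasuring adj (((ConilDGCoalg.tensorFunctor k).obj C).obj D) A ≫ a.hom.hom =
        (α_ C.obj.X D.obj.X A.X).hom ≫ C.obj.X ◁ univMeasuring adj D A ≫
          univMeasuring adj C ((act.obj D).obj A) := by
  let CD := ((ConilDGCoalg.tensorFunctor k).obj C).obj D
  obtain ⟨a, ha⟩ := exists_univMeasuring_comp adj (C := CD) (IsMeasuring.comp
    (isMeasuring_univMeasuring adj D A) (isMeasuring_univMeasuring adj C ((act.obj D).obj A)))
  -- For the inverse, the universal measuring of `C ⊗ D` is curried in `C`. This gives a measuring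
  -- of `D` into a convolution algebra, hence a map `g` on `D ▷ A`, whose transpose is `b`.
  have hn : (α_ C.obj.X D.obj.X A.X).hom ≫
      C.obj.X ◁ curryLeft ((α_ C.obj.X D.obj.X A.X).inv ≫ univMeasuring adj CD A) ≫
        ihomEval C.obj.X ((act.obj CD).obj A).X = univMeasuring adj CD A :=
    (congrArg ((α_ C.obj.X D.obj.X A.X).hom ≫ ·) (curryLeft_ihomEval _)).trans
      (Iso.hom_inv_id_assoc _ _)
  obtain ⟨g, hg⟩ := exists_univMeasuring_comp adj (IsMeasuring.of_comp_ihomEval (C := C.obj)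
    (D := D.obj) (A := A) (B := (act.obj CD).obj A)
    (n := curryLeft ((α_ C.obj.X D.obj.X A.X).inv ≫ univMeasuring adj CD A))
    ((congrArg (IsMeasuring CD.obj A _) hn).mpr (isMeasuring_univMeasuring adj CD A)))
  obtain ⟨b, rfl⟩ := (adj.homEquiv (X₁ := C)).surjective g
  have hb : C.obj.X ◁ univMeasuring adj D A ≫ univMeasuring adj C _ ≫ b.hom =
      (α_ C.obj.X D.obj.X A.X).inv ≫ univMeasuring adj CD A :=
    (congrArg (C.obj.X ◁ univMeasuring adj D A ≫ ·) (convHomEquiv_homEquiv adj b).symm).trans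
      ((MonoidalCategory.whiskerLeft_comp_assoc _ _ _ _).symm.trans
        ((congrArg (fun x => C.obj.X ◁ x ≫ ihomEval C.obj.X ((act.obj CD).obj A).X) hg).trans
          (curryLeft_ihomEval _)))
  have hab : univMeasuring adj CD A ≫ a.hom ≫ b.hom = univMeasuring adj CD A := by
    rw [← Category.assoc, ha]
    exact (Category.assoc _ _ _).trans ((congrArg ((α_ C.obj.X D.obj.X A.X).hom ≫ ·)
      ((Category.assoc _ _ _).trans hb)).trans (Iso.hom_inv_id_assoc _ _))
  have hba : C.obj.X ◁ univMeasuring adj D A ≫ univMeasuring adj C _ ≫ b.hom ≫ a.hom =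
      C.obj.X ◁ univMeasuring adj D A ≫ univMeasuring adj C _ := by
    refine Eq.trans ?_ ((congrArg ((α_ C.obj.X D.obj.X A.X).inv ≫ ·) ha).trans
      (Iso.inv_hom_id_assoc _ _))
    refine Eq.trans ?_ ((congrArg (· ≫ a.hom) hb).trans (Category.assoc _ _ _))
    simp only [Category.assoc]
  exact ⟨⟨a, b, univMeasuring_ext adj (hab.trans (Category.comp_id _).symm),
    univMeasuring_ext₂ adj (hba.trans (congrArg _ (Category.comp_id _).symm))⟩, ha⟩

lemma exists_semiModule : ∃ S : SemiModule act, ∀ (C D : ConilDGCoalg k) (A : NonUnitalDGAlg k),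
    univMeasuring adj (((ConilDGCoalg.tensorFunctor k).obj C).obj D) A ≫ (S.assoc C D A).hom.hom =
      (α_ C.obj.X D.obj.X A.X).hom ≫ C.obj.X ◁ univMeasuring adj D A ≫
        univMeasuring adj C ((act.obj D).obj A) := by
  choose a ha using exists_assoc adj
  refine ⟨⟨a, fun {C C' D D' A A'} f g h => univMeasuring_ext adj ?_,
    fun C D E A => univMeasuring_ext adj ?_⟩, ha⟩
  · have hb := univMeasuring_comp_act_bimap adj ((ConilDGCoalg.tensorFunctor k).bimap f g) h
    rw [ConilDGCoalg.tensorFunctor_bimap_hom] at hb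
    exact associator_naturality_of_eq (ha C D A) (ha C' D' A') hb
      (univMeasuring_comp_act_bimap adj g h) (univMeasuring_comp_act_bimap adj f (act.bimap g h))
  · exact pentagon_of_eq (ha D E A) (ha C _ A) (univMeasuring_comp_act_obj_map adj C _)
      (univMeasuring_comp_act_map_app adj _ A) (ha _ E A) (ha C D _)

end univMeasuring

/-- The adjunction between `{-, B}` and the enrichment into `B`. -/
noncomputable def convAdjunction {k : Type u} [Field k]
    {act : ConilDGCoalg k ⥤ NonUnitalDGAlg k ⥤ NonUnitalDGAlg k}
    {enr : (NonUnitalDGAlg k)ᵒᵖ ⥤ NonUnitalDGAlg k ⥤ ConilDGCoalg k}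
    (cotAdj : act ⊣₂ convFunctor k) (enrAdj : act.flip ⊣₂ enr) (B : NonUnitalDGAlg k) :
    ((convFunctor k).flip.obj B).rightOp ⊣ enr.flip.obj B :=
  Adjunction.mkOfHomEquiv
    { homEquiv C A := (opEquiv _ _).trans
        ((cotAdj.homEquiv (X₁ := C) (X₂ := A.unop) (X₃ := B)).symm.trans
          (enrAdj.homEquiv (X₁ := A.unop) (X₂ := C) (X₃ := B)))
      homEquiv_naturality_left_symm f g := Quiver.Hom.unop_inj
        ((congrArg cotAdj.homEquiv (enrAdj.homEquiv_symm_naturality_two f g)).trans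
          (cotAdj.homEquiv_naturality_one f _))
      homEquiv_naturality_right f g :=
        (congrArg enrAdj.homEquiv (cotAdj.homEquiv_symm_naturality_two g.unop f.unop)).trans
          (enrAdj.homEquiv_naturality_one g.unop _) }

end NonUnitalDGAlg

theorem mainTheorem6 (k : Type u) [Field k] :
    (∃ (act : ConilDGCoalg k ⥤ NonUnitalDGAlg k ⥤ NonUnitalDGAlg k)
      (enr : (NonUnitalDGAlg k)ᵒᵖ ⥤ NonUnitalDGAlg k ⥤ ConilDGCoalg k),
      Nonempty (act ⊣₂ NonUnitalDGAlg.convFunctor k) ∧ Nonempty (act.flip ⊣₂ enr)) ∧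
    ∀ (act : ConilDGCoalg k ⥤ NonUnitalDGAlg k ⥤ NonUnitalDGAlg k)
      (enr : (NonUnitalDGAlg k)ᵒᵖ ⥤ NonUnitalDGAlg k ⥤ ConilDGCoalg k)
      (cotAdj : act ⊣₂ NonUnitalDGAlg.convFunctor k) (enrAdj : act.flip ⊣₂ enr),
      (∃ S : ClosedSemiModule act enr (NonUnitalDGAlg.convFunctor k),
        S.cotAdj = cotAdj ∧ S.enrAdj = enrAdj ∧
        ∀ (C D : ConilDGCoalg k) (A : NonUnitalDGAlg k)
          (g : (act.obj (((ConilDGCoalg.tensorFunctor k).obj C).obj D)).obj A ⟶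
            (act.obj C).obj ((act.obj D).obj A)),
          NonUnitalDGAlg.univMeasuring cotAdj (((ConilDGCoalg.tensorFunctor k).obj C).obj D) A ≫
              g.hom =
            (α_ C.obj.X D.obj.X A.X).hom ≫
              C.obj.X ◁ NonUnitalDGAlg.univMeasuring cotAdj D A ≫
                NonUnitalDGAlg.univMeasuring cotAdj C ((act.obj D).obj A) ↔
          g = (S.assoc C D A).hom) ∧
      ∃ θ : ∀ B : NonUnitalDGAlg k,
          ((NonUnitalDGAlg.convFunctor k).flip.obj B).rightOp ⊣ enr.flip.obj B,
        ∀ (C : ConilDGCoalg k) (A B : NonUnitalDGAlg k) (f : (act.obj C).obj A ⟶ B),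
          (θ B).homEquiv C (op A) (cotAdj.homEquiv f).op = enrAdj.homEquiv f := by
  refine ⟨NonUnitalDGAlg.exists_tensoring_enrichment k, fun act enr cotAdj enrAdj => ⟨?_, ?_⟩⟩
  · obtain ⟨S, hS⟩ := NonUnitalDGAlg.exists_semiModule cotAdj
    -- The associator satisfies the equation by `hS`. Any other solution equals it because algebra
    -- maps out of the tensoring are determined by the universal measuring.
    refine ⟨⟨S, cotAdj, enrAdj⟩, rfl, rfl, fun C D A g => ⟨fun h => ?_, ?_⟩⟩
    · exact NonUnitalDGAlg.univMeasuring_ext cotAdj (h.trans (hS C D A).symm)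
    · rintro rfl
      exact hS C D A
  · refine ⟨NonUnitalDGAlg.convAdjunction cotAdj enrAdj, fun C A B f => ?_⟩
    rw [NonUnitalDGAlg.convAdjunction, Adjunction.mkOfHomEquiv_homEquiv]
    exact congrArg enrAdj.homEquiv (cotAdj.homEquiv.symm_apply_apply f)
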